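/- Let $X$ be a finite alphabet with $|X|\ge 2$ and let $G$ be a self-similar group over $X$: a group acting faithfully on the set $X^*$ of finite words by length-preserving permutations such that for all $g\in G$, $x\in X$ there is $g|_x\in G$ (the section of $g$ at $x$) with $g(xw)=g(x)\,g|_x(w)$ for all $w\in X^*$; put $g|_{xv}=(g|_x)|_v$. A finite automaton in $G$ is a finite subset of $G$ closed under taking sections; its state diagram is the digraph whose vertices are its elements, with an edge $a\to a|_x$ labelled $x\mid a(x)$ for each state $a$ and letter $x$. The group $G$ is contracting if there is a finite automaton $N\subseteq G$ such that for every $g\in G$ there is $n$ with $g|_w\in N$ for all words $w$ of length $n$. For a field $K$, the Nekrashevych algebra $N_K(G,X)$ is the unital $*$-algebra over $K$ (with trivial involution on $K$) generated by $X\cup G$, where the identity of $G$ is the identity of the algebra, with relations $g^*=g^{-1}$, $g\cdot h=gh$, $gx=g(x)\,g|_x$, $y^*x=\delta_{x,y}$ and $\sum_{x\in X}xx^*=1$ for $g,h\in G$ and $x,y\in X$. **Theorem.** Suppose that $G$ is contracting and is generated by a finite automaton $A$, given by its state diagram. Then the simplicity of $N_K(G,X)$ depends only on the characteristic of $K$.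 Either $N_K(G,X)$ is non-simple for every field $K$, or there is a finite set $P$ of primes such that, for every field $K$, the algebra $N_K(G,X)$ is simple if and only if the characteristic of $K$ is not in $P$. Furthermore, there is a single algorithm which, given as input the state diagram of any finite automaton $A$ generating a contracting self-similar group $G$ over a finite alphabet $X$ with $|X|\ge 2$, halts, decides which of the two cases holds and, in the second case, outputs the finite set $P$. -/

import Mathlib

universe u v w w'

/-- A self-similar group `G` over the alphabet `X`: a faithful action of `G` on the set of finite
words over `X` by length-preserving permutations such that for all `g` and every letter `x`
there is an element `h` of `G` (the section of `g` at `x`) with `g(xw) = g(x) h(w)` for all words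
`w`. -/
class SelfSimilarGroup (G X : Type*) [Group G] [MulAction G (List X)] : Prop
    extends FaithfulSMul G (List X) where
  length_smul : ∀ (g : G) (w : List X), (g • w).length = w.length
  exists_section : ∀ (g : G) (x : X), ∃ h : G, ∀ w : List X,
    g • (x :: w) = (g • [x]) ++ (h • w)

namespace SelfSimilarGroup

section Basic

variable {G X : Type*} [Group G] [MulAction G (List X)] [SelfSimilarGroup G X]

/-- The image `g(x)` of the letter `x` under `g`, as a letter. -/
def letter (g : G) (x : X) : X :=
  (g • [x]).head (by
    intro h
    have h1 := length_smul g [x]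
    rw [h] at h1
    simp at h1)

/-- The section `g|_x` of `g` at the letter `x`. -/
noncomputable def sect (g : G) (x : X) : G := Classical.choose (exists_section g x)

theorem smul_singleton (g : G) (x : X) : g • [x] = [letter g x] := by
  obtain ⟨y, hy⟩ := List.length_eq_one_iff.mp (length_smul g [x])
  simp [letter, hy]

theorem smul_cons (g : G) (x : X) (w : List X) :
    g • (x :: w) = letter g x :: (sect g x • w) := by
  have h : g • (x :: w) = (g • [x]) ++ (sect g x • w) :=
    Classical.choose_spec (exists_section g x) w
  rwa [smul_singleton] at h

/-- The section `g|_w` of `g` at the word `w`: `g|_{xv} = (g|_x)|_v`. -/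
noncomputable def sectWord (g : G) : List X → G
  | [] => g
  | x :: v => sectWord (sect g x) v

end Basic

/-- A (finite) automaton in `G`: a finite subset of `G` closed under taking sections. -/
structure Automaton (G X : Type*) [Group G] [MulAction G (List X)] [SelfSimilarGroup G X] where
  states : Finset G
  sect_mem : ∀ a ∈ states, ∀ x : X, sect a x ∈ states

/-- `G` is contracting: there is a finite automaton `N` in `G` such that for every `g` there
is `n` for which all sections of `g` at words of length `n` lie in `N`. -/
def IsContracting (G X : Type*) [Group G] [MulAction G (List X)] [SelfSimilarGroup G X] : Prop :=
  ∃ N : Automaton G X, ∀ g : G, ∃ n : ℕ, ∀ w : List X, w.length = n → sectWord g w ∈ N.states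

/-- The automaton `A` generates the group `G`. -/
def Automaton.Generates {G X : Type*} [Group G] [MulAction G (List X)] [SelfSimilarGroup G X]
    (A : Automaton G X) : Prop :=
  Subgroup.closure (A.states : Set G) = ⊤

/-- The state diagram of the automaton `A` as finite data, relative to an enumeration of
the alphabet as `0, …, d - 1` and of the states as `0, …, n - 1`: the number `d`, together with the
table whose entry in row `i` and column `j` is the pair (number of the letter `a(x)`, number of the
state `a|_x`), where `a` is the state with number `i` and `x` is the letter with number `j`;
this entry is the edge from `a` to `a|_x` labelled by `x | a(x)`. -/
noncomputable def Automaton.stateDiagram {G X : Type*} [Group G] [MulAction G (List X)]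
    [SelfSimilarGroup G X] (A : Automaton G X) {d n : ℕ} (eX : Fin d ≃ X)
    (eA : Fin n ≃ A.states) : ℕ × List (List (ℕ × ℕ)) :=
  (d, List.ofFn fun i : Fin n => List.ofFn fun j : Fin d =>
    (((eX.symm (letter (eA i : G) (eX j)) : Fin d) : ℕ),
      ((eA.symm ⟨sect (eA i : G) (eX j), A.sect_mem _ (eA i).2 _⟩ : Fin n) : ℕ)))

/-- Generators of the Nekrashevych algebra: the letters `x`, their adjoints `x^*`, and the
elements `g` of the group. The adjoint of the generator `g` is the generator `g⁻¹`. -/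
inductive NekGen (G X : Type*) : Type _
  | letter (x : X) : NekGen G X
  | letterStar (x : X) : NekGen G X
  | elt (g : G) : NekGen G X

/-- The generator of the free algebra that corresponds to the letter `x`. -/
def gX (K : Type*) [Field K] (G : Type*) {X : Type*} (x : X) : FreeAlgebra K (NekGen G X) :=
  FreeAlgebra.ι K (NekGen.letter x)

/-- The generator of the free algebra that corresponds to `x^*`. -/
def gXs (K : Type*) [Field K] (G : Type*) {X : Type*} (x : X) : FreeAlgebra K (NekGen G X) :=
  FreeAlgebra.ι K (NekGen.letterStar x)

/-- The generator of the free algebra that corresponds to the group element `g`. -/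
def gG (K : Type*) [Field K] {G : Type*} (X : Type*) (g : G) : FreeAlgebra K (NekGen G X) :=
  FreeAlgebra.ι K (NekGen.elt g)

/-- The defining relations of the Nekrashevych algebra as a `*`-algebra. The set of relations is
closed under `*` (which reverses products, exchanges `x` and `x^*`, and sends `g` to `g⁻¹`), so that
the algebra they present is the `*`-algebra they present. -/
inductive NekRel (K : Type*) [Field K] (G X : Type*) [Fintype X] [Group G]
    [MulAction G (List X)] [SelfSimilarGroup G X] :
    FreeAlgebra K (NekGen G X) → FreeAlgebra K (NekGen G X) → Prop
  /-- the identity of `G` is the identity of the algebra -/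
  | one : NekRel K G X (gG K X 1) 1
  /-- `g · h = gh` -/
  | mul (g h : G) : NekRel K G X (gG K X g * gG K X h) (gG K X (g * h))
  /-- `g x = g(x) g|_x` -/
  | ss (g : G) (x : X) : NekRel K G X (gG K X g * gX K G x)
      (gX K G (SelfSimilarGroup.letter g x) * gG K X (sect g x))
  /-- the adjoint `x^* g⁻¹ = (g|_x)⁻¹ g(x)^*` of the previous relation -/
  | ss_star (g : G) (x : X) : NekRel K G X (gXs K G x * gG K X g⁻¹)
      (gG K X (sect g x)⁻¹ * gXs K G (SelfSimilarGroup.letter g x))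
  /-- `x^* x = 1` -/
  | ck1_same (x : X) : NekRel K G X (gXs K G x * gX K G x) 1
  /-- `y^* x = 0` for distinct letters `x`, `y` -/
  | ck1_ne (x y : X) : x ≠ y → NekRel K G X (gXs K G y * gX K G x) 0
  /-- the sum of `x x^*` over all letters `x` equals `1` -/
  | ck2 : NekRel K G X (∑ x : X, gX K G x * gXs K G x) 1

/-- The Nekrashevych algebra of the self-similar group `G` over the finite alphabet `X`, with
coefficients in the field `K`. -/
abbrev NekrashevychAlgebra (K : Type*) [Field K] (G X : Type*) [Fintype X] [Group G]
    [MulAction G (List X)] [SelfSimilarGroup G X] :=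
  RingQuot (NekRel K G X)

end SelfSimilarGroup

/-! A pair `(u, g)` stands for the product u g in the algebra. Right multiplication by a word w
turns it into the pair (u g(w), g|_w), which is `rt w`. Multiplied on the right by long enough
words, every element of the algebra becomes a formal sum of pairs. A formal sum is zero in the
algebra exactly when all long words annihilate it (`toNek_eq_zero_iff`); it is singular when every
word has an annihilating extension. Singular elements form a proper ideal. Conversely, if no
extension of v annihilates a, then some a v w is a sum of terms u g with pairwise incomparable words
u, and u^* isolates a nonzero multiple of a group element, so a generates the whole algebra. Hence
simplicity means that singular elements vanish (`isSimpleRing_iff_noSing`).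

This condition depends only on the prime field, and in characteristic zero it can be tested over the
integers, that is, over `ZMod 0` (`noSing_iff_zmod`). If it holds modulo one prime p, an integral
singular sum can be divided by p again and again after translation, so it holds over the integers
too (`noSing_int_of_zmod`). Failure in characteristic zero therefore forces failure for every field.

Contraction reduces the question to combinations f of a finite family of group elements
(`noSing_of_family`). A word w partitions the indices according to the pairs (g_i(w), g_i|_w), and w
annihilates f iff f sums to zero over each class, that is, f is orthogonal to the indicator vectors
`row`. For singular f it is enough to look at resolving words. So `NoSing` over `ZMod p` says that
for some n all rows at words of length n lie in the span of the resolving rows, up to a denominator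
that is nonzero modulo p (`exists_forall_row_mem`, `noSing_of_forall_row_mem`). In characteristic
zero these finitely many relations have a common denominator D and survive modulo every prime not
dividing D; only the prime divisors of D can be exceptional.

Both alternatives have finite witnesses that can be checked on the state diagram. Vanishing is
witnessed by such linear relations. Non-vanishing is witnessed by a combination f, an annihilating
extension for each of the finitely many states of words, and a nonempty set of words that do not
annihilate f and that can always be prolonged, up to equality of states, inside the set. The checks
are primitive recursive, and an unbounded search halts because a witness of one kind always exists
(`Interp.exists_check`). -/

namespace SelfSimilarGroup

/-! ### Sections, and right translation of pairs by words -/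

section Words

variable {G X : Type*} [Group G] [MulAction G (List X)] [SelfSimilarGroup G X]

theorem smul_nil (g : G) : g • ([] : List X) = [] :=
  List.length_eq_zero_iff.mp (by rw [length_smul]; rfl)

theorem smul_append (g : G) (v w : List X) : g • (v ++ w) = g • v ++ sectWord g v • w := by
  induction v generalizing g with
  | nil => simp [smul_nil, sectWord]
  | cons x v ih => simp [smul_cons, sectWord, ih]

theorem sectWord_append (g : G) (v w : List X) :
    sectWord g (v ++ w) = sectWord (sectWord g v) w := by
  induction v generalizing g with
  | nil => rfl
  | cons x v ih => simp [sectWord, ih]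

theorem ext_smul (X : Type*) [MulAction G (List X)] [SelfSimilarGroup G X] {g h : G}
    (H : ∀ w : List X, g • w = h • w) : g = h :=
  FaithfulSMul.eq_of_smul_eq_smul H

theorem sectWord_mul (g h : G) (w : List X) :
    sectWord (g * h) w = sectWord g (h • w) * sectWord h w := by
  refine ext_smul X fun z => ?_
  have h1 := smul_append (g * h) w z
  rw [mul_smul, mul_smul, smul_append h, smul_append g] at h1
  rw [mul_smul]
  exact (List.append_cancel_left h1).symm

theorem sectWord_one (w : List X) : sectWord (1 : G) w = 1 := by
  have h := sectWord_mul (1 : G) 1 w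
  rw [mul_one, one_smul] at h
  exact left_eq_mul.mp h

theorem sectWord_inv (g : G) (w : List X) : sectWord g⁻¹ (g • w) = (sectWord g w)⁻¹ := by
  have h := sectWord_mul g⁻¹ g w
  rw [inv_mul_cancel, sectWord_one] at h
  exact eq_inv_of_mul_eq_one_left h.symm

theorem sect_inv (g : G) (x : X) : sect g⁻¹ (letter g x) = (sect g x)⁻¹ := by
  have := sectWord_inv g [x]
  rwa [smul_singleton] at this

theorem letter_inv (g : G) (x : X) : letter g⁻¹ (letter g x) = x := by
  have : g⁻¹ • g • [x] = [x] := inv_smul_smul g [x]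
  rw [smul_singleton, smul_singleton] at this
  simpa using this

theorem letter_mul (g h : G) (x : X) : letter (g * h) x = letter g (letter h x) := by
  have : (g * h) • [x] = g • h • [x] := mul_smul g h [x]
  simpa [smul_singleton] using this

theorem sect_mul (g h : G) (x : X) : sect (g * h) x = sect g (letter h x) * sect h x := by
  have := sectWord_mul g h [x]
  rwa [smul_singleton] at this

/-- The pair of the image of `w` under `g` and the section of `g` at `w`. -/
noncomputable def pt (g : G) (w : List X) : List X × G := (g • w, sectWord g w)

/-- Right translation by the word `w` in the monoid of pairs `(u, g)`, where `(u, g)` stands for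
`w' ↦ u g(w')`. -/
noncomputable def rt (w : List X) (t : List X × G) : List X × G :=
  (t.1 ++ t.2 • w, sectWord t.2 w)

theorem rt_nil (t : List X × G) : rt [] t = t := by
  simp [rt, smul_nil, sectWord]

theorem rt_append (v w : List X) (t : List X × G) : rt (v ++ w) t = rt w (rt v t) := by
  simp [rt, smul_append, sectWord_append]

theorem rt_comp (v w : List X) :
    (rt w ∘ rt v : List X × G → List X × G) = rt (v ++ w) := by
  funext t; simp [rt_append]

theorem length_rt (w : List X) (t : List X × G) : (rt w t).1.length = t.1.length + w.length := by
  simp [rt, length_smul]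

theorem pt_eq_rt (g : G) (w : List X) : pt g w = rt w ([], g) := by simp [pt, rt]

/-- Two words are incomparable if neither extends the other. -/
def Incomp (u v : List X) : Prop := ¬ u <+: v ∧ ¬ v <+: u

theorem Incomp.append {u v : List X} (h : Incomp u v) (a b : List X) :
    Incomp (u ++ a) (v ++ b) := by
  constructor
  · intro H
    rcases List.prefix_or_prefix_of_prefix ((List.prefix_append u a).trans H)
      (List.prefix_append v b) with h1 | h1
    · exact h.1 h1
    · exact h.2 h1
  · intro H
    rcases List.prefix_or_prefix_of_prefix ((List.prefix_append v b).trans H)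
      (List.prefix_append u a) with h1 | h1
    · exact h.2 h1
    · exact h.1 h1

theorem incomp_of_length_eq {u v : List X} (hl : u.length = v.length) (hne : u ≠ v) :
    Incomp u v :=
  ⟨fun h => hne (h.eq_of_length hl), fun h => hne (h.eq_of_length hl.symm).symm⟩

/-- Finitely many conditions on words that persist under extension and can each be reached from
every word can be reached simultaneously from every word. -/
theorem exists_append_forall_mem {α : Type*} (s : Finset α) (P : α → List X → Prop)
    (hmono : ∀ i v w, P i v → P i (v ++ w)) (hex : ∀ i ∈ s, ∀ v, ∃ w, P i (v ++ w))
    (v : List X) : ∃ w, ∀ i ∈ s, P i (v ++ w) := by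
  classical
  induction s using Finset.induction_on with
  | empty => exact ⟨[], by simp⟩
  | insert a s ha ih =>
    obtain ⟨w, hw⟩ := ih fun i hi => hex i (Finset.mem_insert_of_mem hi)
    obtain ⟨z, hz⟩ := hex a (Finset.mem_insert_self a s) (v ++ w)
    refine ⟨w ++ z, fun i hi => ?_⟩
    rw [← List.append_assoc]
    rcases Finset.mem_insert.mp hi with rfl | hi
    · exact hz
    · exact hmono i _ _ (hw i hi)

/-- Only comparable first words need work. If they are equal, faithfulness gives a word at which two
distinct group elements differ. If one is u and the other continues u by a letter y, a second letter
y' is pulled back through the group element at u, so that the two translates branch right after u.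
-/
theorem exists_rt_eq_or_incomp [Nontrivial X] (t t' : List X × G) (v : List X) :
    ∃ w, rt (v ++ w) t = rt (v ++ w) t' ∨ Incomp (rt (v ++ w) t).1 (rt (v ++ w) t').1 := by
  simp only [rt_append]
  generalize rt v t = s, rt v t' = s'
  obtain ⟨u, g⟩ := s
  obtain ⟨u', g'⟩ := s'
  have key : ∀ (u z : List X) (g g' : G), ∃ w, rt w (u, g) = rt w (u ++ z, g') ∨
      Incomp (rt w (u, g)).1 (rt w (u ++ z, g')).1 := by
    intro u z g g'
    cases z with
    | nil =>
      by_cases hg : g = g'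
      · exact ⟨[], Or.inl (by simp [hg])⟩
      · have : ∃ w : List X, g • w ≠ g' • w := by
          by_contra hcon
          push Not at hcon
          exact hg (ext_smul X hcon)
        obtain ⟨w, hw⟩ := this
        refine ⟨w, Or.inr (incomp_of_length_eq ?_ ?_)⟩
        · simp [length_rt]
        · simpa [rt] using hw
    | cons y z =>
      obtain ⟨y', hy'⟩ := exists_ne y
      refine ⟨g⁻¹ • [y'], Or.inr ?_⟩
      have h1 : Incomp (u ++ [y']) (u ++ [y]) :=
        incomp_of_length_eq (by simp) (by simpa using hy')
      have := h1.append [] (z ++ g' • g⁻¹ • [y'])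
      simpa [rt] using this
  by_cases h1 : u <+: u'
  · obtain ⟨z, rfl⟩ := h1
    exact key u z g g'
  · by_cases h2 : u' <+: u
    · obtain ⟨z, rfl⟩ := h2
      obtain ⟨w, hw⟩ := key u' z g' g
      exact ⟨w, hw.imp Eq.symm fun h => ⟨h.2, h.1⟩⟩
    · exact ⟨[], Or.inr (by simpa [rt_nil] using ⟨h1, h2⟩)⟩

/-- For every finite set of pairs, every word extends to one at which the translates are pairwise
equal or incomparable. -/
theorem exists_resolving [Nontrivial X] (s : Finset (List X × G)) (v : List X) :
    ∃ w, ∀ t ∈ s, ∀ t' ∈ s, rt (v ++ w) t = rt (v ++ w) t' ∨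
      Incomp (rt (v ++ w) t).1 (rt (v ++ w) t').1 := by
  classical
  obtain ⟨w, hw⟩ := exists_append_forall_mem (s ×ˢ s)
    (fun p w => rt w p.1 = rt w p.2 ∨ Incomp (rt w p.1).1 (rt w p.2).1)
    (fun p v w h => by
      rcases h with h | h
      · exact Or.inl (by rw [rt_append, rt_append, h])
      · refine Or.inr ?_
        rw [rt_append, rt_append]
        exact h.append _ _)
    (fun p _ v => exists_rt_eq_or_incomp p.1 p.2 v) v
  exact ⟨w, fun t ht t' ht' => hw (t, t') (Finset.mk_mem_product ht ht')⟩

end Words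

/-! ### Singular and eventually vanishing formal sums -/

section Singular

variable {G X : Type*} [Group G] [MulAction G (List X)] [SelfSimilarGroup G X]
  {M : Type*} [AddCommMonoid M]

/-- Every word has an extension that annihilates `φ`. -/
def Sing (φ : (List X × G) →₀ M) : Prop :=
  ∀ v : List X, ∃ w : List X, φ.mapDomain (rt (v ++ w)) = 0

/-- All sufficiently long words annihilate `φ`. -/
def EvZero (φ : (List X × G) →₀ M) : Prop :=
  ∃ n : ℕ, ∀ w : List X, w.length = n → φ.mapDomain (rt w) = 0

variable (G X M) in
/-- Singular elements are eventually zero. -/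
def NoSing : Prop := ∀ φ : (List X × G) →₀ M, Sing φ → EvZero φ

theorem mapDomain_rt_append (v w : List X) (φ : (List X × G) →₀ M) :
    φ.mapDomain (rt (v ++ w)) = (φ.mapDomain (rt v)).mapDomain (rt w) := by
  rw [← Finsupp.mapDomain_comp, rt_comp]

theorem mapDomain_rt_eq_zero_append {v : List X} {φ : (List X × G) →₀ M}
    (h : φ.mapDomain (rt v) = 0) (w : List X) : φ.mapDomain (rt (v ++ w)) = 0 := by
  rw [mapDomain_rt_append, h, Finsupp.mapDomain_zero]

theorem mapDomain_rt_eq_zero_of_le {n : ℕ} {φ : (List X × G) →₀ M}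
    (h : ∀ w : List X, w.length = n → φ.mapDomain (rt w) = 0) (w : List X) (hw : n ≤ w.length) :
    φ.mapDomain (rt w) = 0 := by
  have := mapDomain_rt_eq_zero_append (h (w.take n) (by simpa using hw)) (w.drop n)
  rwa [List.take_append_drop] at this

theorem Sing.mapDomain {φ : (List X × G) →₀ M} (h : Sing φ) (u : List X) :
    Sing (φ.mapDomain (rt u)) := fun v => by
  obtain ⟨w, hw⟩ := h (u ++ v)
  exact ⟨w, by rw [← mapDomain_rt_append, ← List.append_assoc, hw]⟩

/-- Finiteness of the alphabet enters here: the depths needed after the finitely many words of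
length n have a maximum. -/
theorem evZero_of_forall [Finite X] {φ : (List X × G) →₀ M} (n : ℕ)
    (h : ∀ w : List X, w.length = n → EvZero (φ.mapDomain (rt w))) : EvZero φ := by
  classical
  have hfin : {w : List X | w.length = n}.Finite := List.finite_length_eq X n
  choose! N hN using h
  refine ⟨n + hfin.toFinset.sup N, fun w hw => ?_⟩
  have h1 : (w.take n).length = n := by simp; omega
  have h2 := mapDomain_rt_eq_zero_of_le (hN _ h1) (w.drop n) (by
    have := Finset.le_sup (f := N) (hfin.mem_toFinset.mpr h1)
    simp; omega)
  rwa [← mapDomain_rt_append, List.take_append_drop] at h2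

/-- The first component of a pair is determined by its length and any right translate. -/
theorem fst_eq_of_rt_eq {w : List X} {t t' : List X × G} (h : rt w t = rt w t') : t.1 = t'.1 := by
  have h1 : t.1 ++ t.2 • w = t'.1 ++ t'.2 • w := congrArg Prod.fst h
  exact (List.append_inj' h1 (by simp [length_smul])).1

end Singular

/-! ### The representation on formal sums and vanishing in the algebra -/

open scoped Classical in
/-- The action of the generators of the Nekrashevych algebra on the free module spanned by the pairs
`(u, g)`. -/
noncomputable def genRep (K : Type*) [Field K] {G X : Type*} [Group G] [MulAction G (List X)]
    [SelfSimilarGroup G X] : NekGen G X → Module.End K ((List X × G) →₀ K)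
  | .letter x => Finsupp.lmapDomain K K fun t => (x :: t.1, t.2)
  | .elt g => Finsupp.lmapDomain K K fun t => (g • t.1, sectWord g t.1 * t.2)
  | .letterStar x => Finsupp.linearCombination K fun t : List X × G =>
      match t with
      | ([], _) => 0
      | (y :: u, g) => if y = x then Finsupp.single (u, g) 1 else 0

/-- The representation of the free algebra on the free module spanned by the pairs `(u, g)`. -/
noncomputable def freeRep (K : Type*) [Field K] (G X : Type*) [Group G] [MulAction G (List X)]
    [SelfSimilarGroup G X] :
    FreeAlgebra K (NekGen G X) →ₐ[K] Module.End K ((List X × G) →₀ K) :=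
  FreeAlgebra.lift K (genRep K)

/-- The submodule spanned by the pairs `(u, g)` with `n ≤ |u|`. -/
def longSupp (K : Type*) [Field K] (G X : Type*) (n : ℕ) : Submodule K ((List X × G) →₀ K) :=
  Finsupp.supported K K {t | n ≤ t.1.length}

theorem longSupp_anti (K : Type*) [Field K] (G X : Type*) {m n : ℕ} (h : m ≤ n) :
    longSupp K G X n ≤ longSupp K G X m :=
  Finsupp.supported_mono fun _ ht => le_trans h ht

theorem single_mem_longSupp (K : Type*) [Field K] {G X : Type*} {n : ℕ} {t : List X × G}
    (h : n ≤ t.1.length) : Finsupp.single t (1 : K) ∈ longSupp K G X n :=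
  Finsupp.single_mem_supported K _ h

theorem longSupp_le_comap {K : Type*} [Field K] {G X : Type*} {n : ℕ}
    {V : Type*} [AddCommGroup V] [Module K V] (f : ((List X × G) →₀ K) →ₗ[K] V)
    (p : Submodule K V) (h : ∀ t : List X × G, n ≤ t.1.length → f (Finsupp.single t 1) ∈ p) :
    ∀ φ ∈ longSupp K G X n, f φ ∈ p := by
  intro φ hφ
  have : longSupp K G X n ≤ p.comap f := by
    rw [longSupp, Finsupp.supported_eq_span_single, Submodule.span_le]
    rintro _ ⟨t, ht, rfl⟩
    exact h t ht
  exact this hφ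

theorem longSupp_ext {K : Type*} [Field K] {G X : Type*} {n : ℕ}
    {V : Type*} [AddCommGroup V] [Module K V] (f g : ((List X × G) →₀ K) →ₗ[K] V)
    (h : ∀ t : List X × G, n ≤ t.1.length → f (Finsupp.single t 1) = g (Finsupp.single t 1)) :
    ∀ φ ∈ longSupp K G X n, f φ = g φ := by
  intro φ hφ
  have := longSupp_le_comap (f - g) ⊥ (fun t ht => by simp [h t ht]) φ hφ
  simpa [sub_eq_zero] using this

section Rep

variable (K : Type*) [Field K] {G X : Type*} [Group G] [MulAction G (List X)]
  [SelfSimilarGroup G X]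

theorem freeRep_gX (x : X) (t : List X × G) :
    freeRep K G X (gX K G x) (Finsupp.single t 1) = Finsupp.single (x :: t.1, t.2) 1 := by
  simp [freeRep, gX, genRep, Finsupp.mapDomain_single]

theorem freeRep_gG (g : G) (t : List X × G) :
    freeRep K G X (gG K X g) (Finsupp.single t 1) =
      Finsupp.single (g • t.1, sectWord g t.1 * t.2) 1 := by
  simp [freeRep, gG, genRep, Finsupp.mapDomain_single]

theorem freeRep_gXs_cons_self (x : X) (u : List X) (g : G) :
    freeRep K G X (gXs K G x) (Finsupp.single (x :: u, g) 1) = Finsupp.single (u, g) 1 := by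
  simp [freeRep, gXs, genRep]

theorem freeRep_gXs_cons_ne {x y : X} (h : y ≠ x) (u : List X) (g : G) :
    freeRep K G X (gXs K G x) (Finsupp.single (y :: u, g) 1) = 0 := by
  simp [freeRep, gXs, genRep, h]

variable [Fintype X]

/-- Every defining relation holds in the representation on sufficiently long pairs. -/
theorem freeRep_rel {a b : FreeAlgebra K (NekGen G X)} (h : NekRel K G X a b) :
    ∀ φ ∈ longSupp K G X 1, freeRep K G X a φ = freeRep K G X b φ := by
  classical
  -- Length at least 1 is needed for the relation that the x x^* sum to 1: its left side kills the
  -- pairs with empty word.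
  refine longSupp_ext _ _ ?_
  rintro ⟨u, k⟩ ht
  obtain ⟨y, u, rfl⟩ : ∃ y v, u = y :: v := by
    cases u with
    | nil => simp at ht
    | cons y v => exact ⟨y, v, rfl⟩
  cases h with
  | one => simp [freeRep_gG, sectWord_one]
  | mul g h => simp [freeRep_gG, sectWord_mul, mul_smul, mul_assoc]
  | ss g x => simp [freeRep_gG, freeRep_gX, smul_cons, sectWord]
  | ss_star g x =>
    obtain ⟨z, rfl⟩ : ∃ z, y = letter g z := ⟨letter g⁻¹ y, by
      have := letter_inv g⁻¹ y
      rw [inv_inv] at this; exact this.symm⟩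
    by_cases hz : z = x
    · subst hz
      simp [freeRep_gG, freeRep_gXs_cons_self, smul_cons, sectWord, letter_inv, sect_inv]
    · have : letter g z ≠ letter g x := fun h => hz (by rw [← letter_inv g z, h, letter_inv])
      simp [freeRep_gG, smul_cons, letter_inv, freeRep_gXs_cons_ne K hz,
        freeRep_gXs_cons_ne K this]
  | ck1_same x => simp [freeRep_gX, freeRep_gXs_cons_self]
  | ck1_ne x z hxz => simp [freeRep_gX, freeRep_gXs_cons_ne K hxz]
  | ck2 =>
    simp only [map_sum, map_mul, LinearMap.sum_apply, Module.End.mul_apply, map_one,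
      Module.End.one_apply]
    rw [Finset.sum_eq_single y]
    · simp [freeRep_gX, freeRep_gXs_cons_self]
    · intro x _ hx
      rw [freeRep_gXs_cons_ne K hx.symm, map_zero]
    · simp

/-- The image of a letter in the Nekrashevych algebra. -/
noncomputable def nX (G : Type*) [Group G] [MulAction G (List X)] [SelfSimilarGroup G X] (x : X) :
    NekrashevychAlgebra K G X := RingQuot.mkAlgHom K (NekRel K G X) (gX K G x)

/-- The image of the adjoint of a letter in the Nekrashevych algebra. -/
noncomputable def nXs (G : Type*) [Group G] [MulAction G (List X)] [SelfSimilarGroup G X] (x : X) :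
    NekrashevychAlgebra K G X := RingQuot.mkAlgHom K (NekRel K G X) (gXs K G x)

/-- The image of a group element in the Nekrashevych algebra. -/
noncomputable def nG (X : Type*) [Fintype X] [MulAction G (List X)] [SelfSimilarGroup G X] (g : G) :
    NekrashevychAlgebra K G X := RingQuot.mkAlgHom K (NekRel K G X) (gG K X g)

/-- The product of the letters of a word in the Nekrashevych algebra. -/
noncomputable def nW (G : Type*) [Group G] [MulAction G (List X)] [SelfSimilarGroup G X]
    (w : List X) : NekrashevychAlgebra K G X := (w.map (nX K G)).prod

/-- The adjoint of the product of the letters of a word in the Nekrashevych algebra. -/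
noncomputable def nWs (G : Type*) [Group G] [MulAction G (List X)] [SelfSimilarGroup G X]
    (w : List X) : NekrashevychAlgebra K G X := (w.reverse.map (nXs K G)).prod

theorem nG_one : nG K X (1 : G) = 1 := by
  rw [nG, RingQuot.mkAlgHom_rel K (NekRel.one), map_one]

theorem nG_mul (g h : G) : nG K X (g * h) = nG K X g * nG K X h := by
  rw [nG, nG, nG, ← map_mul, RingQuot.mkAlgHom_rel K (NekRel.mul g h)]

theorem nG_mul_nX (g : G) (x : X) :
    nG K X g * nX K G x = nX K G (letter g x) * nG K X (sect g x) := by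
  simp only [nG, nX]
  rw [← map_mul, ← map_mul, RingQuot.mkAlgHom_rel K (NekRel.ss g x)]

theorem nXs_mul_nX_self (x : X) : nXs K G x * nX K G x = 1 := by
  simp only [nXs, nX]
  rw [← map_mul, RingQuot.mkAlgHom_rel K (NekRel.ck1_same x), map_one]

theorem nXs_mul_nX_ne {x y : X} (h : x ≠ y) : nXs K G y * nX K G x = 0 := by
  simp only [nXs, nX]
  rw [← map_mul, RingQuot.mkAlgHom_rel K (NekRel.ck1_ne x y h), map_zero]

theorem sum_nX_mul_nXs : ∑ x : X, nX K G x * nXs K G x = 1 := by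
  simp only [nXs, nX]
  rw [← map_one (RingQuot.mkAlgHom K (NekRel K G X)), ← RingQuot.mkAlgHom_rel K NekRel.ck2, map_sum]
  simp [map_mul]

theorem nW_cons (x : X) (w : List X) : nW K G (x :: w) = nX K G x * nW K G w := by simp [nW]

theorem nW_append (v w : List X) : nW K G (v ++ w) = nW K G v * nW K G w := by simp [nW]

theorem nWs_cons (x : X) (w : List X) : nWs K G (x :: w) = nWs K G w * nXs K G x := by simp [nWs]

theorem nW_nil : nW K G ([] : List X) = 1 := by simp [nW]

theorem nWs_nil : nWs K G ([] : List X) = 1 := by simp [nWs]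

theorem nG_mul_nW (g : G) (w : List X) :
    nG K X g * nW K G w = nW K G (g • w) * nG K X (sectWord g w) := by
  induction w generalizing g with
  | nil => simp [nW_nil, smul_nil, sectWord]
  | cons x w ih =>
    rw [nW_cons, ← mul_assoc, nG_mul_nX, mul_assoc, ih, smul_cons, nW_cons, mul_assoc, sectWord]

theorem nWs_mul_nW_self (w : List X) : nWs K G w * nW K G w = 1 := by
  induction w with
  | nil => simp [nW_nil, nWs_nil]
  | cons x w ih =>
    rw [nWs_cons, nW_cons, mul_assoc, ← mul_assoc (nXs K G x), nXs_mul_nX_self, one_mul, ih]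

theorem nWs_mul_nW_incomp {u v : List X} (h : Incomp u v) : nWs K G u * nW K G v = 0 := by
  induction u generalizing v with
  | nil => exact absurd (List.nil_prefix) h.1
  | cons x u ih =>
    cases v with
    | nil => exact absurd (List.nil_prefix) h.2
    | cons y v =>
      rw [nWs_cons, nW_cons, mul_assoc, ← mul_assoc (nXs K G x)]
      by_cases hxy : y = x
      · subst hxy
        rw [nXs_mul_nX_self, one_mul]
        exact ih ⟨fun h' => h.1 (by simpa using h'), fun h' => h.2 (by simpa using h')⟩
      · rw [nXs_mul_nX_ne K hxy, zero_mul, mul_zero]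

/-- Iterating the relation that the x x^* sum to 1 writes a as the sum of a w w^* over the words w
of length n. -/
theorem eq_zero_of_mul_nW {a : NekrashevychAlgebra K G X} (n : ℕ)
    (h : ∀ w : List X, w.length = n → a * nW K G w = 0) : a = 0 := by
  induction n generalizing a with
  | zero => simpa [nW_nil] using h [] rfl
  | succ n ih =>
    have h1 : ∀ x : X, a * nX K G x = 0 := fun x => ih fun w hw => by
      rw [mul_assoc, ← nW_cons]
      exact h _ (by simp [hw])
    rw [← mul_one a, ← sum_nX_mul_nXs K (G := G) (X := X), Finset.mul_sum]
    exact Finset.sum_eq_zero fun x _ => by rw [← mul_assoc, h1, zero_mul]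

/-- The linear map that interprets the pair `(u, g)` as the element `u g` of the algebra. -/
noncomputable def toNek : ((List X × G) →₀ K) →ₗ[K] NekrashevychAlgebra K G X :=
  Finsupp.linearCombination K fun t => nW K G t.1 * nG K X t.2

theorem toNek_single (t : List X × G) (c : K) :
    toNek K (Finsupp.single t c) = c • (nW K G t.1 * nG K X t.2) := by
  simp [toNek]

theorem toNek_mul_nW (φ : (List X × G) →₀ K) (w : List X) :
    toNek K φ * nW K G w = toNek K (φ.mapDomain (rt w)) := by
  induction φ using Finsupp.induction_linear with
  | zero => simp
  | add f g hf hg => rw [map_add, add_mul, hf, hg, Finsupp.mapDomain_add, map_add]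
  | single t c =>
    rw [Finsupp.mapDomain_single, toNek_single, toNek_single, rt, nW_append, smul_mul_assoc,
      mul_assoc, nG_mul_nW, mul_assoc]

/-- Multiplication in the algebra agrees with the representation on sufficiently long pairs. -/
theorem exists_band (a : FreeAlgebra K (NekGen G X)) :
    ∃ c, ∀ n, ∀ φ ∈ longSupp K G X (n + c), freeRep K G X a φ ∈ longSupp K G X n ∧
      RingQuot.mkAlgHom K (NekRel K G X) a * toNek K φ = toNek K (freeRep K G X a φ) := by
  have red : ∀ (a : FreeAlgebra K (NekGen G X)) (c : ℕ),
      (∀ n, ∀ t : List X × G, n + c ≤ t.1.length →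
        freeRep K G X a (Finsupp.single t 1) ∈ longSupp K G X n ∧
        RingQuot.mkAlgHom K (NekRel K G X) a * (nW K G t.1 * nG K X t.2) =
          toNek K (freeRep K G X a (Finsupp.single t 1))) →
      ∃ c, ∀ n, ∀ φ ∈ longSupp K G X (n + c), freeRep K G X a φ ∈ longSupp K G X n ∧
        RingQuot.mkAlgHom K (NekRel K G X) a * toNek K φ = toNek K (freeRep K G X a φ) := by
    intro a c h
    refine ⟨c, fun n φ hφ => ⟨?_, ?_⟩⟩
    · exact longSupp_le_comap _ _ (fun t ht => (h n t ht).1) φ hφ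
    · refine longSupp_ext (n := n + c)
        ((LinearMap.mulLeft K (RingQuot.mkAlgHom K (NekRel K G X) a)).comp (toNek K))
        ((toNek K).comp (freeRep K G X a)) (fun t ht => ?_) φ hφ
      simpa [toNek_single] using (h n t ht).2
  induction a with
  | grade0 r =>
    refine red _ 0 fun n t ht => ⟨?_, ?_⟩
    · simpa [Algebra.algebraMap_eq_smul_one] using
        Submodule.smul_mem _ r (single_mem_longSupp K ht)
    · simp [Algebra.algebraMap_eq_smul_one, toNek]
  | grade1 x =>
    cases x with
    | letter x =>
      refine red _ 0 fun n t ht => ?_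
      rw [← gX, freeRep_gX]
      refine ⟨single_mem_longSupp K (by simp; omega), ?_⟩
      rw [toNek_single, one_smul, nW_cons, nX, mul_assoc]
    | letterStar x =>
      -- Only x^* shortens words, and by one letter; the other generators need no margin.
      refine red _ 1 fun n t ht => ?_
      rw [← gXs]
      obtain ⟨u, g⟩ := t
      cases u with
      | nil => simp at ht
      | cons y u =>
        by_cases hy : y = x
        · subst hy
          rw [freeRep_gXs_cons_self]
          refine ⟨single_mem_longSupp K (by simpa using ht), ?_⟩
          change nXs K G y * _ = _
          rw [toNek_single, one_smul, nW_cons, ← mul_assoc, ← mul_assoc, nXs_mul_nX_self, one_mul]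
        · rw [freeRep_gXs_cons_ne K hy]
          refine ⟨Submodule.zero_mem _, ?_⟩
          change nXs K G x * _ = _
          rw [nW_cons, ← mul_assoc, ← mul_assoc, nXs_mul_nX_ne K hy, zero_mul, zero_mul, map_zero]
    | elt g =>
      refine red _ 0 fun n t ht => ?_
      rw [← gG, freeRep_gG]
      refine ⟨single_mem_longSupp K (by simpa [length_smul] using ht), ?_⟩
      change nG K X g * _ = _
      rw [toNek_single, one_smul, nG_mul, ← mul_assoc, ← mul_assoc, nG_mul_nW]
  | mul a b ha hb =>
    obtain ⟨c, hc⟩ := ha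
    obtain ⟨e, he⟩ := hb
    -- The margins add up under products: b costs e letters, and then a costs c.
    refine ⟨c + e, fun n φ hφ => ?_⟩
    obtain ⟨h1, h2⟩ := he (n + c) φ (by rwa [add_assoc])
    obtain ⟨h3, h4⟩ := hc n _ h1
    refine ⟨by simpa using h3, ?_⟩
    rw [map_mul, mul_assoc, h2, h4, map_mul, Module.End.mul_apply]
  | add a b ha hb =>
    obtain ⟨c, hc⟩ := ha
    obtain ⟨e, he⟩ := hb
    refine ⟨c + e, fun n φ hφ => ?_⟩
    obtain ⟨h1, h2⟩ := hc n φ (longSupp_anti K G X (by omega) hφ)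
    obtain ⟨h3, h4⟩ := he n φ (longSupp_anti K G X (by omega) hφ)
    refine ⟨by simpa using Submodule.add_mem _ h1 h3, ?_⟩
    rw [map_add, add_mul, h2, h4, map_add, LinearMap.add_apply, map_add]

/-- An element of the free algebra that vanishes in the Nekrashevych algebra annihilates all
sufficiently long pairs. -/
theorem exists_freeRep_eq_zero {a : FreeAlgebra K (NekGen G X)}
    (ha : RingQuot.mkAlgHom K (NekRel K G X) a = 0) :
    ∃ n, ∀ φ ∈ longSupp K G X n, freeRep K G X a φ = 0 := by
  -- The representation itself does not factor through the algebra, since the relations hold on long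
  -- pairs only. The elements that annihilate all sufficiently long pairs form an ideal containing
  -- the relations, so the quotient by this ideal does factor.
  let J : TwoSidedIdeal (FreeAlgebra K (NekGen G X)) := TwoSidedIdeal.mk'
    {a | ∃ n, ∀ φ ∈ longSupp K G X n, freeRep K G X a φ = 0}
    ⟨0, by simp⟩
    (by
      rintro a b ⟨n, hn⟩ ⟨m, hm⟩
      refine ⟨n + m, fun φ hφ => ?_⟩
      simp [hn φ (longSupp_anti K G X (by omega) hφ), hm φ (longSupp_anti K G X (by omega) hφ)])
    (by
      rintro a ⟨n, hn⟩
      exact ⟨n, fun φ hφ => by simp [hn φ hφ]⟩)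
    (by
      rintro a b ⟨n, hn⟩
      exact ⟨n, fun φ hφ => by simp [hn φ hφ]⟩)
    (by
      rintro a b ⟨n, hn⟩
      -- Applying b first costs at most c letters, so pairs of length n + c are still long enough
      -- for a.
      obtain ⟨c, hc⟩ := exists_band K b
      exact ⟨n + c, fun φ hφ => by simp [hn _ (hc n φ hφ).1]⟩)
  have hJ : ∀ a, a ∈ J ↔ ∃ n, ∀ φ ∈ longSupp K G X n, freeRep K G X a φ = 0 := fun a =>
    TwoSidedIdeal.mem_mk' _ _ _ _ _ _ a
  have hrel : ∀ ⦃a b⦄, NekRel K G X a b → J.ringCon.mk' a = J.ringCon.mk' b := by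
    intro a b h
    refine (RingCon.eq _).mpr ?_
    rw [TwoSidedIdeal.rel_iff, hJ]
    exact ⟨1, fun φ hφ => by simp [freeRep_rel K h φ hφ]⟩
  have h1 : J.ringCon.mk' a = 0 := by
    rw [← RingQuot.lift_mkRingHom_apply J.ringCon.mk' hrel a, ← RingQuot.mkAlgHom_coe K]
    rw [AlgHom.coe_toRingHom, ha, map_zero]
  have h2 : J.ringCon a 0 := (RingCon.eq _).mp h1
  rw [TwoSidedIdeal.rel_iff, sub_zero] at h2
  exact (hJ a).mp h2

/-- The obvious lift of φ to the free algebra sends the basis vector at (w, 1) to the translate of φ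
by w. Annihilating all long pairs therefore gives eventual vanishing. -/
theorem evZero_of_toNek_eq_zero {φ : (List X × G) →₀ K} (h : toNek K φ = 0) : EvZero φ := by
  let lin : ((List X × G) →₀ K) →ₗ[K] FreeAlgebra K (NekGen G X) :=
    Finsupp.linearCombination K fun t => (t.1.map (gX K G)).prod * gG K X t.2
  have h1 : ∀ φ, RingQuot.mkAlgHom K (NekRel K G X) (lin φ) = toNek K φ := by
    intro φ
    induction φ using Finsupp.induction_linear with
    | zero => simp
    | add f g hf hg => rw [map_add, map_add, hf, hg, map_add]
    | single t c =>
      simp only [lin, Finsupp.linearCombination_single, map_smul, toNek_single, map_mul, map_list_prod,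
        List.map_map]
      rfl
  have h2 : ∀ (u w : List X) (g : G),
      freeRep K G X (u.map (gX K G)).prod (Finsupp.single (w, g) 1) =
        Finsupp.single (u ++ w, g) 1 := by
    intro u w g
    induction u with
    | nil => simp
    | cons x u ih => simp [ih, freeRep_gX]
  have h3 : ∀ φ (w : List X), freeRep K G X (lin φ) (Finsupp.single (w, 1) 1) =
      φ.mapDomain (rt w) := by
    intro φ w
    induction φ using Finsupp.induction_linear with
    | zero => simp
    | add f g hf hg => rw [map_add, map_add, LinearMap.add_apply, hf, hg, Finsupp.mapDomain_add]
    | single t c =>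
      simp [lin, Finsupp.linearCombination_single, freeRep_gG, h2, Finsupp.mapDomain_single, rt]
  obtain ⟨n, hn⟩ := exists_freeRep_eq_zero K (a := lin φ) (by rw [h1, h])
  exact ⟨n, fun w hw => by
    rw [← h3]; exact hn _ (single_mem_longSupp K hw.ge)⟩

theorem toNek_eq_zero_iff {φ : (List X × G) →₀ K} : toNek K φ = 0 ↔ EvZero φ := by
  refine ⟨evZero_of_toNek_eq_zero K, fun ⟨n, hn⟩ => eq_zero_of_mul_nW K n fun w hw => ?_⟩
  rw [toNek_mul_nW, hn w hw, map_zero]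

end Rep

/-! ### Simplicity as the vanishing of singular elements -/

section Simple

variable (K : Type*) [Field K] {G X : Type*} [Fintype X] [Group G]
  [MulAction G (List X)] [SelfSimilarGroup G X]

theorem nG_mul_nG_inv (g : G) : nG K X g * nG K X g⁻¹ = 1 := by
  rw [← nG_mul, mul_inv_cancel, nG_one]

/-- After multiplication by sufficiently long words, elements of the algebra are combinations of
products `u g`. -/
theorem exists_mul_nW_eq_toNek (a : NekrashevychAlgebra K G X) :
    ∃ c, ∀ v : List X, c ≤ v.length → ∃ φ : (List X × G) →₀ K, a * nW K G v = toNek K φ := by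
  obtain ⟨a, rfl⟩ := RingQuot.mkAlgHom_surjective K (NekRel K G X) a
  obtain ⟨c, hc⟩ := exists_band K a
  refine ⟨c, fun v hv => ⟨freeRep K G X a (Finsupp.single (v, 1) 1), ?_⟩⟩
  rw [← (hc 0 (Finsupp.single (v, 1) 1) (single_mem_longSupp K (by simpa using hv))).2,
    toNek_single, nG_one, mul_one, one_smul]

/-- This is the part of the ideal property that concerns right multiplication. Since u g v equals u
g(v) g|_v, an extension z of u g(v) that annihilates a is pulled back through the section g|_v; sums
are handled one term after the other. -/
theorem exists_mul_toNek_mul_nW_eq_zero {a : NekrashevychAlgebra K G X}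
    (ha : ∀ v : List X, ∃ w, a * nW K G (v ++ w) = 0) (φ : (List X × G) →₀ K) (v : List X) :
    ∃ w, a * toNek K φ * nW K G (v ++ w) = 0 := by
  induction φ using Finsupp.induction_linear generalizing v with
  | zero => exact ⟨[], by simp⟩
  | add f g hf hg =>
    obtain ⟨w, hw⟩ := hf v
    obtain ⟨z, hz⟩ := hg (v ++ w)
    refine ⟨w ++ z, ?_⟩
    rw [map_add, mul_add, add_mul, ← List.append_assoc, hz, nW_append, ← mul_assoc, hw, zero_mul,
      add_zero]
  | single t c =>
    obtain ⟨u, g⟩ := t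
    obtain ⟨z, hz⟩ := ha (u ++ g • v)
    refine ⟨(sectWord g v)⁻¹ • z, ?_⟩
    rw [mul_assoc, toNek_mul_nW, Finsupp.mapDomain_single, toNek_single, rt, smul_append,
      smul_inv_smul, ← List.append_assoc, mul_smul_comm, ← mul_assoc, hz, zero_mul, smul_zero]

theorem mul_nW_append_eq_zero {a : NekrashevychAlgebra K G X} {v : List X}
    (h : a * nW K G v = 0) (w : List X) : a * nW K G (v ++ w) = 0 := by
  rw [nW_append, ← mul_assoc, h, zero_mul]

/-- If the pairs in the support of `φ` are pairwise incomparable, then each coefficient of `φ` can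
be extracted. -/
theorem nWs_mul_toNek {φ : (List X × G) →₀ K}
    (h : ∀ t ∈ φ.support, ∀ t' ∈ φ.support, t = t' ∨ Incomp t.1 t'.1) {t : List X × G}
    (ht : t ∈ φ.support) : nWs K G t.1 * toNek K φ = φ t • nG K X t.2 := by
  rw [toNek, Finsupp.linearCombination_apply, Finsupp.sum, Finset.mul_sum,
    Finset.sum_eq_single t]
  · rw [mul_smul_comm, ← mul_assoc, nWs_mul_nW_self, one_mul]
  · intro t' ht' hne
    have := (h t ht t' ht').resolve_left hne.symm
    rw [mul_smul_comm, ← mul_assoc, nWs_mul_nW_incomp K this, zero_mul, smul_zero]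
  · exact fun h => absurd ht h

theorem exists_resolved {G X : Type*} [Nontrivial X] [Group G]
    [MulAction G (List X)] [SelfSimilarGroup G X] {M : Type*} [AddCommMonoid M] (φ : (List X × G) →₀ M) (v : List X) :
    ∃ w, ∀ t ∈ (φ.mapDomain (rt (v ++ w))).support, ∀ t' ∈ (φ.mapDomain (rt (v ++ w))).support,
      t = t' ∨ Incomp t.1 t'.1 := by
  classical
  obtain ⟨w, hw⟩ := exists_resolving φ.support v
  refine ⟨w, fun t ht t' ht' => ?_⟩
  obtain ⟨s, hs, rfl⟩ := Finset.mem_image.mp (Finsupp.mapDomain_support ht)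
  obtain ⟨s', hs', rfl⟩ := Finset.mem_image.mp (Finsupp.mapDomain_support ht')
  exact hw s hs s' hs'

variable [Nontrivial X]

/-- The unit is a single pair, and a translate of a single pair is again a single pair, so it never
becomes zero. -/
theorem nontrivial_nek : Nontrivial (NekrashevychAlgebra K G X) := by
  refine ⟨⟨1, 0, fun h => ?_⟩⟩
  have h1 : toNek K (Finsupp.single (([] : List X), (1 : G)) (1 : K)) = 0 := by
    rw [toNek_single, nW_nil, nG_one, one_mul, one_smul, h]
  obtain ⟨n, hn⟩ := evZero_of_toNek_eq_zero K h1
  have := hn (List.replicate n (Classical.arbitrary X)) (by simp)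
  rw [Finsupp.mapDomain_single, Finsupp.single_eq_zero] at this
  exact one_ne_zero this

/-- The ideal of singular elements. -/
def singIdeal : TwoSidedIdeal (NekrashevychAlgebra K G X) := TwoSidedIdeal.mk'
  {a | ∀ v : List X, ∃ w, a * nW K G (v ++ w) = 0}
  (fun v => ⟨[], by simp⟩)
  (by
    intro a b ha hb v
    obtain ⟨w, hw⟩ := ha v
    obtain ⟨z, hz⟩ := hb (v ++ w)
    refine ⟨w ++ z, ?_⟩
    rw [← List.append_assoc, add_mul, hz, mul_nW_append_eq_zero K hw, add_zero])
  (by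
    intro a ha v
    obtain ⟨w, hw⟩ := ha v
    exact ⟨w, (neg_mul a _).trans (by rw [hw]; exact neg_zero)⟩)
  (by
    intro a b hb v
    obtain ⟨w, hw⟩ := hb v
    exact ⟨w, by rw [mul_assoc, hw, mul_zero]⟩)
  (by
    intro a b ha v
    obtain ⟨c, hc⟩ := exists_mul_nW_eq_toNek K b
    -- The factor b may contain adjoints of letters. Prolonging v by c arbitrary letters absorbs
    -- them and leaves a combination of pairs.
    obtain ⟨φ, hφ⟩ := hc (v ++ List.replicate c (Classical.arbitrary X)) (by simp)
    obtain ⟨w, hw⟩ := exists_mul_toNek_mul_nW_eq_zero K ha φ []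
    refine ⟨List.replicate c (Classical.arbitrary X) ++ w, ?_⟩
    rw [← List.append_assoc, nW_append, mul_assoc, ← mul_assoc b, hφ, ← mul_assoc]
    exact hw)

theorem mem_singIdeal {a : NekrashevychAlgebra K G X} :
    a ∈ singIdeal K ↔ ∀ v : List X, ∃ w, a * nW K G (v ++ w) = 0 :=
  TwoSidedIdeal.mem_mk' _ _ _ _ _ _ a

/-- Non-vanishing at all extensions of v leaves the freedom to pass to a resolved, still nonzero
translate. Multiplying it by u^* on the left for a word u of its support leaves a nonzero scalar
times a group element, which is invertible. -/
theorem one_mem_of_forall_ne {I : TwoSidedIdeal (NekrashevychAlgebra K G X)}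
    {a : NekrashevychAlgebra K G X} (ha : a ∈ I) {v : List X}
    (hv : ∀ w, a * nW K G (v ++ w) ≠ 0) : 1 ∈ I := by
  obtain ⟨c, hc⟩ := exists_mul_nW_eq_toNek K a
  obtain ⟨φ, hφ⟩ := hc (v ++ List.replicate c (Classical.arbitrary X)) (by simp)
  obtain ⟨w, hw⟩ := exists_resolved φ []
  rw [List.nil_append] at hw
  have h1 : a * nW K G (v ++ List.replicate c (Classical.arbitrary X) ++ w) =
      toNek K (φ.mapDomain (rt w)) := by
    rw [nW_append, ← mul_assoc, hφ, toNek_mul_nW]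
  set ψ := φ.mapDomain (rt w)
  have h2 : toNek K ψ ≠ 0 := by
    rw [← h1, List.append_assoc]; exact hv _
  obtain ⟨t, ht⟩ : ψ.support.Nonempty := by
    rw [Finsupp.support_nonempty_iff]
    rintro h
    rw [h, map_zero] at h2
    exact h2 rfl
  have h3 : nWs K G t.1 * toNek K ψ * ((ψ t)⁻¹ • nG K X t.2⁻¹) = 1 := by
    rw [nWs_mul_toNek K hw ht, smul_mul_smul_comm, mul_inv_cancel₀ (Finsupp.mem_support_iff.mp ht),
      nG_mul_nG_inv, one_smul]
  rw [← h3, ← h1]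
  exact I.mul_mem_right _ _ (I.mul_mem_left _ _ (I.mul_mem_right _ _ ha))

/-- Vanishing in the algebra is weaker than vanishing of the formal sum, but the two agree once the
sum is resolved: a surviving coefficient could be extracted and would make a unit zero. -/
theorem sing_of_forall_exists {φ : (List X × G) →₀ K}
    (h : ∀ v : List X, ∃ w, toNek K φ * nW K G (v ++ w) = 0) : Sing φ := by
  intro v
  obtain ⟨w, hw⟩ := h v
  obtain ⟨z, hz⟩ := exists_resolved φ (v ++ w)
  have h1 := mul_nW_append_eq_zero K hw z
  rw [toNek_mul_nW] at h1
  refine ⟨w ++ z, ?_⟩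
  rw [← List.append_assoc]
  by_contra hne
  obtain ⟨t, ht⟩ := Finsupp.support_nonempty_iff.mpr hne
  have h2 := nWs_mul_toNek K hz ht
  rw [h1, mul_zero] at h2
  have h3 : ((φ.mapDomain (rt (v ++ w ++ z))) t)⁻¹ •
      ((φ.mapDomain (rt (v ++ w ++ z))) t • nG K X t.2) * nG K X t.2⁻¹ = 0 := by
    rw [← h2]; simp
  rw [inv_smul_smul₀ (Finsupp.mem_support_iff.mp ht), nG_mul_nG_inv] at h3
  have := nontrivial_nek K (G := G) (X := X)
  exact one_ne_zero h3

/-- The Nekrashevych algebra is simple if and only if all singular elements vanish. -/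
theorem isSimpleRing_iff_noSing : IsSimpleRing (NekrashevychAlgebra K G X) ↔ NoSing G X K := by
  have hnt := nontrivial_nek K (G := G) (X := X)
  constructor
  · intro hs φ hφ
    have hmem : toNek K φ ∈ singIdeal K := (mem_singIdeal K).mpr fun v => by
      obtain ⟨w, hw⟩ := hφ v
      exact ⟨w, by rw [toNek_mul_nW, hw, map_zero]⟩
    rcases hs.simple.eq_bot_or_eq_top (singIdeal K (G := G) (X := X)) with h | h
    · rw [h, TwoSidedIdeal.mem_bot] at hmem
      exact evZero_of_toNek_eq_zero K hmem
    · exfalso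
      have h1 : (1 : NekrashevychAlgebra K G X) ∈ singIdeal K := by rw [h]; trivial
      obtain ⟨w, hw⟩ := (mem_singIdeal K).mp h1 []
      rw [one_mul, List.nil_append] at hw
      have := nWs_mul_nW_self K (G := G) w
      rw [hw, mul_zero] at this
      exact zero_ne_one this
  · intro h
    refine ⟨⟨fun I => ?_⟩⟩
    by_cases hI : I = ⊥
    · exact Or.inl hI
    right
    obtain ⟨a, haI, ha0⟩ : ∃ a ∈ I, a ≠ 0 := by
      by_contra hcon
      push Not at hcon
      exact hI (le_antisymm (fun x hx => (TwoSidedIdeal.mem_bot _).mpr (hcon x hx)) bot_le)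
    have hone : 1 ∈ I := by
      -- If a is singular, so are all the sums a v with v of length c; by hypothesis they vanish,
      -- hence a vanishes, a contradiction. If a is not singular, it generates the unit ideal.
      by_cases hS : ∀ v : List X, ∃ w, a * nW K G (v ++ w) = 0
      · exfalso
        apply ha0
        obtain ⟨c, hc⟩ := exists_mul_nW_eq_toNek K a
        refine eq_zero_of_mul_nW K c fun v hv => ?_
        obtain ⟨φ, hφ⟩ := hc v hv.ge
        rw [hφ, toNek_eq_zero_iff]
        refine h φ (sing_of_forall_exists K fun u => ?_)
        obtain ⟨w, hw⟩ := hS (v ++ u)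
        refine ⟨w, ?_⟩
        rw [← hφ, mul_assoc, ← nW_append, ← List.append_assoc, hw]
      · push Not at hS
        obtain ⟨v, hv⟩ := hS
        exact one_mem_of_forall_ne K haI hv
    exact (TwoSidedIdeal.one_mem_iff _).mp hone

end Simple

/-! ### Dependence on the coefficients -/

section Coefficients

variable {G X : Type*} [Group G] [MulAction G (List X)] [SelfSimilarGroup G X]

theorem Sing.mapRange {M M' : Type*} [AddCommMonoid M] [AddCommMonoid M'] (j : M →+ M')
    {φ : (List X × G) →₀ M} (h : Sing φ) : Sing (φ.mapRange j j.map_zero) := fun v => by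
  obtain ⟨w, hw⟩ := h v
  exact ⟨w, by rw [Finsupp.mapDomain_mapRange _ _ _ _ j.map_add, hw, Finsupp.mapRange_zero]⟩

theorem NoSing.of_injective {M M' : Type*} [AddCommMonoid M] [AddCommMonoid M'] (j : M →+ M')
    (hj : Function.Injective j) (h : NoSing G X M') : NoSing G X M := fun φ hφ => by
  obtain ⟨n, hn⟩ := h _ (hφ.mapRange j)
  refine ⟨n, fun w hw => Finsupp.mapRange_injective j j.map_zero hj ?_⟩
  rw [← Finsupp.mapDomain_mapRange _ _ _ _ j.map_add, hn w hw, Finsupp.mapRange_zero]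

theorem NoSing.pi {M ι : Type*} [AddCommMonoid M] [Finite ι] (h : NoSing G X M) :
    NoSing G X (ι → M) := fun φ hφ => by
  have := Fintype.ofFinite ι
  choose n hn using fun i => h _ (hφ.mapRange (Pi.evalAddMonoidHom (fun _ : ι => M) i))
  refine ⟨Finset.univ.sup n, fun w hw => ?_⟩
  ext t i
  have := mapDomain_rt_eq_zero_of_le (hn i) w (by
    rw [hw]; exact Finset.le_sup (Finset.mem_univ i))
  rw [Finsupp.mapDomain_mapRange _ _ _ _ (map_add _)] at this
  simpa using DFunLike.congr_fun this t

/-- The coefficients of one formal sum span a finitely generated, hence free, submodule, and in a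
basis the sum becomes a finite tuple of sums with coefficients in R. -/
theorem NoSing.of_forall_fg {R V : Type*} [CommRing R] [AddCommGroup V] [Module R V]
    (hfree : ∀ p : Submodule R V, p.FG → Module.Free R p) (h : NoSing G X R) : NoSing G X V := by
  intro φ hφ
  let p : Submodule R V := Submodule.span R (φ '' φ.support)
  have hfg : p.FG := Submodule.fg_span (φ.support.finite_toSet.image _)
  have := hfree p hfg
  have : Module.Finite R p := Module.Finite.iff_fg.mpr hfg
  have hmem : ∀ t, φ t ∈ p := fun t => by
    by_cases ht : t ∈ φ.support
    · exact Submodule.subset_span ⟨t, ht, rfl⟩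
    · rw [Finsupp.notMem_support_iff.mp ht]; exact p.zero_mem
  let ψ : (List X × G) →₀ p := Finsupp.onFinset φ.support (fun t => ⟨φ t, hmem t⟩) fun t ht => by
    rw [Finsupp.mem_support_iff]
    exact fun h0 => ht (Subtype.ext h0)
  have hψ : ψ.mapRange p.subtype.toAddMonoidHom (map_zero _) = φ := by
    ext t; rfl
  have hsing : Sing ψ := fun v => by
    obtain ⟨w, hw⟩ := hφ v
    refine ⟨w, Finsupp.mapRange_injective p.subtype.toAddMonoidHom (map_zero _)
      p.injective_subtype ?_⟩
    rw [← Finsupp.mapDomain_mapRange _ _ _ _ (map_add _), hψ, hw, Finsupp.mapRange_zero]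
  have hp : NoSing G X p := (h.pi (ι := Module.Free.ChooseBasisIndex R p)).of_injective
    (Module.Free.chooseBasis R p).equivFun.toLinearMap.toAddMonoidHom
    (Module.Free.chooseBasis R p).equivFun.injective
  obtain ⟨n, hn⟩ := hp ψ hsing
  refine ⟨n, fun w hw => ?_⟩
  rw [← hψ, Finsupp.mapDomain_mapRange _ _ _ _ (map_add _), hn w hw, Finsupp.mapRange_zero]

/-- In positive characteristic K is a vector space over its prime field. In characteristic zero K is
torsion-free, so its finitely generated subgroups are free; the integers, which are `ZMod 0`, can
then replace the rationals. -/
theorem noSing_iff_zmod (K : Type*) [Field K] (p : ℕ) [CharP K p] :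
    NoSing G X K ↔ NoSing G X (ZMod p) := by
  rcases CharP.char_is_prime_or_zero K p with hp | rfl
  · have := Fact.mk hp
    let _ : Algebra (ZMod p) K := ZMod.algebra K p
    exact ⟨fun h => h.of_injective (algebraMap (ZMod p) K).toAddMonoidHom
      (algebraMap (ZMod p) K).injective, fun h => h.of_forall_fg fun q _ => inferInstance⟩
  · have : CharZero K := CharP.charP_to_charZero K
    change _ ↔ NoSing G X ℤ
    refine ⟨fun h => h.of_injective (Int.castAddHom K) Int.cast_injective, fun h =>
      h.of_forall_fg fun q hq => ?_⟩
    have : Module.Finite ℤ q := Module.Finite.iff_fg.mpr hq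
    infer_instance

/-- The sum of the absolute values of the coefficients. -/
def absSum {α : Type*} (φ : α →₀ ℤ) : ℕ := φ.sum fun _ c => c.natAbs

theorem absSum_add_le {α : Type*} (φ ψ : α →₀ ℤ) : absSum (φ + ψ) ≤ absSum φ + absSum ψ := by
  classical
  have h : ∀ θ : α →₀ ℤ, θ.support ⊆ φ.support ∪ ψ.support →
      absSum θ = ∑ t ∈ φ.support ∪ ψ.support, (θ t).natAbs := fun θ hθ =>
    Finsupp.sum_of_support_subset _ hθ _ (by simp)
  rw [h _ Finsupp.support_add, h φ Finset.subset_union_left, h ψ Finset.subset_union_right,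
    ← Finset.sum_add_distrib]
  exact Finset.sum_le_sum fun t _ => Int.natAbs_add_le _ _

theorem absSum_mapDomain_le {α β : Type*} (f : α → β) (φ : α →₀ ℤ) :
    absSum (φ.mapDomain f) ≤ absSum φ := by
  induction φ using Finsupp.induction with
  | zero => simp [absSum]
  | single_add a b φ ha hb ih =>
    have h1 : absSum (Finsupp.single a b + φ) = b.natAbs + absSum φ := by
      rw [absSum, Finsupp.sum_add_index_of_disjoint, Finsupp.sum_single_index (by simp), absSum]
      rw [Finsupp.support_single _ hb]
      simpa using ha
    rw [Finsupp.mapDomain_add, Finsupp.mapDomain_single, h1]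
    refine (absSum_add_le _ _).trans (Nat.add_le_add ?_ ih)
    rw [absSum, Finsupp.sum_single_index (by simp)]

theorem absSum_smul {α : Type*} (p : ℕ) (φ : α →₀ ℤ) : absSum (p • φ) = p * absSum φ := by
  rw [absSum, Finsupp.sum_of_support_subset (p • φ) (s := φ.support) Finsupp.support_smul _ (by simp),
    absSum, Finsupp.sum, Finset.mul_sum]
  simp [Int.natAbs_mul]

theorem exists_smul_eq_of_mapRange_zmod {α : Type*} {p : ℕ} {φ : α →₀ ℤ}
    (h : φ.mapRange (Int.castAddHom (ZMod p)) (map_zero _) = 0) : ∃ ψ : α →₀ ℤ, φ = p • ψ := by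
  refine ⟨φ.mapRange (· / (p : ℤ)) (by simp), ?_⟩
  ext t
  have h1 : ((φ t : ℤ) : ZMod p) = 0 := by simpa using DFunLike.congr_fun h t
  rw [CharP.intCast_eq_zero_iff (ZMod p) p] at h1
  simp [Int.mul_ediv_cancel' h1]

/-- If there are singular elements over the integers that do not vanish, then there are such
elements in every positive characteristic. -/
theorem noSing_int_of_zmod [Finite X] {p : ℕ} (hp : p.Prime) (h : NoSing G X (ZMod p)) :
    NoSing G X ℤ := by
  intro φ hφ
  induction hn : absSum φ using Nat.strong_induction_on generalizing φ with
  | _ N ih =>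
  obtain ⟨n, hzero⟩ := h _ (hφ.mapRange (Int.castAddHom (ZMod p)))
  by_cases h0 : absSum φ = 0
  · have : φ = 0 := by
      ext t
      by_contra ht
      have := Finset.sum_eq_zero_iff.mp h0 t (Finsupp.mem_support_iff.mpr ht)
      exact ht (by simpa using this)
    exact ⟨0, fun w _ => by rw [this, Finsupp.mapDomain_zero]⟩
  refine evZero_of_forall n fun w hw => ?_
  have h1 := hzero w hw
  rw [Finsupp.mapDomain_mapRange _ _ _ _ (map_add _)] at h1
  obtain ⟨ψ, hψ⟩ := exists_smul_eq_of_mapRange_zmod h1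
  have hinj : ∀ θ : (List X × G) →₀ ℤ, p • θ = 0 → θ = 0 := fun θ hθ =>
    (smul_eq_zero.mp hθ).resolve_left hp.ne_zero
  have hsm : ∀ (v : List X) (θ : (List X × G) →₀ ℤ),
      (p • θ).mapDomain (rt v) = p • θ.mapDomain (rt v) := fun v θ => Finsupp.mapDomain_smul _ _
  have hsing : Sing ψ := fun v => by
    obtain ⟨z, hz⟩ := hφ.mapDomain w v
    exact ⟨z, hinj _ (by rw [← hsm, ← hψ, hz])⟩
  -- Translation does not increase the sum of absolute values, and p is at least 2, so division by p
  -- at least halves the positive number N.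
  have hlt : absSum ψ < N := by
    have h2 := absSum_mapDomain_le (rt w) φ
    rw [hψ, absSum_smul] at h2
    have := Nat.mul_le_mul_right (absSum ψ) hp.two_le
    omega
  obtain ⟨m, hm⟩ := ih _ hlt _ hsing rfl
  exact ⟨m, fun z hz => by rw [hψ, hsm, hm z hz, smul_zero]⟩

end Coefficients

/-! ### Reduction to a finite family and to linear algebra -/

section Families

variable {G X : Type*} [Group G] [MulAction G (List X)] [SelfSimilarGroup G X]
  {ι : Type*} (g : ι → G)

/-- The combination of group elements with coefficients `f`. -/
noncomputable def emb {M : Type*} [AddCommMonoid M] (f : ι →₀ M) : (List X × G) →₀ M :=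
  f.mapDomain fun i => ([], g i)

theorem mapDomain_rt_emb {M : Type*} [AddCommMonoid M] (f : ι →₀ M) (w : List X) :
    (emb g f).mapDomain (rt w) = f.mapDomain fun i => pt (g i) w := by
  rw [emb, ← Finsupp.mapDomain_comp]
  exact Finsupp.mapDomain_congr fun i _ => (pt_eq_rt _ _).symm

variable (X) in
/-- The sections of every group element at long words belong to the family `g`. -/
def ContractsTo : Prop :=
  ∀ h : G, ∃ n, ∀ w : List X, n ≤ w.length → sectWord h w ∈ Set.range g

/-- Left translation of pairs by a word. -/
def lt {G X : Type*} (u : List X) (t : List X × G) : List X × G := (u ++ t.1, t.2)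

theorem lt_injective {G X : Type*} (u : List X) : Function.Injective (lt u : List X × G → List X × G) := by
  rintro ⟨a, b⟩ ⟨c, d⟩ h
  simpa [lt] using h

theorem mapDomain_rt_lt {M : Type*} [AddCommMonoid M] (u w : List X) (φ : (List X × G) →₀ M) :
    (φ.mapDomain (lt u)).mapDomain (rt w) = (φ.mapDomain (rt w)).mapDomain (lt u) := by
  rw [← Finsupp.mapDomain_comp, ← Finsupp.mapDomain_comp]
  congr 1
  funext t
  simp [rt, lt]

theorem mapDomain_rt_lt_eq_zero {M : Type*} [AddCommMonoid M] {u w : List X}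
    {φ : (List X × G) →₀ M} :
    (φ.mapDomain (lt u)).mapDomain (rt w) = 0 ↔ φ.mapDomain (rt w) = 0 := by
  rw [mapDomain_rt_lt]
  exact ⟨fun h => Finsupp.mapDomain_injective (lt_injective u)
    (by rw [h, Finsupp.mapDomain_zero]), fun h => by rw [h, Finsupp.mapDomain_zero]⟩

open scoped Classical in
-- Translation by z appends |z| letters to the first word, so truncation recovers it. Hence the
-- parts of a singular sum with a fixed first word are singular as well.
theorem mapDomain_filter_fst {M : Type*} [AddCommMonoid M] (φ : (List X × G) →₀ M)
    (u z : List X) : (φ.filter fun t => t.1 = u).mapDomain (rt z) =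
      (φ.mapDomain (rt z)).filter fun t => t.1.take (t.1.length - z.length) = u := by
  induction φ using Finsupp.induction_linear with
  | zero => rw [Finsupp.filter_zero, Finsupp.mapDomain_zero, Finsupp.filter_zero]
  | add a b ha hb => simp only [Finsupp.filter_add, Finsupp.mapDomain_add, ha, hb]
  | single t c =>
    have h1 : (rt z t).1.take ((rt z t).1.length - z.length) = t.1 := by
      rw [length_rt]; simp [rt]
    by_cases ht : t.1 = u
    · rw [Finsupp.filter_single_of_pos (fun t : List X × G => t.1 = u) ht,
        Finsupp.mapDomain_single, Finsupp.filter_single_of_pos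
          (fun t : List X × G => t.1.take (t.1.length - z.length) = u) (h1.trans ht)]
    · rw [Finsupp.filter_single_of_neg (fun t : List X × G => t.1 = u) ht,
        Finsupp.mapDomain_zero, Finsupp.mapDomain_single, Finsupp.filter_single_of_neg
          (fun t : List X × G => t.1.take (t.1.length - z.length) = u) (by rwa [h1])]

theorem EvZero.sum {α M : Type*} [AddCommMonoid M] (s : Finset α) (φ : α → (List X × G) →₀ M)
    (h : ∀ a ∈ s, EvZero (φ a)) : EvZero (∑ a ∈ s, φ a) := by
  choose! n hn using h
  refine ⟨s.sup n, fun w hw => ?_⟩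
  rw [Finsupp.mapDomain_finsetSum]
  exact Finset.sum_eq_zero fun a ha =>
    mapDomain_rt_eq_zero_of_le (hn a ha) w (by rw [hw]; exact Finset.le_sup ha)

/-- It suffices to consider combinations of the elements of a family to which `G` contracts. -/
theorem noSing_of_family [Finite X] {M : Type*} [AddCommMonoid M] (hg : ContractsTo X g)
    (h : ∀ f : ι →₀ M, Sing (X := X) (emb g f) → EvZero (X := X) (emb g f)) : NoSing G X M := by
  classical
  intro φ hφ
  choose n hn using hg
  refine evZero_of_forall (φ.support.sup fun t => n t.2) fun w hw => ?_
  have hsing := hφ.mapDomain w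
  have hsupp : ∀ t ∈ (φ.mapDomain (rt w)).support, t.2 ∈ Set.range g := by
    intro t ht
    obtain ⟨s, hs, rfl⟩ := Finset.mem_image.mp (Finsupp.mapDomain_support ht)
    exact hn s.2 w (by
      rw [hw]; exact Finset.le_sup (f := fun t : List X × G => n t.2) hs)
  generalize φ.mapDomain (rt w) = ψ at hsing hsupp
  have hdec : ψ = ∑ u ∈ ψ.support.image Prod.fst, ψ.filter fun t => t.1 = u := by
    ext t
    simp only [Finsupp.finsetSum_apply, Finsupp.filter_apply, Finset.sum_ite_eq]
    split_ifs with ht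
    · rfl
    · by_contra h0
      exact ht (Finset.mem_image_of_mem _ (Finsupp.mem_support_iff.mpr h0))
  rw [hdec]
  refine EvZero.sum _ _ fun u _ => ?_
  set θ := ψ.filter fun t => t.1 = u
  have hθsing : Sing θ := fun v => by
    obtain ⟨z, hz⟩ := hsing v
    exact ⟨z, by rw [mapDomain_filter_fst, hz, Finsupp.filter_zero]⟩
  rcases isEmpty_or_nonempty ι with hι | hι
  · have : θ = 0 := by
      ext t
      by_contra h0
      have ht : t ∈ ψ.support := by
        have h1 := Finsupp.mem_support_iff.mpr h0
        rw [Finsupp.support_filter, Finset.mem_filter] at h1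
        exact h1.1
      obtain ⟨i, _⟩ := hsupp t ht
      exact hι.elim i
    exact ⟨0, fun w _ => by rw [this, Finsupp.mapDomain_zero]⟩
  -- The family may have repetitions, so an index is chosen for each group element. With the common
  -- prefix u removed, θ becomes a combination of the family.
  let f : ι →₀ M := θ.mapDomain fun t => Function.invFun g t.2
  have hf : (emb g f).mapDomain (lt u) = θ := by
    rw [emb, ← Finsupp.mapDomain_comp, ← Finsupp.mapDomain_comp]
    conv_rhs => rw [← Finsupp.mapDomain_id (v := θ)]
    refine Finsupp.mapDomain_congr fun t ht => ?_
    rw [Finsupp.support_filter, Finset.mem_filter] at ht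
    have h1 : g (Function.invFun g t.2) = t.2 := Function.invFun_eq (hsupp t ht.1)
    simp [lt, h1, ← ht.2]
  have hfs : Sing (X := X) (emb g f) := fun v => by
    obtain ⟨z, hz⟩ := hθsing v
    rw [← hf, mapDomain_rt_lt_eq_zero] at hz
    exact ⟨z, hz⟩
  obtain ⟨m, hm⟩ := h f hfs
  exact ⟨m, fun z hz => by rw [← hf, mapDomain_rt_lt_eq_zero]; exact hm z hz⟩

/-- The word `v` resolves the family `g` if members of the family with the same image of `v` have
the same section at `v`. -/
def Resolving (v : List X) : Prop :=
  ∀ i j, g i • v = g j • v → pt (g i) v = pt (g j) v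

/-- At a resolving word, distinct translates have distinct first words of equal length, and no
further translation can merge them. So an extension of v annihilates the sum only if v already does.
-/
theorem mapDomain_eq_zero_of_resolving {M : Type*} [AddCommMonoid M] {f : ι →₀ M}
    (hf : Sing (X := X) (emb g f)) {v : List X} (hv : Resolving g v) :
    (emb g f).mapDomain (rt v) = 0 := by
  classical
  obtain ⟨w, hw⟩ := hf v
  rw [mapDomain_rt_append] at hw
  have hinj : Set.InjOn (rt w) (Set.range fun i => pt (g i) v) := by
    rintro _ ⟨i, rfl⟩ _ ⟨j, rfl⟩ hij
    exact hv i j (fst_eq_of_rt_eq hij)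
  refine Finsupp.mapDomain_injOn _ hinj ?_ (by simp) (by rw [hw, Finsupp.mapDomain_zero])
  rw [mapDomain_rt_emb]
  intro t ht
  obtain ⟨i, _, rfl⟩ := Finset.mem_image.mp (Finsupp.mapDomain_support ht)
  exact ⟨i, rfl⟩

/-- Resolving words are cofinal. Hence annihilation by all of them is not only necessary but also
sufficient for singularity. -/
theorem exists_append_resolving [Finite ι] [Nontrivial X] (v : List X) :
    ∃ w, Resolving g (v ++ w) := by
  classical
  have := Fintype.ofFinite ι
  obtain ⟨w, hw⟩ := exists_resolving (Finset.univ.image fun i => (([] : List X), g i)) v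
  refine ⟨w, fun i j hij => ?_⟩
  rcases hw _ (Finset.mem_image_of_mem _ (Finset.mem_univ i)) _
    (Finset.mem_image_of_mem _ (Finset.mem_univ j)) with h | h
  · rw [pt_eq_rt, pt_eq_rt, h]
  · rw [← pt_eq_rt, ← pt_eq_rt] at h
    exact absurd (by simp only [pt] at h ⊢; rw [hij]) h.1

open scoped Classical in
/-- The indicator function of the class of `i`, where two members of the family are
equivalent if they agree on the words that start with `w`. -/
noncomputable def row (w : List X) (i : ι) : ι → ℤ :=
  fun j => if pt (g j) w = pt (g i) w then 1 else 0

open scoped Classical in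
theorem mapDomain_apply_fintype {α β M : Type*} [Fintype α] [AddCommMonoid M] (h : α → β)
    (f : α →₀ M) (b : β) : f.mapDomain h b = ∑ a, if h a = b then f a else 0 := by
  rw [Finsupp.mapDomain, Finsupp.sum_fintype _ _ (by simp), Finsupp.finsetSum_apply]
  simp [Finsupp.single_apply]

/-- This turns annihilation by w into orthogonality to the rows at w, which are integral and thus
independent of the coefficients. -/
theorem mapDomain_emb_apply [Fintype ι] {R : Type*} [CommRing R] (f : ι →₀ R) (w : List X)
    (i : ι) : (emb g f).mapDomain (rt w) (pt (g i) w) = ∑ j, (row g w i j : R) * f j := by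
  classical
  rw [mapDomain_rt_emb, mapDomain_apply_fintype]
  refine Finset.sum_congr rfl fun j _ => ?_
  rw [row]
  split_ifs <;> simp

theorem mapDomain_emb_eq_zero [Fintype ι] {M : Type*} [AddCommMonoid M] {f : ι →₀ M} {w : List X}
    (h : ∀ i, (emb g f).mapDomain (rt w) (pt (g i) w) = 0) : (emb g f).mapDomain (rt w) = 0 := by
  classical
  ext t
  by_cases ht : ∃ i, pt (g i) w = t
  · obtain ⟨i, rfl⟩ := ht
    exact h i
  · push Not at ht
    rw [mapDomain_rt_emb, mapDomain_apply_fintype]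
    exact Finset.sum_eq_zero fun i _ => if_neg (ht i)

variable (X) in
/-- The rows at resolving words. -/
def resRows : Set (ι → ℤ) := {r | ∃ (v : List X) (i : ι), Resolving g v ∧ r = row g v i}

theorem not_dvd_mul {p a b : ℕ} (hp : p.Prime ∨ p = 0) (ha : ¬ p ∣ a) (hb : ¬ p ∣ b) :
    ¬ p ∣ a * b := by
  rcases hp with hp | rfl
  · exact fun h => (hp.dvd_mul.mp h).elim ha hb
  · simp only [zero_dvd_iff] at *
    exact mul_ne_zero ha hb

theorem not_dvd_one {p : ℕ} (hp : p.Prime ∨ p = 0) : ¬ p ∣ 1 := by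
  rcases hp with hp | rfl
  · exact hp.one_lt.ne' ∘ Nat.dvd_one.mp
  · simp

/-- The vectors that have a multiple, by a factor that is nonzero modulo `p`, which agrees modulo
`p` with an element of the subgroup generated by `S`. -/
def satSpan {p : ℕ} (hp : p.Prime ∨ p = 0) (S : Set (ι → ℤ)) : AddSubgroup (ι → ℤ) where
  carrier := {x | ∃ D : ℕ, ¬ p ∣ D ∧ ∃ y ∈ AddSubgroup.closure S, ∀ k, (p : ℤ) ∣ D * x k - y k}
  zero_mem' := ⟨1, not_dvd_one hp, 0, zero_mem _, by simp⟩
  add_mem' := by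
    rintro a b ⟨D, hD, y, hy, h⟩ ⟨E, hE, z, hz, h'⟩
    refine ⟨D * E, not_dvd_mul hp hD hE, E • y + D • z,
      add_mem (nsmul_mem hy _) (nsmul_mem hz _), fun k => ?_⟩
    have := ((h k).mul_left (E : ℤ)).add ((h' k).mul_left (D : ℤ))
    have e : ((D * E : ℕ) : ℤ) * (a + b) k - (E • y + D • z) k =
        E * (D * a k - y k) + D * (E * b k - z k) := by
      simp; ring
    rwa [e]
  neg_mem' := by
    rintro a ⟨D, hD, y, hy, h⟩
    refine ⟨D, hD, -y, neg_mem hy, fun k => ?_⟩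
    have e : (D : ℤ) * (-a) k - (-y) k = -(D * a k - y k) := by
      simp; ring
    rw [e]
    exact (h k).neg_right

theorem subset_satSpan {p : ℕ} (hp : p.Prime ∨ p = 0) {S : Set (ι → ℤ)} {x : ι → ℤ} (hx : x ∈ S) :
    x ∈ satSpan hp S :=
  ⟨1, not_dvd_one hp, x, AddSubgroup.subset_closure hx, by simp⟩

/-- The product of the individual denominators serves for all vectors. For p = 0 this common D is
the number whose prime divisors bound the exceptional set. -/
theorem exists_uniform_satSpan {p : ℕ} (hp : p.Prime ∨ p = 0) {S : Set (ι → ℤ)}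
    (T : Finset (ι → ℤ)) (h : ∀ x ∈ T, x ∈ satSpan hp S) :
    ∃ D : ℕ, ¬ p ∣ D ∧ ∀ x ∈ T, ∃ y ∈ AddSubgroup.closure S, ∀ k, (p : ℤ) ∣ D * x k - y k := by
  classical
  induction T using Finset.induction_on with
  | empty => exact ⟨1, not_dvd_one hp, by simp⟩
  | insert a T ha ih =>
    obtain ⟨D, hD, hT⟩ := ih fun x hx => h x (Finset.mem_insert_of_mem hx)
    obtain ⟨E, hE, y, hy, hyk⟩ := h a (Finset.mem_insert_self a T)
    refine ⟨D * E, not_dvd_mul hp hD hE, fun x hx => ?_⟩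
    rcases Finset.mem_insert.mp hx with rfl | hx
    · refine ⟨D • y, nsmul_mem hy _, fun k => ?_⟩
      have e : ((D * E : ℕ) : ℤ) * x k - (D • y) k = D * (E * x k - y k) := by
        simp; ring
      rw [e]
      exact (hyk k).mul_left (D : ℤ)
    · obtain ⟨z, hz, hzk⟩ := hT x hx
      refine ⟨E • z, nsmul_mem hz _, fun k => ?_⟩
      have e : ((D * E : ℕ) : ℤ) * x k - (E • z) k = E * (D * x k - z k) := by
        simp; ring
      rw [e]
      exact (hzk k).mul_left (E : ℤ)

theorem NoSing.of_zmod_module {p : ℕ} [Fact p.Prime] {V : Type*} [AddCommGroup V]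
    [Module (ZMod p) V] (h : NoSing G X (ZMod p)) : NoSing G X V :=
  h.of_forall_fg fun _ _ => inferInstance

/-- For p prime the quotient is killed by p, hence a vector space over `ZMod p`. For p = 0 it is
torsion-free, because a factor n can be absorbed into the denominator, so its finitely generated
subgroups are free. -/
theorem noSing_quotient {p : ℕ} (hp : p.Prime ∨ p = 0) (S : Set (ι → ℤ))
    (h : NoSing G X (ZMod p)) : NoSing G X ((ι → ℤ) ⧸ satSpan hp S) := by
  have h1 := hp
  rcases h1 with hp' | rfl
  · have := Fact.mk hp'
    have hpx : ∀ x : (ι → ℤ) ⧸ satSpan hp S, p • x = 0 := by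
      intro x
      obtain ⟨x, rfl⟩ := QuotientAddGroup.mk_surjective x
      rw [← QuotientAddGroup.mk_nsmul, QuotientAddGroup.eq_zero_iff]
      exact ⟨1, not_dvd_one hp, 0, zero_mem _, fun k => by simp⟩
    let _ : Module (ZMod p) ((ι → ℤ) ⧸ satSpan hp S) := AddCommGroup.zmodModule hpx
    exact h.of_zmod_module
  · change NoSing G X ℤ at h
    refine h.of_forall_fg fun q hq => ?_
    have : Module.Finite ℤ q := Module.Finite.iff_fg.mpr hq
    have : Module.IsTorsionFree ℤ ((ι → ℤ) ⧸ satSpan hp S) := by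
      refine Module.isTorsionFree_int_iff_isAddTorsionFree.mpr ⟨fun n hn => ?_⟩
      refine (injective_iff_map_eq_zero
        (nsmulAddMonoidHom (α := (ι → ℤ) ⧸ satSpan hp S) n)).mpr fun x hx => ?_
      obtain ⟨x, rfl⟩ := QuotientAddGroup.mk_surjective x
      change n • (x : (ι → ℤ) ⧸ satSpan hp S) = 0 at hx
      rw [← QuotientAddGroup.mk_nsmul, QuotientAddGroup.eq_zero_iff] at hx
      obtain ⟨D, hD, y, hy, hk⟩ := hx
      refine (QuotientAddGroup.eq_zero_iff _).mpr ⟨D * n, not_dvd_mul hp hD (by simpa using hn),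
        y, hy, fun k => ?_⟩
      simpa [mul_assoc] using hk k
    infer_instance

/-- A universal singular element does it: its coefficients are the classes of the basis vectors
modulo the span of the resolving rows. Its translate by w has the classes of the rows at w as
coefficients, so it is singular by construction, and its eventual vanishing puts the rows into the
span at one uniform length. -/
theorem exists_forall_row_mem [Fintype ι] [Nontrivial X] {p : ℕ} (hp : p.Prime ∨ p = 0)
    (h : NoSing G X (ZMod p)) :
    ∃ n, ∀ w : List X, w.length = n → ∀ i, row g w i ∈ satSpan hp (resRows X g) := by
  classical
  let Q := (ι → ℤ) ⧸ satSpan hp (resRows X g)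
  let f : ι →₀ Q := Finsupp.equivFunOnFinite.symm fun i =>
    QuotientAddGroup.mk' (satSpan hp (resRows X g)) (Pi.single i 1)
  have key : ∀ (w : List X) (i : ι), (emb g f).mapDomain (rt w) (pt (g i) w) =
      QuotientAddGroup.mk' (satSpan hp (resRows X g)) (row g w i) := by
    intro w i
    have h1 : row g w i = ∑ j, if pt (g j) w = pt (g i) w then Pi.single j 1 else 0 := by
      funext k
      rw [row, Finset.sum_apply, Finset.sum_eq_single k]
      · split_ifs <;> simp
      · intro j _ hj
        split_ifs <;> simp [hj.symm]
      · simp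
    rw [mapDomain_rt_emb, mapDomain_apply_fintype, h1, map_sum]
    refine Finset.sum_congr rfl fun j _ => ?_
    split_ifs
    · rfl
    · rw [map_zero]
  obtain ⟨n, hn⟩ := noSing_quotient hp (resRows X g) h (emb g f) fun v => by
    obtain ⟨w, hw⟩ := exists_append_resolving g v
    refine ⟨w, mapDomain_emb_eq_zero g fun i => ?_⟩
    rw [key]
    exact (QuotientAddGroup.eq_zero_iff _).mpr (subset_satSpan hp ⟨_, i, hw, rfl⟩)
  refine ⟨n, fun w hw i => ?_⟩
  have := key w i
  rw [hn w hw] at this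
  exact (QuotientAddGroup.eq_zero_iff _).mp this.symm

/-- A singular f is orthogonal to the resolving rows, hence to D times each row at length n; the
factor D is nonzero in the domain `ZMod p` and can be cancelled. -/
theorem noSing_of_forall_row_mem [Finite X] [Fintype ι] (hg : ContractsTo X g) {p : ℕ}
    (hp : p.Prime ∨ p = 0) {n : ℕ}
    (h : ∀ w : List X, w.length = n → ∀ i, row g w i ∈ satSpan hp (resRows X g)) :
    NoSing G X (ZMod p) := by
  refine noSing_of_family g hg fun f hf => ⟨n, fun w hw => mapDomain_emb_eq_zero g fun i => ?_⟩
  have hdom : IsDomain (ZMod p) := by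
    rcases hp with hp | rfl
    · have := Fact.mk hp
      infer_instance
    · exact inferInstanceAs (IsDomain ℤ)
  rw [mapDomain_emb_apply]
  let P : (ι → ℤ) →+ ZMod p :=
    { toFun := fun x => ∑ j, (x j : ZMod p) * f j
      map_zero' := by simp
      map_add' := fun x y => by simp [add_mul, Finset.sum_add_distrib] }
  have hP : ∀ y ∈ AddSubgroup.closure (resRows X g), P y = 0 := by
    intro y hy
    have : AddSubgroup.closure (resRows X g) ≤ P.ker := by
      rw [AddSubgroup.closure_le]
      rintro _ ⟨v, j, hv, rfl⟩
      change P _ = 0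
      have := mapDomain_emb_apply g f v j
      rw [mapDomain_eq_zero_of_resolving g hf hv] at this
      exact this.symm
    exact this hy
  obtain ⟨D, hD, y, hy, hk⟩ := h w hw i
  have h1 : (D : ZMod p) * P (row g w i) = P y := by
    change _ * ∑ j, _ = ∑ j, _
    rw [Finset.mul_sum]
    refine Finset.sum_congr rfl fun j _ => ?_
    have := (CharP.intCast_eq_zero_iff (ZMod p) p _).mpr (hk j)
    push_cast at this
    rw [← mul_assoc, sub_eq_zero.mp this]
  rw [hP y hy] at h1
  refine (mul_eq_zero.mp h1).resolve_left fun h0 => hD ?_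
  exact (CharP.cast_eq_zero_iff (ZMod p) p D).mp h0

end Families

end SelfSimilarGroup

/-! ### Closure properties of primitive recursive predicates -/

theorem PrimrecPred.ball {α β : Type*} [Primcodable α] [Primcodable β] {l : α → List β}
    {p : α → β → Prop} (hl : Primrec l) (hp : PrimrecPred fun x : α × β => p x.1 x.2) :
    PrimrecPred fun a => ∀ b ∈ l a, p a b :=
  (PrimrecRel.forall_mem_list (R := fun b a => p a b)
    (hp.comp (Primrec.pair Primrec.snd Primrec.fst))).comp hl Primrec.id

theorem PrimrecPred.bex {α β : Type*} [Primcodable α] [Primcodable β] {l : α → List β}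
    {p : α → β → Prop} (hl : Primrec l) (hp : PrimrecPred fun x : α × β => p x.1 x.2) :
    PrimrecPred fun a => ∃ b ∈ l a, p a b :=
  (PrimrecRel.exists_mem_list (R := fun b a => p a b)
    (hp.comp (Primrec.pair Primrec.snd Primrec.fst))).comp hl Primrec.id

theorem PrimrecPred.imp {α : Type*} [Primcodable α] {p q : α → Prop} (hp : PrimrecPred p)
    (hq : PrimrecPred q) : PrimrecPred fun a => p a → q a :=
  (hp.not.or hq).of_eq fun _ => imp_iff_not_or.symm

theorem PrimrecPred.iff {α : Type*} [Primcodable α] {p q : α → Prop} (hp : PrimrecPred p)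
    (hq : PrimrecPred q) : PrimrecPred fun a => p a ↔ q a :=
  ((hp.imp hq).and (hq.imp hp)).of_eq fun _ => iff_def.symm

theorem PrimrecPred.eq_of {α β : Type*} [Primcodable α] [Primcodable β] {f g : α → β}
    (hf : Primrec f) (hg : Primrec g) : PrimrecPred fun a => f a = g a := by
  classical
  exact PrimrecRel.comp (R := fun a b : β => a = b) Primrec.eq hf hg

open scoped Classical in
theorem Primrec.list_filter_comp {α β : Type*} [Primcodable α] [Primcodable β] {l : α → List β}
    {p : α → β → Prop} (hl : Primrec l) (hp : PrimrecPred fun x : α × β => p x.1 x.2) :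
    Primrec fun a => (l a).filter fun b => decide (p a b) :=
  (PrimrecRel.listFilter (R := fun b a => p a b)
    (hp.comp (Primrec.pair Primrec.snd Primrec.fst))).comp hl Primrec.id

/-! ### Finite certificates on tables -/

namespace SelfSimilarGroup

namespace Decide

/-- Tables of automata. -/
abbrev Tbl := List (List (ℕ × ℕ))

/-- The letter and the state that the state `c` produces from the letter `x`. The states are coded
as follows: `2 i` is the state with number `i`, `2 i + 1` is its inverse, and all
other numbers stand for the identity. -/
def stepL (t : Tbl) (x c : ℕ) : ℕ × ℕ :=
  if c < 2 * t.length then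
    if c % 2 = 0 then
      (((t.getD (c / 2) []).getD x (0, 0)).1, 2 * ((t.getD (c / 2) []).getD x (0, 0)).2)
    else
      -- The inverse of a state a sends x to the letter y with a(y) = x, found by searching the row,
      -- and its section at x is the inverse of a|_y.
      ((t.getD (c / 2) []).findIdx fun e => decide (e.1 = x),
        2 * ((t.getD (c / 2) []).getD
          ((t.getD (c / 2) []).findIdx fun e => decide (e.1 = x)) (0, 0)).2 + 1)
  else (x, c)

/-- The letter and the product of states that a product of states produces from a letter. -/
def stepW (t : Tbl) (u : List ℕ) (x : ℕ) : ℕ × List ℕ :=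
  u.foldr (fun c s => ((stepL t s.1 c).1, (stepL t s.1 c).2 :: s.2)) (x, [])

/-- The reversed image of the word `w` under a product of states, and the section at `w`. -/
def run (t : Tbl) (u w : List ℕ) : List ℕ × List ℕ :=
  w.foldl (fun s x => ((stepW t s.2 x).1 :: s.1, (stepW t s.2 x).2)) ([], u)

/-- All words of length `n` over the letters `0, …, c - 1`. -/
def words (c n : ℕ) : List (List ℕ) :=
  Nat.rec [[]] (fun _ l => l.flatMap fun w => (List.range c).map fun x => x :: w) n

/-- All products of `n` factors. -/
def cw (t : Tbl) (n : ℕ) : List (List ℕ) := words (2 * t.length + 1) n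

/-- Agreement of two products of states on all words of length `k`. -/
def Agree (t : Tbl) (d k : ℕ) (u v : List ℕ) : Prop :=
  ∀ z ∈ words d k, (run t u z).1 = (run t v z).1

/-- Agreement on words of length `k` implies agreement on words of length `k + 1`. -/
def Good (t : Tbl) (d k n : ℕ) : Prop :=
  ∀ u ∈ cw t n, ∀ v ∈ cw t n, Agree t d k u v → Agree t d (k + 1) u v

/-- The sections of products of length `m + 1` at words of length `n` are products of length `m`. -/
def Contr (t : Tbl) (d k m n : ℕ) : Prop :=
  ∀ u ∈ cw t (m + 1), ∀ w ∈ words d n, ∃ v ∈ cw t m,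
    -- The code of the identity pads v to length m + 1, so that both sides are products to which
    -- `Good` for length m + 1 applies.
    Agree t d k (run t u w).2 (2 * t.length :: v)

/-- All products of length `m` have the same sections at `w` and `w'`, and the same coincidences
between images of `w` and of `w'`. -/
def Same (t : Tbl) (d k m : ℕ) (w w' : List ℕ) : Prop :=
  ∀ i ∈ cw t m, Agree t d k (run t i w).2 (run t i w').2 ∧
    ∀ j ∈ cw t m, ((run t i w).1 = (run t j w).1 ↔ (run t i w').1 = (run t j w').1)

/-- The letters of `w` are less than `d`. -/
def Valid (d : ℕ) (w : List ℕ) : Prop := ∀ x ∈ w, x < d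

/-- The words in `l` represent all words up to `Same`. -/
def Closed (t : Tbl) (d k m : ℕ) (l : List (List ℕ)) : Prop :=
  [] ∈ l ∧ ∀ w ∈ l, Valid d w ∧ ∀ x ∈ List.range d, ∃ w' ∈ l, Same t d k m (w ++ [x]) w'

/-- The products `i` and `j` agree on all words that start with `w`. -/
def Equ (t : Tbl) (d k : ℕ) (w i j : List ℕ) : Prop :=
  (run t i w).1 = (run t j w).1 ∧ Agree t d k (run t i w).2 (run t j w).2

open scoped Classical in
/-- The number of elements of `l` that are equivalent to `i` at `w`. -/
noncomputable def cnt (t : Tbl) (d k : ℕ) (l : List (List ℕ)) (w i : List ℕ) : ℕ :=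
  (l.filter fun j => decide (Equ t d k w j i)).length

/-- The word `w` annihilates the difference of the sums over two lists, modulo `p`. -/
def Van (t : Tbl) (d k m p : ℕ) (l l' : List (List ℕ)) (w : List ℕ) : Prop :=
  ∀ i ∈ cw t m, cnt t d k l w i % p = cnt t d k l' w i % p

/-- Certificates for the existence of a singular element that does not vanish. -/
abbrev NCert := (List (List ℕ) × List (List ℕ)) × (List (List ℕ) × List (List ℕ))

/-- The certificate `c` proves that there is a singular element modulo `p` that does not vanish. -/
def NonCert (t : Tbl) (d k m : ℕ) (l : List (List ℕ)) (p : ℕ) (c : NCert) : Prop :=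
  (∀ u ∈ c.1.1 ++ c.1.2, u ∈ cw t m) ∧
  (∀ v ∈ l, ∃ w ∈ c.2.1, Valid d w ∧ Van t d k m p c.1.1 c.1.2 (v ++ w)) ∧
  -- The list of persistent words is nonempty; otherwise the last condition would be void.
  (∃ w ∈ c.2.2, w = w) ∧
  ∀ w ∈ c.2.2, Valid d w ∧ ¬ Van t d k m p c.1.1 c.1.2 w ∧
    ∃ x ∈ List.range d, ∃ w' ∈ c.2.2, Same t d k m (w ++ [x]) w'

/-- The word `v` resolves the products of length `m`. -/
def Resolves (t : Tbl) (d k m : ℕ) (v : List ℕ) : Prop :=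
  ∀ i ∈ cw t m, ∀ j ∈ cw t m, (run t i v).1 = (run t j v).1 →
    Agree t d k (run t i v).2 (run t j v).2

/-- Integer combinations of indicator functions of classes. -/
abbrev Comb := List (List ℕ × List ℕ) × List (List ℕ × List ℕ)

/-- Certificates for the vanishing of all singular elements. -/
abbrev SCert := ℕ × ℕ × List Comb

open scoped Classical in
/-- The number of classes in `l` that contain `j`. -/
noncomputable def cntC (t : Tbl) (d k : ℕ) (l : List (List ℕ × List ℕ)) (j : List ℕ) : ℕ :=
  (l.filter fun q => decide (Equ t d k q.1 j q.2)).length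

open scoped Classical in
/-- The certificate `s` proves that all singular elements modulo `p` vanish. -/
def SimpCert (t : Tbl) (d k m p : ℕ) (s : SCert) : Prop :=
  -- The number `s.1` is the denominator D. Since reduction modulo 0 is the identity, p = 0 asks for
  -- D nonzero and for exact equalities. The negative terms of a combination are moved to the other
  -- side to stay within natural numbers.
  s.1 % p ≠ 0 ∧ ∀ w ∈ words d s.2.1, ∀ i ∈ cw t m, ∃ c ∈ s.2.2,
    (∀ q ∈ c.1 ++ c.2, q.2 ∈ cw t m ∧ Valid d q.1 ∧ Resolves t d k m q.1) ∧
    ∀ j ∈ cw t m, ((if Equ t d k w j i then s.1 else 0) + cntC t d k c.2 j) % p =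
      cntC t d k c.1 j % p

/-- Primality, by trial division. -/
def IsPrime (p : ℕ) : Prop := 2 ≤ p ∧ ∀ m ∈ List.range p, p % m = 0 → m = 1

/-- Certificates for the base data: `k`, `m`, the contraction depth, and representatives of the
words. -/
abbrev BCert := (ℕ × ℕ × ℕ) × List (List ℕ)

/-- The base data are correct. -/
def Base (t : Tbl) (d : ℕ) (b : BCert) : Prop :=
  Good t d b.1.1 (b.1.2.1 + 1) ∧ Contr t d b.1.1 b.1.2.1 b.1.2.2 ∧ Closed t d b.1.1 b.1.2.1 b.2

/-- Certificates for the outputs. -/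
abbrev Cert := BCert × (List NCert × (SCert × List SCert)) × List ℕ

/-- The certificate proves that there is a singular integral element that does not vanish. -/
def CheckNone (a : ℕ × Tbl) (c : Cert) : Prop :=
  Base a.2 a.1 c.1 ∧ ∃ e ∈ c.2.1.1, NonCert a.2 a.1 c.1.1.1 c.1.1.2.1 c.1.2 0 e

/-- The certificate proves that the list of exceptional primes is correct. -/
def CheckSome (a : ℕ × Tbl) (c : Cert) : Prop :=
  Base a.2 a.1 c.1 ∧
  (∀ p ∈ c.2.2, IsPrime p ∧
    ∃ e ∈ c.2.1.1, NonCert a.2 a.1 c.1.1.1 c.1.1.2.1 c.1.2 p e) ∧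
  SimpCert a.2 a.1 c.1.1.1 c.1.1.2.1 0 c.2.1.2.1 ∧
  -- Every prime divisor of the nonzero denominator D of the characteristic zero certificate is at
  -- most D, so these primes include all that the certificate leaves open.
  ∀ p ∈ List.range (c.2.1.2.1.1 + 1), IsPrime p →
    (∃ q ∈ c.2.2, p = q) ∨ ∃ s ∈ c.2.1.2.2, SimpCert a.2 a.1 c.1.1.1 c.1.1.2.1 p s

/-! ### Certificate checking is primitive recursive -/

section Primrec

variable {α : Type*} [Primcodable α] {t : α → Tbl} {d k m n p : α → ℕ}
  {u v w i j : α → List ℕ} {l l' : α → List (List ℕ)}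

theorem primrec_stepL : Primrec fun a : Tbl × ℕ × ℕ => stepL a.1 a.2.1 a.2.2 := by
  have hc : Primrec fun a : Tbl × ℕ × ℕ => a.2.2 := Primrec.snd.comp Primrec.snd
  have hx : Primrec fun a : Tbl × ℕ × ℕ => a.2.1 := Primrec.fst.comp Primrec.snd
  have hrow : Primrec fun a : Tbl × ℕ × ℕ => a.1.getD (a.2.2 / 2) [] :=
    (Primrec.list_getD []).comp Primrec.fst (Primrec.nat_div.comp hc (Primrec.const 2))
  have hget : ∀ {y : Tbl × ℕ × ℕ → ℕ}, Primrec y → Primrec fun a : Tbl × ℕ × ℕ =>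
      (a.1.getD (a.2.2 / 2) []).getD (y a) (0, 0) := fun hy =>
    (Primrec.list_getD (0, 0)).comp hrow hy
  have hidx : Primrec fun a : Tbl × ℕ × ℕ =>
      (a.1.getD (a.2.2 / 2) []).findIdx fun e => decide (e.1 = a.2.1) :=
    Primrec.list_findIdx hrow (PrimrecPred.eq_of (α := (Tbl × ℕ × ℕ) × (ℕ × ℕ))
      (Primrec.fst.comp Primrec.snd) (hx.comp Primrec.fst)).decide
  refine Primrec.ite (Primrec.nat_lt.comp hc (Primrec.nat_mul.comp (Primrec.const 2)
    (Primrec.list_length.comp Primrec.fst))) (Primrec.ite (PrimrecPred.eq_of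
      (Primrec.nat_mod.comp hc (Primrec.const 2)) (Primrec.const 0)) ?_ ?_) (Primrec.pair hx hc)
  · exact Primrec.pair (Primrec.fst.comp (hget hx))
      (Primrec.nat_mul.comp (Primrec.const 2) (Primrec.snd.comp (hget hx)))
  · exact Primrec.pair hidx (Primrec.nat_add.comp
      (Primrec.nat_mul.comp (Primrec.const 2) (Primrec.snd.comp (hget hidx))) (Primrec.const 1))

theorem primrec_stepW : Primrec fun a : Tbl × List ℕ × ℕ => stepW a.1 a.2.1 a.2.2 := by
  have h1 : Primrec fun q : (Tbl × List ℕ × ℕ) × ℕ × (ℕ × List ℕ) =>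
      stepL q.1.1 q.2.2.1 q.2.1 :=
    primrec_stepL.comp (Primrec.pair (Primrec.fst.comp Primrec.fst)
      (Primrec.pair (Primrec.fst.comp (Primrec.snd.comp Primrec.snd))
        (Primrec.fst.comp Primrec.snd)))
  exact Primrec.list_foldr (h := fun (a : Tbl × List ℕ × ℕ) (b : ℕ × (ℕ × List ℕ)) =>
      ((stepL a.1 b.2.1 b.1).1, (stepL a.1 b.2.1 b.1).2 :: b.2.2))
    (Primrec.fst.comp Primrec.snd)
    (Primrec.pair (Primrec.snd.comp Primrec.snd) (Primrec.const []))
    (Primrec.pair (Primrec.fst.comp h1) (Primrec.list_cons.comp (Primrec.snd.comp h1)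
      (Primrec.snd.comp (Primrec.snd.comp Primrec.snd))))

theorem primrec_run₀ : Primrec fun a : Tbl × List ℕ × List ℕ => run a.1 a.2.1 a.2.2 := by
  have h1 : Primrec fun q : (Tbl × List ℕ × List ℕ) × (List ℕ × List ℕ) × ℕ =>
      stepW q.1.1 q.2.1.2 q.2.2 :=
    primrec_stepW.comp (Primrec.pair (Primrec.fst.comp Primrec.fst)
      (Primrec.pair (Primrec.snd.comp (Primrec.fst.comp Primrec.snd))
        (Primrec.snd.comp Primrec.snd)))
  exact Primrec.list_foldl
    (h := fun (a : Tbl × List ℕ × List ℕ) (b : (List ℕ × List ℕ) × ℕ) =>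
      ((stepW a.1 b.1.2 b.2).1 :: b.1.1, (stepW a.1 b.1.2 b.2).2))
    (Primrec.snd.comp Primrec.snd)
    (Primrec.pair (Primrec.const []) (Primrec.fst.comp Primrec.snd))
    (Primrec.pair (Primrec.list_cons.comp (Primrec.fst.comp h1)
      (Primrec.fst.comp (Primrec.fst.comp Primrec.snd))) (Primrec.snd.comp h1))

theorem primrec_run (ht : Primrec t) (hu : Primrec u) (hw : Primrec w) :
    Primrec fun a => run (t a) (u a) (w a) :=
  primrec_run₀.comp (ht.pair (hu.pair hw))

theorem primrec_words (hd : Primrec d) (hn : Primrec n) : Primrec fun a => words (d a) (n a) := by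
  refine Primrec.nat_rec' (f := n) (g := fun _ => [[]])
    (h := fun a (b : ℕ × List (List ℕ)) => b.2.flatMap fun w =>
      (List.range (d a)).map fun x => x :: w) hn (Primrec.const _) ?_
  refine Primrec.list_flatMap (Primrec.snd.comp Primrec.snd) ?_
  refine Primrec.list_map (Primrec.list_range.comp (hd.comp (Primrec.fst.comp Primrec.fst))) ?_
  exact Primrec.list_cons.comp Primrec.snd (Primrec.snd.comp Primrec.fst)

theorem primrec_cw (ht : Primrec t) (hn : Primrec n) : Primrec fun a => cw (t a) (n a) :=
  primrec_words (Primrec.nat_add.comp (Primrec.nat_mul.comp (Primrec.const 2)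
    (Primrec.list_length.comp ht)) (Primrec.const 1)) hn

theorem primrecPred_agree (ht : Primrec t) (hd : Primrec d) (hk : Primrec k) (hu : Primrec u)
    (hv : Primrec v) : PrimrecPred fun a => Agree (t a) (d a) (k a) (u a) (v a) :=
  PrimrecPred.ball (primrec_words hd hk) (PrimrecPred.eq_of
    (Primrec.fst.comp (primrec_run (ht.comp Primrec.fst) (hu.comp Primrec.fst) Primrec.snd))
    (Primrec.fst.comp (primrec_run (ht.comp Primrec.fst) (hv.comp Primrec.fst) Primrec.snd)))

theorem primrecPred_good (ht : Primrec t) (hd : Primrec d) (hk : Primrec k) (hn : Primrec n) :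
    PrimrecPred fun a => Good (t a) (d a) (k a) (n a) := by
  have h1 := Primrec.fst (α := α) (β := List ℕ)
  have h2 := h1.comp (Primrec.fst (α := α × List ℕ) (β := List ℕ))
  refine PrimrecPred.ball (primrec_cw ht hn) (PrimrecPred.ball
    ((primrec_cw ht hn).comp h1) (PrimrecPred.imp ?_ ?_))
  · exact primrecPred_agree (ht.comp h2) (hd.comp h2) (hk.comp h2)
      (Primrec.snd.comp Primrec.fst) Primrec.snd
  · exact primrecPred_agree (ht.comp h2) (hd.comp h2)
      (Primrec.succ.comp (hk.comp h2)) (Primrec.snd.comp Primrec.fst) Primrec.snd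

theorem primrecPred_contr (ht : Primrec t) (hd : Primrec d) (hk : Primrec k) (hm : Primrec m)
    (hn : Primrec n) : PrimrecPred fun a => Contr (t a) (d a) (k a) (m a) (n a) := by
  have h1 := Primrec.fst (α := α) (β := List ℕ)
  have h2 := h1.comp (Primrec.fst (α := α × List ℕ) (β := List ℕ))
  have h3 := h2.comp (Primrec.fst (α := (α × List ℕ) × List ℕ) (β := List ℕ))
  refine PrimrecPred.ball (primrec_cw ht (Primrec.succ.comp hm)) (PrimrecPred.ball
    ((primrec_words hd hn).comp h1) (PrimrecPred.bex ((primrec_cw ht hm).comp h2) ?_))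
  exact primrecPred_agree (ht.comp h3) (hd.comp h3) (hk.comp h3)
    (Primrec.snd.comp (primrec_run (ht.comp h3)
      (Primrec.snd.comp (Primrec.fst.comp Primrec.fst)) (Primrec.snd.comp Primrec.fst)))
    (Primrec.list_cons.comp (Primrec.nat_mul.comp (Primrec.const 2)
      (Primrec.list_length.comp (ht.comp h3))) Primrec.snd)

theorem primrecPred_same (ht : Primrec t) (hd : Primrec d) (hk : Primrec k) (hm : Primrec m)
    (hu : Primrec u) (hv : Primrec v) :
    PrimrecPred fun a => Same (t a) (d a) (k a) (m a) (u a) (v a) := by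
  have h1 := Primrec.fst (α := α) (β := List ℕ)
  have h2 := h1.comp (Primrec.fst (α := α × List ℕ) (β := List ℕ))
  refine PrimrecPred.ball (primrec_cw ht hm) (PrimrecPred.and ?_
    (PrimrecPred.ball ((primrec_cw ht hm).comp h1) (PrimrecPred.iff ?_ ?_)))
  · exact primrecPred_agree (ht.comp h1) (hd.comp h1) (hk.comp h1)
      (Primrec.snd.comp (primrec_run (ht.comp h1) Primrec.snd (hu.comp h1)))
      (Primrec.snd.comp (primrec_run (ht.comp h1) Primrec.snd (hv.comp h1)))
  · exact PrimrecPred.eq_of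
      (Primrec.fst.comp (primrec_run (ht.comp h2) (Primrec.snd.comp Primrec.fst) (hu.comp h2)))
      (Primrec.fst.comp (primrec_run (ht.comp h2) Primrec.snd (hu.comp h2)))
  · exact PrimrecPred.eq_of
      (Primrec.fst.comp (primrec_run (ht.comp h2) (Primrec.snd.comp Primrec.fst) (hv.comp h2)))
      (Primrec.fst.comp (primrec_run (ht.comp h2) Primrec.snd (hv.comp h2)))

theorem primrecPred_valid (hd : Primrec d) (hw : Primrec w) :
    PrimrecPred fun a => Valid (d a) (w a) :=
  PrimrecPred.ball hw (Primrec.nat_lt.comp Primrec.snd (hd.comp Primrec.fst))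

theorem primrecPred_mem (hu : Primrec u) (hl : Primrec l) : PrimrecPred fun a => u a ∈ l a :=
  (PrimrecPred.bex (p := fun a b => b = u a) hl
    (PrimrecPred.eq_of Primrec.snd (hu.comp Primrec.fst))).of_eq fun a => by simp

theorem primrecPred_closed (ht : Primrec t) (hd : Primrec d) (hk : Primrec k) (hm : Primrec m)
    (hl : Primrec l) : PrimrecPred fun a => Closed (t a) (d a) (k a) (m a) (l a) := by
  have h1 := Primrec.fst (α := α) (β := List ℕ)
  have h2 := h1.comp (Primrec.fst (α := α × List ℕ) (β := ℕ))
  have h3 := h2.comp (Primrec.fst (α := (α × List ℕ) × ℕ) (β := List ℕ))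
  refine PrimrecPred.and (primrecPred_mem (Primrec.const []) hl) (PrimrecPred.ball hl
    (PrimrecPred.and (primrecPred_valid (hd.comp h1) Primrec.snd) (PrimrecPred.ball
      (Primrec.list_range.comp (hd.comp h1)) (PrimrecPred.bex (hl.comp h2) ?_))))
  exact primrecPred_same (ht.comp h3) (hd.comp h3) (hk.comp h3) (hm.comp h3)
    (Primrec.list_concat.comp (Primrec.snd.comp (Primrec.fst.comp Primrec.fst))
      (Primrec.snd.comp Primrec.fst)) Primrec.snd

theorem primrecPred_equ (ht : Primrec t) (hd : Primrec d) (hk : Primrec k) (hw : Primrec w)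
    (hi : Primrec i) (hj : Primrec j) :
    PrimrecPred fun a => Equ (t a) (d a) (k a) (w a) (i a) (j a) :=
  PrimrecPred.and
    (PrimrecPred.eq_of (Primrec.fst.comp (primrec_run ht hi hw))
      (Primrec.fst.comp (primrec_run ht hj hw)))
    (primrecPred_agree ht hd hk (Primrec.snd.comp (primrec_run ht hi hw))
      (Primrec.snd.comp (primrec_run ht hj hw)))

theorem primrec_cnt (ht : Primrec t) (hd : Primrec d) (hk : Primrec k) (hl : Primrec l)
    (hw : Primrec w) (hi : Primrec i) :
    Primrec fun a => cnt (t a) (d a) (k a) (l a) (w a) (i a) := by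
  have h1 := Primrec.fst (α := α) (β := List ℕ)
  exact Primrec.list_length.comp (Primrec.list_filter_comp hl (primrecPred_equ (ht.comp h1)
    (hd.comp h1) (hk.comp h1) (hw.comp h1) Primrec.snd (hi.comp h1)))

theorem primrecPred_van (ht : Primrec t) (hd : Primrec d) (hk : Primrec k) (hm : Primrec m)
    (hp : Primrec p) (hl : Primrec l) (hl' : Primrec l') (hw : Primrec w) :
    PrimrecPred fun a => Van (t a) (d a) (k a) (m a) (p a) (l a) (l' a) (w a) := by
  have h1 := Primrec.fst (α := α) (β := List ℕ)
  refine PrimrecPred.ball (primrec_cw ht hm) (PrimrecPred.eq_of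
    (Primrec.nat_mod.comp ?_ (hp.comp h1)) (Primrec.nat_mod.comp ?_ (hp.comp h1)))
  · exact primrec_cnt (ht.comp h1) (hd.comp h1) (hk.comp h1) (hl.comp h1) (hw.comp h1) Primrec.snd
  · exact primrec_cnt (ht.comp h1) (hd.comp h1) (hk.comp h1) (hl'.comp h1) (hw.comp h1) Primrec.snd

theorem primrecPred_nonCert (ht : Primrec t) (hd : Primrec d) (hk : Primrec k) (hm : Primrec m)
    (hl : Primrec l) (hp : Primrec p) {c : α → NCert} (hc : Primrec c) :
    PrimrecPred fun a => NonCert (t a) (d a) (k a) (m a) (l a) (p a) (c a) := by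
  have h1 := Primrec.fst (α := α) (β := List ℕ)
  have h2 := h1.comp (Primrec.fst (α := α × List ℕ) (β := List ℕ))
  have h2' := h1.comp (Primrec.fst (α := α × List ℕ) (β := ℕ))
  have h3 := h2'.comp (Primrec.fst (α := (α × List ℕ) × ℕ) (β := List ℕ))
  have c11 : Primrec fun a => (c a).1.1 := Primrec.fst.comp (Primrec.fst.comp hc)
  have c12 : Primrec fun a => (c a).1.2 := Primrec.snd.comp (Primrec.fst.comp hc)
  have c21 : Primrec fun a => (c a).2.1 := Primrec.fst.comp (Primrec.snd.comp hc)
  have c22 : Primrec fun a => (c a).2.2 := Primrec.snd.comp (Primrec.snd.comp hc)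
  refine PrimrecPred.and (PrimrecPred.ball (Primrec.list_append.comp c11 c12)
    (primrecPred_mem Primrec.snd ((primrec_cw ht hm).comp h1))) (PrimrecPred.and
    (PrimrecPred.ball hl (PrimrecPred.bex (c21.comp h1) (PrimrecPred.and
      (primrecPred_valid (hd.comp h2) Primrec.snd) ?_))) (PrimrecPred.and
    (PrimrecPred.bex c22 (PrimrecPred.eq_of Primrec.snd Primrec.snd))
    (PrimrecPred.ball c22 (PrimrecPred.and (primrecPred_valid (hd.comp h1) Primrec.snd)
      (PrimrecPred.and (PrimrecPred.not ?_) (PrimrecPred.bex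
        (Primrec.list_range.comp (hd.comp h1)) (PrimrecPred.bex (c22.comp h2') ?_)))))))
  · exact primrecPred_van (ht.comp h2) (hd.comp h2) (hk.comp h2) (hm.comp h2) (hp.comp h2)
      (c11.comp h2) (c12.comp h2)
      (Primrec.list_append.comp (Primrec.snd.comp Primrec.fst) Primrec.snd)
  · exact primrecPred_van (ht.comp h1) (hd.comp h1) (hk.comp h1) (hm.comp h1) (hp.comp h1)
      (c11.comp h1) (c12.comp h1) Primrec.snd
  · exact primrecPred_same (ht.comp h3) (hd.comp h3) (hk.comp h3) (hm.comp h3)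
      (Primrec.list_concat.comp (Primrec.snd.comp (Primrec.fst.comp Primrec.fst))
        (Primrec.snd.comp Primrec.fst)) Primrec.snd

theorem primrecPred_resolves (ht : Primrec t) (hd : Primrec d) (hk : Primrec k) (hm : Primrec m)
    (hv : Primrec v) : PrimrecPred fun a => Resolves (t a) (d a) (k a) (m a) (v a) := by
  have h1 := Primrec.fst (α := α) (β := List ℕ)
  have h2 := h1.comp (Primrec.fst (α := α × List ℕ) (β := List ℕ))
  have hi := primrec_run (ht.comp h2) (Primrec.snd.comp Primrec.fst) (hv.comp h2)
  have hj := primrec_run (ht.comp h2) (Primrec.snd (α := α × List ℕ) (β := List ℕ)) (hv.comp h2)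
  refine PrimrecPred.ball (primrec_cw ht hm) (PrimrecPred.ball ((primrec_cw ht hm).comp h1)
    (PrimrecPred.imp (PrimrecPred.eq_of (Primrec.fst.comp hi) (Primrec.fst.comp hj))
      (primrecPred_agree (ht.comp h2) (hd.comp h2) (hk.comp h2) (Primrec.snd.comp hi)
        (Primrec.snd.comp hj))))

theorem primrec_cntC (ht : Primrec t) (hd : Primrec d) (hk : Primrec k)
    {l : α → List (List ℕ × List ℕ)} (hl : Primrec l) (hj : Primrec j) :
    Primrec fun a => cntC (t a) (d a) (k a) (l a) (j a) := by
  have h1 := Primrec.fst (α := α) (β := List ℕ × List ℕ)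
  exact Primrec.list_length.comp (Primrec.list_filter_comp hl (primrecPred_equ (ht.comp h1)
    (hd.comp h1) (hk.comp h1) (Primrec.fst.comp Primrec.snd) (hj.comp h1)
    (Primrec.snd.comp Primrec.snd)))

theorem primrecPred_simpCert (ht : Primrec t) (hd : Primrec d) (hk : Primrec k) (hm : Primrec m)
    (hp : Primrec p) {s : α → SCert} (hs : Primrec s) :
    PrimrecPred fun a => SimpCert (t a) (d a) (k a) (m a) (p a) (s a) := by
  classical
  have h1 := Primrec.fst (α := α) (β := List ℕ)
  have h2 := h1.comp (Primrec.fst (α := α × List ℕ) (β := List ℕ))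
  have h3 := h2.comp (Primrec.fst (α := (α × List ℕ) × List ℕ) (β := Comb))
  have h4 := h3.comp (Primrec.fst (α := ((α × List ℕ) × List ℕ) × Comb) (β := List ℕ × List ℕ))
  have h4' := h3.comp (Primrec.fst (α := ((α × List ℕ) × List ℕ) × Comb) (β := List ℕ))
  have s1 : Primrec fun a => (s a).1 := Primrec.fst.comp hs
  have s2 : Primrec fun a => (s a).2.1 := Primrec.fst.comp (Primrec.snd.comp hs)
  have s3 : Primrec fun a => (s a).2.2 := Primrec.snd.comp (Primrec.snd.comp hs)
  have hc : Primrec fun q : (((α × List ℕ) × List ℕ) × Comb) × List ℕ => q.1.2 :=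
    Primrec.snd.comp Primrec.fst
  refine PrimrecPred.and (PrimrecPred.not (PrimrecPred.eq_of (Primrec.nat_mod.comp s1 hp)
    (Primrec.const 0))) (PrimrecPred.ball (primrec_words hd s2) (PrimrecPred.ball
    ((primrec_cw ht hm).comp h1) (PrimrecPred.bex (s3.comp h2) (PrimrecPred.and
    (PrimrecPred.ball (Primrec.list_append.comp (Primrec.fst.comp Primrec.snd)
      (Primrec.snd.comp Primrec.snd)) (PrimrecPred.and ?_ (PrimrecPred.and
        (primrecPred_valid (hd.comp h4) (Primrec.fst.comp Primrec.snd)) ?_)))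
    (PrimrecPred.ball ((primrec_cw ht hm).comp h3) (PrimrecPred.eq_of (Primrec.nat_mod.comp
      (Primrec.nat_add.comp (Primrec.ite ?_ (s1.comp h4') (Primrec.const 0)) ?_) (hp.comp h4'))
      (Primrec.nat_mod.comp ?_ (hp.comp h4'))))))))
  · exact primrecPred_mem (Primrec.snd.comp Primrec.snd) ((primrec_cw ht hm).comp h4)
  · exact primrecPred_resolves (ht.comp h4) (hd.comp h4) (hk.comp h4) (hm.comp h4)
      (Primrec.fst.comp Primrec.snd)
  · exact primrecPred_equ (ht.comp h4') (hd.comp h4') (hk.comp h4')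
      (Primrec.snd.comp (Primrec.fst.comp (Primrec.fst.comp Primrec.fst))) Primrec.snd
      (Primrec.snd.comp (Primrec.fst.comp Primrec.fst))
  · exact primrec_cntC (ht.comp h4') (hd.comp h4') (hk.comp h4') (Primrec.snd.comp hc) Primrec.snd
  · exact primrec_cntC (ht.comp h4') (hd.comp h4') (hk.comp h4') (Primrec.fst.comp hc) Primrec.snd

theorem primrecPred_isPrime (hp : Primrec p) : PrimrecPred fun a => IsPrime (p a) :=
  PrimrecPred.and (Primrec.nat_le.comp (Primrec.const 2) hp)
    (PrimrecPred.ball (Primrec.list_range.comp hp) (PrimrecPred.imp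
      (PrimrecPred.eq_of (Primrec.nat_mod.comp (hp.comp Primrec.fst) Primrec.snd)
        (Primrec.const 0)) (PrimrecPred.eq_of Primrec.snd (Primrec.const 1))))

theorem primrecPred_base (ht : Primrec t) (hd : Primrec d) {b : α → BCert} (hb : Primrec b) :
    PrimrecPred fun a => Base (t a) (d a) (b a) := by
  have hk : Primrec fun a => (b a).1.1 := Primrec.fst.comp (Primrec.fst.comp hb)
  have hm : Primrec fun a => (b a).1.2.1 :=
    Primrec.fst.comp (Primrec.snd.comp (Primrec.fst.comp hb))
  have hn : Primrec fun a => (b a).1.2.2 :=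
    Primrec.snd.comp (Primrec.snd.comp (Primrec.fst.comp hb))
  exact (primrecPred_good ht hd hk (Primrec.succ.comp hm)).and
    ((primrecPred_contr ht hd hk hm hn).and
      (primrecPred_closed ht hd hk hm (Primrec.snd.comp hb)))

end Primrec

theorem primrecPred_checkNone : PrimrecPred fun q : (ℕ × Tbl) × Cert => CheckNone q.1 q.2 := by
  have ht : Primrec fun q : (ℕ × Tbl) × Cert => q.1.2 := Primrec.snd.comp Primrec.fst
  have hd : Primrec fun q : (ℕ × Tbl) × Cert => q.1.1 := Primrec.fst.comp Primrec.fst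
  have hb : Primrec fun q : (ℕ × Tbl) × Cert => q.2.1 := Primrec.fst.comp Primrec.snd
  have hk : Primrec fun q : (ℕ × Tbl) × Cert => q.2.1.1.1 := Primrec.fst.comp (Primrec.fst.comp hb)
  have hm : Primrec fun q : (ℕ × Tbl) × Cert => q.2.1.1.2.1 :=
    Primrec.fst.comp (Primrec.snd.comp (Primrec.fst.comp hb))
  have h1 := Primrec.fst (α := (ℕ × Tbl) × Cert) (β := NCert)
  exact (primrecPred_base ht hd hb).and (PrimrecPred.bex
    (Primrec.fst.comp (Primrec.fst.comp (Primrec.snd.comp Primrec.snd)))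
    (primrecPred_nonCert (ht.comp h1) (hd.comp h1) (hk.comp h1) (hm.comp h1)
      ((Primrec.snd.comp hb).comp h1) (Primrec.const 0) Primrec.snd))

theorem primrecPred_checkSome : PrimrecPred fun q : (ℕ × Tbl) × Cert => CheckSome q.1 q.2 := by
  have ht : Primrec fun q : (ℕ × Tbl) × Cert => q.1.2 := Primrec.snd.comp Primrec.fst
  have hd : Primrec fun q : (ℕ × Tbl) × Cert => q.1.1 := Primrec.fst.comp Primrec.fst
  have hb : Primrec fun q : (ℕ × Tbl) × Cert => q.2.1 := Primrec.fst.comp Primrec.snd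
  have hk : Primrec fun q : (ℕ × Tbl) × Cert => q.2.1.1.1 := Primrec.fst.comp (Primrec.fst.comp hb)
  have hm : Primrec fun q : (ℕ × Tbl) × Cert => q.2.1.1.2.1 :=
    Primrec.fst.comp (Primrec.snd.comp (Primrec.fst.comp hb))
  have hmid : Primrec fun q : (ℕ × Tbl) × Cert => q.2.2.1 :=
    Primrec.fst.comp (Primrec.snd.comp Primrec.snd)
  have hP : Primrec fun q : (ℕ × Tbl) × Cert => q.2.2.2 :=
    Primrec.snd.comp (Primrec.snd.comp Primrec.snd)
  have hs : Primrec fun q : (ℕ × Tbl) × Cert => q.2.2.1.2.1 :=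
    Primrec.fst.comp (Primrec.snd.comp hmid)
  have h1 := Primrec.fst (α := (ℕ × Tbl) × Cert) (β := ℕ)
  have h2 := h1.comp (Primrec.fst (α := ((ℕ × Tbl) × Cert) × ℕ) (β := NCert))
  have h2' := h1.comp (Primrec.fst (α := ((ℕ × Tbl) × Cert) × ℕ) (β := SCert))
  refine (primrecPred_base ht hd hb).and (PrimrecPred.and (PrimrecPred.ball hP
    (PrimrecPred.and (primrecPred_isPrime Primrec.snd) (PrimrecPred.bex
      ((Primrec.fst.comp hmid).comp h1) ?_))) (PrimrecPred.and
    (primrecPred_simpCert ht hd hk hm (Primrec.const 0) hs) (PrimrecPred.ball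
    (Primrec.list_range.comp (Primrec.succ.comp (Primrec.fst.comp hs))) (PrimrecPred.imp
      (primrecPred_isPrime Primrec.snd) (PrimrecPred.or (PrimrecPred.bex (hP.comp h1)
        (PrimrecPred.eq_of (Primrec.snd.comp Primrec.fst) Primrec.snd)) (PrimrecPred.bex
        ((Primrec.snd.comp (Primrec.snd.comp hmid)).comp h1) ?_))))))
  · exact primrecPred_nonCert (ht.comp h2) (hd.comp h2) (hk.comp h2) (hm.comp h2)
      ((Primrec.snd.comp hb).comp h2) (Primrec.snd.comp Primrec.fst) Primrec.snd
  · exact primrecPred_simpCert (ht.comp h2') (hd.comp h2') (hk.comp h2') (hm.comp h2')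
      (Primrec.snd.comp Primrec.fst) Primrec.snd

/-! ### The search for a certificate -/

open scoped Classical in
/-- The outcome of the search when the certificate with code `n` is tried. -/
noncomputable def attempt (a : ℕ × Tbl) (n : ℕ) : Option (Option (List ℕ)) :=
  (Encodable.decode (α := Cert) n).bind fun c =>
    if CheckNone a c then some none else if CheckSome a c then some (some c.2.2) else none

/-- The algorithm: search for a certificate. -/
noncomputable def decideSimple (a : ℕ × Tbl) : Part (Option (List ℕ)) := Nat.rfindOpt (attempt a)

theorem partrec_decideSimple : Partrec decideSimple := by
  classical
  refine Partrec.rfindOpt (Primrec.to_comp ?_)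
  refine Primrec.option_bind (f := fun q : (ℕ × Tbl) × ℕ => Encodable.decode (α := Cert) q.2)
    (Primrec.decode.comp Primrec.snd) ?_
  have hac : Primrec fun q : ((ℕ × Tbl) × ℕ) × Cert => (q.1.1, q.2) :=
    Primrec.pair (Primrec.fst.comp Primrec.fst) Primrec.snd
  exact Primrec.ite (primrecPred_checkNone.comp hac) (Primrec.const _) (Primrec.ite
    (primrecPred_checkSome.comp hac) (Primrec.option_some.comp (Primrec.option_some.comp
      (Primrec.snd.comp (Primrec.snd.comp Primrec.snd)))) (Primrec.const _))

end Decide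

/-! ### Codes and the group elements they represent -/

theorem smul_eq_of_length_le {G X : Type*} [Group G] [MulAction G (List X)]
    [SelfSimilarGroup G X] {g h : G} {k : ℕ} (H : ∀ z : List X, z.length = k → g • z = h • z)
    {z : List X} (hz : z.length ≤ k) : g • z = h • z := by
  rcases isEmpty_or_nonempty X with hX | ⟨⟨x⟩⟩
  · cases z with
    | nil => rw [smul_nil, smul_nil]
    | cons x z => exact hX.elim x
  · have := H (z ++ List.replicate (k - z.length) x) (by simp; omega)
    rw [smul_append, smul_append] at this
    exact (List.append_inj' this (by simp [length_smul])).1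

namespace Decide

theorem mem_words {c n : ℕ} {w : List ℕ} : w ∈ words c n ↔ w.length = n ∧ Valid c w := by
  induction n generalizing w with
  | zero =>
    have h1 : words c 0 = [[]] := rfl
    rw [h1, List.mem_singleton, List.length_eq_zero_iff]
    exact ⟨fun h => ⟨h, by simp [h, Valid]⟩, fun h => h.1⟩
  | succ n ih =>
    have h1 : words c (n + 1) = (words c n).flatMap fun w => (List.range c).map fun x => x :: w :=
      rfl
    rw [h1]
    simp only [List.mem_flatMap, List.mem_map, List.mem_range, ih]
    constructor
    · rintro ⟨v, ⟨hv, hv'⟩, x, hx, rfl⟩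
      exact ⟨by simp [hv], by simpa [Valid] using ⟨hx, hv'⟩⟩
    · rintro ⟨hl, hv⟩
      cases w with
      | nil => simp at hl
      | cons x w =>
        have hv' : x < c ∧ Valid c w := by simpa [Valid] using hv
        exact ⟨w, ⟨by simpa using hl, hv'.2⟩, x, hv'.1, rfl⟩

theorem Valid.append {c : ℕ} {v w : List ℕ} (hv : Valid c v) (hw : Valid c w) :
    Valid c (v ++ w) := fun x hx => (List.mem_append.mp hx).elim (hv x) (hw x)

theorem run_append_singleton (t : Tbl) (u w : List ℕ) (x : ℕ) :
    run t u (w ++ [x]) =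
      ((stepW t (run t u w).2 x).1 :: (run t u w).1, (stepW t (run t u w).2 x).2) := by
  simp [run]

/-- The table `t` describes the action on words over `d` letters of a generating set of `G`,
with letters interpreted by `lX` and codes of states by `ev`. -/
structure Interp {G X : Type*} [Group G] [MulAction G (List X)] [SelfSimilarGroup G X]
    (t : Tbl) (d : ℕ) (lX : ℕ → X) (ev : ℕ → G) : Prop where
  inj : ∀ x < d, ∀ y < d, lX x = lX y → x = y
  surj : ∀ x, ∃ y < d, lX y = x
  step : ∀ c < 2 * t.length + 1, ∀ x < d, ((stepL t x c).1 < d ∧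
    (stepL t x c).2 < 2 * t.length + 1) ∧ lX (stepL t x c).1 = letter (ev c) (lX x) ∧
    ev (stepL t x c).2 = sect (ev c) (lX x)
  one : ev (2 * t.length) = 1
  gen : ∀ g, ∃ u, Valid (2 * t.length + 1) u ∧ (u.map ev).prod = g

/-- The value of a product of states. -/
def val {G : Type*} [Group G] (ev : ℕ → G) (u : List ℕ) : G := (u.map ev).prod

namespace Interp

variable {G X : Type*} [Group G] [MulAction G (List X)] [SelfSimilarGroup G X]
  {t : Tbl} {d : ℕ} {lX : ℕ → X} {ev : ℕ → G}

theorem map_inj (I : Interp t d lX ev) {v w : List ℕ} (hv : Valid d v) (hw : Valid d w)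
    (h : v.map lX = w.map lX) : v = w := by
  induction v generalizing w with
  | nil => simpa using h.symm
  | cons x v ih =>
    cases w with
    | nil => simp at h
    | cons y w =>
      simp only [List.map_cons, List.cons.injEq] at h
      have hv' : x < d ∧ Valid d v := by simpa [Valid] using hv
      have hw' : y < d ∧ Valid d w := by simpa [Valid] using hw
      rw [I.inj x hv'.1 y hw'.1 h.1, ih hv'.2 hw'.2 h.2]

theorem exists_map (I : Interp t d lX ev) (w : List X) : ∃ v, Valid d v ∧ v.map lX = w := by
  induction w with
  | nil => exact ⟨[], by simp [Valid], rfl⟩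
  | cons x w ih =>
    obtain ⟨v, hv, rfl⟩ := ih
    obtain ⟨y, hy, rfl⟩ := I.surj x
    exact ⟨y :: v, by simpa [Valid] using ⟨hy, hv⟩, rfl⟩

theorem stepW_spec (I : Interp t d lX ev)
    {u : List ℕ} (hu : Valid (2 * t.length + 1) u) {x : ℕ} (hx : x < d) :
    ((stepW t u x).1 < d ∧ (stepW t u x).2.length = u.length ∧
      Valid (2 * t.length + 1) (stepW t u x).2) ∧
    lX (stepW t u x).1 = letter (val ev u) (lX x) ∧
    val ev (stepW t u x).2 = sect (val ev u) (lX x) := by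
  induction u with
  | nil =>
    refine ⟨⟨hx, rfl, by simp [Valid, stepW]⟩, ?_, ?_⟩
    · have : (1 : G) • [lX x] = [lX x] := one_smul _ _
      rw [smul_singleton] at this
      simpa [stepW, val] using this.symm
    · exact (sectWord_one (G := G) [lX x]).symm
  | cons c u ih =>
    have hu' : c < 2 * t.length + 1 ∧ Valid (2 * t.length + 1) u := by simpa [Valid] using hu
    obtain ⟨⟨h1, h2, h3⟩, h4, h5⟩ := ih hu'.2
    obtain ⟨⟨h6, h7⟩, h8, h9⟩ := I.step c hu'.1 _ h1
    have e : stepW t (c :: u) x = ((stepL t (stepW t u x).1 c).1,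
      (stepL t (stepW t u x).1 c).2 :: (stepW t u x).2) := rfl
    have ev' : val ev (c :: u) = ev c * val ev u := by simp [val]
    rw [e, ev']
    refine ⟨⟨h6, by simp [h2], List.forall_mem_cons.mpr ⟨h7, h3⟩⟩, ?_, ?_⟩
    · rw [h8, h4, letter_mul]
    · rw [sect_mul, ← h4, ← h5, ← h9]
      simp [val]

theorem run_spec (I : Interp t d lX ev)
    {u w : List ℕ} (hu : Valid (2 * t.length + 1) u) (hw : Valid d w) :
    (Valid d (run t u w).1 ∧ (run t u w).2.length = u.length ∧
      Valid (2 * t.length + 1) (run t u w).2) ∧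
    (run t u w).1.reverse.map lX = val ev u • w.map lX ∧
    val ev (run t u w).2 = sectWord (val ev u) (w.map lX) := by
  induction w using List.reverseRecOn with
  | nil => exact ⟨⟨by simp [Valid, run], rfl, hu⟩, by simp [run, smul_nil], rfl⟩
  | append_singleton w x ih =>
    have hw' : Valid d w ∧ x < d := by
      refine ⟨fun y hy => hw y (by simp [hy]), hw x (by simp)⟩
    obtain ⟨⟨h1, h2, h3⟩, h4, h5⟩ := ih hw'.1
    obtain ⟨⟨h6, h7, h8⟩, h9, h10⟩ := I.stepW_spec h3 hw'.2
    rw [run_append_singleton]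
    refine ⟨⟨by simpa [Valid] using ⟨h6, h1⟩, by rw [h7, h2], h8⟩, ?_, ?_⟩
    · simp only [List.reverse_cons, List.map_append, List.map_cons, List.map_nil]
      rw [h4, h9, h5, smul_append, smul_singleton]
    · rw [h10, h5, List.map_append, sectWord_append]
      rfl

theorem img_eq_iff (I : Interp t d lX ev) {u v w : List ℕ} (hu : Valid (2 * t.length + 1) u)
    (hv : Valid (2 * t.length + 1) v) (hw : Valid d w) :
    (run t u w).1 = (run t v w).1 ↔ val ev u • w.map lX = val ev v • w.map lX := by
  obtain ⟨⟨h1, _⟩, h2, _⟩ := I.run_spec hu hw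
  obtain ⟨⟨h3, _⟩, h4, _⟩ := I.run_spec hv hw
  rw [← h2, ← h4]
  constructor
  · intro h; rw [h]
  · intro h
    have := I.map_inj (v := (run t u w).1.reverse) (w := (run t v w).1.reverse)
      (fun x hx => h1 x (List.mem_reverse.mp hx)) (fun x hx => h3 x (List.mem_reverse.mp hx)) h
    exact List.reverse_injective this

theorem agree_iff (I : Interp t d lX ev) {u v : List ℕ} (k : ℕ) (hu : Valid (2 * t.length + 1) u)
    (hv : Valid (2 * t.length + 1) v) :
    Agree t d k u v ↔ ∀ z : List X, z.length = k → val ev u • z = val ev v • z := by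
  constructor
  · intro h z hz
    obtain ⟨w, hw, rfl⟩ := I.exists_map z
    exact (I.img_eq_iff hu hv hw).mp (h w (mem_words.mpr ⟨by simpa using hz, hw⟩))
  · intro h w hw
    obtain ⟨hl, hw⟩ := mem_words.mp hw
    exact (I.img_eq_iff hu hv hw).mpr (h _ (by simpa using hl))

theorem mem_cw {n : ℕ} {u : List ℕ} :
    u ∈ cw t n ↔ u.length = n ∧ Valid (2 * t.length + 1) u := mem_words

theorem sect_mem_cw (I : Interp t d lX ev)
    {n : ℕ} {u w : List ℕ} (hu : u ∈ cw t n) (hw : Valid d w) :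
    (run t u w).2 ∈ cw t n := by
  obtain ⟨hl, hu⟩ := mem_cw.mp hu
  obtain ⟨⟨_, h1, h2⟩, _⟩ := I.run_spec hu hw
  exact mem_cw.mpr ⟨h1.trans hl, h2⟩

theorem val_pad (I : Interp t d lX ev) (u : List ℕ) : val ev (2 * t.length :: u) = val ev u := by
  simp [val, I.one]

theorem pad_mem {n : ℕ} {u : List ℕ} (hu : u ∈ cw t n) : 2 * t.length :: u ∈ cw t (n + 1) := by
  rw [mem_cw] at hu ⊢
  refine ⟨by simp [hu.1], ?_⟩
  intro x hx
  rcases List.mem_cons.mp hx with rfl | hx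
  · omega
  · exact hu.2 x hx

/-- As in minimization of automata: agreement at level k passes to level k + 1, so the sections at a
letter agree at level k; they are again products of n factors, and induction gives agreement at all
levels. Faithfulness concludes. -/
theorem val_eq_of_agree (I : Interp t d lX ev)
    {k n : ℕ} (hg : Good t d k n) {u v : List ℕ} (hu : u ∈ cw t n)
    (hv : v ∈ cw t n) (h : Agree t d k u v) : val ev u = val ev v := by
  have hu' := (mem_cw.mp hu).2
  have hv' := (mem_cw.mp hv).2
  rw [I.agree_iff k hu' hv'] at h
  have key : ∀ j : ℕ, ∀ u ∈ cw t n, ∀ v ∈ cw t n,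
      (∀ z : List X, z.length = k → val ev u • z = val ev v • z) →
      ∀ z : List X, z.length = k + j → val ev u • z = val ev v • z := by
    intro j
    induction j with
    | zero => intro u _ v _ h; exact h
    | succ j ih =>
      intro u hu v hv h z hz
      have hu' := (mem_cw.mp hu).2
      have hv' := (mem_cw.mp hv).2
      have h1 := (I.agree_iff (k + 1) hu' hv').mp (hg u hu v hv ((I.agree_iff k hu' hv').mpr h))
      cases z with
      | nil => rw [smul_nil, smul_nil]
      | cons y z =>
        obtain ⟨x, hx, rfl⟩ := I.surj y
        have hx' : Valid d [x] := by simpa [Valid] using hx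
        have h2 := ih _ (I.sect_mem_cw hu hx') _ (I.sect_mem_cw hv hx') (fun z hz => by
          have h3 := h1 ([lX x] ++ z) (by simp [hz])
          rw [smul_append, smul_append] at h3
          have h4 := List.append_inj' h3 (by simp [length_smul, hz])
          rw [(I.run_spec hu' hx').2.2, (I.run_spec hv' hx').2.2]
          exact h4.2) z (by simp at hz; omega)
        rw [(I.run_spec hu' hx').2.2, (I.run_spec hv' hx').2.2] at h2
        have h5 := smul_eq_of_length_le h1 (z := [lX x]) (by simp)
        rw [List.map_singleton] at h2
        rw [← List.singleton_append, smul_append, smul_append, h5, h2]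
  exact ext_smul X fun z => smul_eq_of_length_le (key z.length u hu v hv h) (by omega)

/-- Shorter products reach the length for which `Good` is known by padding with the code of the
identity. -/
theorem agree_iff_of_good (I : Interp t d lX ev)
    {k n : ℕ} (hg : Good t d k (n + 1)) {u v : List ℕ} (hu : u ∈ cw t n)
    (hv : v ∈ cw t n) : Agree t d k u v ↔ val ev u = val ev v := by
  have hu' := (mem_cw.mp hu).2
  have hv' := (mem_cw.mp hv).2
  rw [I.agree_iff k hu' hv']
  refine ⟨fun h => ?_, fun h z _ => by rw [h]⟩
  rw [← I.val_pad u, ← I.val_pad v]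
  refine I.val_eq_of_agree hg (pad_mem hu) (pad_mem hv) ?_
  rw [I.agree_iff k (mem_cw.mp (pad_mem hu)).2 (mem_cw.mp (pad_mem hv)).2, I.val_pad, I.val_pad]
  exact h

end Interp

end Decide

/-! ### States of words, and existence of the base data -/

/-- The family `g` has the same sections at `w` and `w'`, and the same coincidences between images
of `w` and of `w'`. -/
def SameState {G X ι : Type*} [Group G] [MulAction G (List X)] [SelfSimilarGroup G X] (g : ι → G)
    (w w' : List X) : Prop :=
  (∀ i, sectWord (g i) w = sectWord (g i) w') ∧ ∀ i j, (g i • w = g j • w ↔ g i • w' = g j • w')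

theorem SameState.append {G X ι : Type*} [Group G] [MulAction G (List X)] [SelfSimilarGroup G X]
    {g : ι → G} {w w' : List X} (h : SameState g w w') (z : List X) :
    SameState g (w ++ z) (w' ++ z) := by
  refine ⟨fun i => by rw [sectWord_append, sectWord_append, h.1], fun i j => ?_⟩
  simp only [smul_append, h.1]
  constructor
  · intro H
    have := List.append_inj' H (by simp [length_smul])
    rw [(h.2 i j).mp this.1, this.2]
  · intro H
    have := List.append_inj' H (by simp [length_smul])
    rw [(h.2 i j).mpr this.1, this.2]

theorem mapDomain_eq_zero_of_factors {α β M : Type*} [AddCommMonoid M] {h h' : α → β}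
    (H : ∀ i j, h i = h j → h' i = h' j) {f : α →₀ M} (hf : f.mapDomain h = 0) :
    f.mapDomain h' = 0 := by
  rcases isEmpty_or_nonempty α with hα | ⟨⟨a⟩⟩
  · rw [Subsingleton.elim f 0, Finsupp.mapDomain_zero]
  · have : Nonempty β := ⟨h a⟩
    obtain ⟨e, he⟩ := (Function.factorsThrough_iff (f := h) h').mp fun i j hij => H i j hij
    rw [he, Finsupp.mapDomain_comp, hf, Finsupp.mapDomain_zero]

theorem SameState.symm {G X ι : Type*} [Group G] [MulAction G (List X)] [SelfSimilarGroup G X]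
    {g : ι → G} {w w' : List X} (h : SameState g w w') : SameState g w' w :=
  ⟨fun i => (h.1 i).symm, fun i j => (h.2 i j).symm⟩

/-- Whether w annihilates a combination depends only on which pairs coincide at w, hence only on the
state of w. This makes singularity checkable on finitely many representatives. -/
theorem SameState.mapDomain {G X ι M : Type*} [Group G] [MulAction G (List X)]
    [SelfSimilarGroup G X] [AddCommMonoid M] {g : ι → G} {w w' : List X} (h : SameState g w w')
    {f : ι →₀ M} (hf : (emb g f).mapDomain (rt w) = 0) : (emb g f).mapDomain (rt w') = 0 := by
  rw [mapDomain_rt_emb] at hf ⊢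
  refine mapDomain_eq_zero_of_factors (fun i j hij => ?_) hf
  simp only [pt, Prod.mk.injEq] at hij ⊢
  exact ⟨(h.2 i j).mp hij.1, by rw [← h.1, ← h.1, hij.2]⟩

theorem Automaton.sectWord_mem {G X : Type*} [Group G] [MulAction G (List X)]
    [SelfSimilarGroup G X] (N : Automaton G X) {g : G} (hg : g ∈ N.states) (w : List X) :
    sectWord g w ∈ N.states := by
  induction w generalizing g with
  | nil => exact hg
  | cons x w ih => exact ih (N.sect_mem g hg x)

namespace Decide

variable {G X : Type*} [Group G] [MulAction G (List X)] [SelfSimilarGroup G X]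
  {t : Tbl} {d : ℕ} {lX : ℕ → X} {ev : ℕ → G}

/-- The family of all products of `m` states. -/
def fam (t : Tbl) (ev : ℕ → G) (m : ℕ) (u : {u // u ∈ cw t m}) : G := val ev u.1

instance (t : Tbl) (m : ℕ) : Finite {u // u ∈ cw t m} := (cw t m).finite_toSet

theorem val_append (u v : List ℕ) : val ev (u ++ v) = val ev u * val ev v := by simp [val]

namespace Interp

theorem val_replicate (I : Interp t d lX ev)
    (n : ℕ) : val ev (List.replicate n (2 * t.length)) = 1 := by
  simp [val, I.one]

theorem exists_mem_cw (I : Interp t d lX ev)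
    {u : List ℕ} (hu : Valid (2 * t.length + 1) u) {m : ℕ} (hm : u.length ≤ m) :
    ∃ v ∈ cw t m, val ev v = val ev u := by
  refine ⟨List.replicate (m - u.length) (2 * t.length) ++ u, mem_cw.mpr ⟨by simp; omega, ?_⟩, ?_⟩
  · refine Valid.append (fun x hx => ?_) hu
    rw [(List.mem_replicate.mp hx).2]; omega
  · rw [val_append, I.val_replicate, one_mul]

theorem exists_sectWord (I : Interp t d lX ev) {m : ℕ} {u : List ℕ} (hu : u ∈ cw t m) (w : List X) :
    ∃ v ∈ cw t m, val ev v = sectWord (val ev u) w := by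
  obtain ⟨w, hw, rfl⟩ := I.exists_map w
  exact ⟨_, I.sect_mem_cw hu hw, (I.run_spec (mem_cw.mp hu).2 hw).2.2⟩

/-- A product of m + r + 1 factors splits into a block of m + 1 factors and one of r factors. At
words of length n the first block loses a factor and the second keeps its length; induction on r
brings every product down to m factors. -/
theorem contractsTo_fam (I : Interp t d lX ev)
    {k m n : ℕ} (hg : Good t d k (m + 1)) (hc : Contr t d k m n) :
    ContractsTo X (fam t ev m) := by
  have step : ∀ u ∈ cw t (m + 1), ∀ w : List X, w.length = n →
      ∃ v ∈ cw t m, val ev v = sectWord (val ev u) w := by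
    intro u hu w hw
    obtain ⟨w, hwv, rfl⟩ := I.exists_map w
    obtain ⟨v, hv, hva⟩ := hc u hu w (mem_words.mpr ⟨by simpa using hw, hwv⟩)
    refine ⟨v, hv, ?_⟩
    have h1 := I.val_eq_of_agree hg (I.sect_mem_cw hu hwv) (pad_mem hv) hva
    rw [(I.run_spec (mem_cw.mp hu).2 hwv).2.2, I.val_pad] at h1
    exact h1.symm
  have key : ∀ r : ℕ, ∃ N, ∀ u ∈ cw t (m + r), ∀ w : List X, N ≤ w.length →
      ∃ v ∈ cw t m, val ev v = sectWord (val ev u) w := by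
    intro r
    induction r with
    | zero => exact ⟨0, fun u hu w _ => I.exists_sectWord hu w⟩
    | succ r ih =>
      obtain ⟨N, hN⟩ := ih
      refine ⟨n + N, fun u hu w hw => ?_⟩
      obtain ⟨hl, hv⟩ := mem_cw.mp hu
      have hsub : ∀ l : List ℕ, l.Sublist u → Valid (2 * t.length + 1) l :=
        fun l h x hx => hv x (h.subset hx)
      have h1 : u.take (m + 1) ∈ cw t (m + 1) :=
        mem_cw.mpr ⟨by simp; omega, hsub _ (List.take_sublist _ _)⟩
      have h2 : u.drop (m + 1) ∈ cw t r :=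
        mem_cw.mpr ⟨by simp; omega, hsub _ (List.drop_sublist _ _)⟩
      obtain ⟨v2, hv2, e2⟩ := I.exists_sectWord h2 (w.take n)
      obtain ⟨v1, hv1, e1⟩ := step _ h1 (val ev (u.drop (m + 1)) • w.take n)
        (by rw [length_smul]; simp; omega)
      have h3 : v1 ++ v2 ∈ cw t (m + r) := by
        rw [mem_cw] at hv1 hv2 ⊢
        exact ⟨by simp [hv1.1, hv2.1], hv1.2.append hv2.2⟩
      obtain ⟨v, hv, e⟩ := hN _ h3 (w.drop n) (by simp; omega)
      refine ⟨v, hv, ?_⟩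
      rw [e, val_append, e1, e2, ← sectWord_mul, ← val_append, List.take_append_drop,
        ← sectWord_append, List.take_append_drop]
  intro h
  obtain ⟨u, hu, rfl⟩ := I.gen h
  obtain ⟨v, hv, e⟩ := I.exists_mem_cw hu (m := m + u.length) (by omega)
  obtain ⟨N, hN⟩ := key u.length
  refine ⟨N, fun w hw => ?_⟩
  obtain ⟨v', hv', e'⟩ := hN v hv w hw
  exact ⟨⟨v', hv'⟩, by rw [e] at e'; exact e'⟩

theorem exists_good (I : Interp t d lX ev) (n : ℕ) : ∃ k, Good t d k n := by
  classical
  have h : ∀ q : List ℕ × List ℕ, ∃ k, ∀ k', k ≤ k' →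
      (∀ z : List X, z.length = k' → val ev q.1 • z = val ev q.2 • z) →
      val ev q.1 = val ev q.2 := by
    intro q
    by_cases hq : val ev q.1 = val ev q.2
    · exact ⟨0, fun _ _ _ => hq⟩
    · have : ∃ z : List X, val ev q.1 • z ≠ val ev q.2 • z := by
        by_contra hcon
        push Not at hcon
        exact hq (ext_smul X hcon)
      obtain ⟨z, hz⟩ := this
      exact ⟨z.length, fun k' hk H => absurd (smul_eq_of_length_le H hk) hz⟩
  choose K hK using h
  refine ⟨((cw t n).toFinset ×ˢ (cw t n).toFinset).sup K, fun u hu v hv huv => ?_⟩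
  have hu' := (mem_cw.mp hu).2
  have hv' := (mem_cw.mp hv).2
  rw [I.agree_iff _ hu' hv'] at huv ⊢
  have hle := Finset.le_sup (f := K)
    (Finset.mk_mem_product (List.mem_toFinset.mpr hu) (List.mem_toFinset.mpr hv))
  intro z _
  rw [hK (u, v) _ hle huv]

/-- Elements of the contracting automaton N are written as products, and m is the largest length
needed. It must not depend on k, because k is afterwards chosen for products of length m + 1. -/
theorem exists_contr (I : Interp t d lX ev) (hcon : IsContracting G X) :
    ∃ m, ∀ k, ∃ n, Contr t d k m n := by
  classical
  obtain ⟨N, hN⟩ := hcon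
  choose U hU hUv using I.gen
  choose n hn using hN
  refine ⟨N.states.sup fun g => (U g).length, fun k => ?_⟩
  set m := N.states.sup fun g => (U g).length
  refine ⟨(cw t (m + 1)).toFinset.sup fun u => n (val ev u), fun u hu w hw => ?_⟩
  obtain ⟨hl, hwv⟩ := mem_words.mp hw
  have hu' := (mem_cw.mp hu).2
  have hle := Finset.le_sup (f := fun u => n (val ev u)) (List.mem_toFinset.mpr hu)
  have hmem : sectWord (val ev u) (w.map lX) ∈ N.states := by
    rw [← List.take_append_drop (n (val ev u)) (w.map lX), sectWord_append]
    exact N.sectWord_mem (hn _ _ (by simp only [List.length_take, List.length_map]; omega)) _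
  obtain ⟨v, hv, e⟩ := I.exists_mem_cw (hU _)
    (Finset.le_sup (f := fun g => (U g).length) hmem)
  refine ⟨v, hv, ?_⟩
  have h1 := I.run_spec hu' hwv
  rw [I.agree_iff k h1.1.2.2 (mem_cw.mp (pad_mem hv)).2, h1.2.2, I.val_pad, e]
  intro z _
  rw [show val ev (U _) = _ from hUv _]

theorem same_iff (I : Interp t d lX ev)
    {k m : ℕ} (hg : Good t d k (m + 1)) {w w' : List ℕ} (hw : Valid d w)
    (hw' : Valid d w') :
    Same t d k m w w' ↔ SameState (fam t ev m) (w.map lX) (w'.map lX) := by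
  have h1 : ∀ i ∈ cw t m, (Agree t d k (run t i w).2 (run t i w').2 ↔
      sectWord (val ev i) (w.map lX) = sectWord (val ev i) (w'.map lX)) := by
    intro i hi
    rw [I.agree_iff_of_good hg (I.sect_mem_cw hi hw) (I.sect_mem_cw hi hw'),
      (I.run_spec (mem_cw.mp hi).2 hw).2.2, (I.run_spec (mem_cw.mp hi).2 hw').2.2]
  have h2 : ∀ i ∈ cw t m, ∀ j ∈ cw t m, (((run t i w).1 = (run t j w).1 ↔
      (run t i w').1 = (run t j w').1) ↔ (val ev i • w.map lX = val ev j • w.map lX ↔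
        val ev i • w'.map lX = val ev j • w'.map lX)) := by
    intro i hi j hj
    rw [I.img_eq_iff (mem_cw.mp hi).2 (mem_cw.mp hj).2 hw,
      I.img_eq_iff (mem_cw.mp hi).2 (mem_cw.mp hj).2 hw']
  constructor
  · intro h
    exact ⟨fun i => (h1 i.1 i.2).mp (h i.1 i.2).1,
      fun i j => (h2 i.1 i.2 j.1 j.2).mp ((h i.1 i.2).2 j.1 j.2)⟩
  · intro h i hi
    exact ⟨(h1 i hi).mpr (h.1 ⟨i, hi⟩),
      fun j hj => (h2 i hi j hj).mpr (h.2 ⟨i, hi⟩ ⟨j, hj⟩)⟩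

/-- Sections of the family stay in the family, so only finitely many combinations of sections and
coincidences occur; one word is kept for each. -/
theorem exists_closed (I : Interp t d lX ev)
    {k m : ℕ} (hg : Good t d k (m + 1)) : ∃ l, Closed t d k m l := by
  classical
  have hsec : ∀ (w : List X) (i : {u // u ∈ cw t m}),
      sectWord (fam t ev m i) w ∈ Set.range (fam t ev m) := by
    intro w i
    obtain ⟨v, hv, e⟩ := I.exists_sectWord i.2 w
    exact ⟨⟨v, hv⟩, e⟩
  let F := ({u // u ∈ cw t m} → Set.range (fam t ev m)) ×
    ({u // u ∈ cw t m} → {u // u ∈ cw t m} → Prop)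
  have : Fintype F := Fintype.ofFinite F
  let S : List X → F := fun w => (fun i => ⟨_, hsec w i⟩,
    fun i j => fam t ev m i • w = fam t ev m j • w)
  have hS : ∀ w w', S w = S w' → SameState (fam t ev m) w w' := by
    intro w w' h
    refine ⟨fun i => ?_, fun i j => ?_⟩
    · exact congrArg Subtype.val (congrFun (congrArg Prod.fst h) i)
    · exact iff_of_eq (congrFun (congrFun (congrArg Prod.snd h) i) j)
  have hrep : ∀ s : F, ∃ w : List ℕ, Valid d w ∧ ((∃ z, S z = s) → S (w.map lX) = s) := by
    intro s
    by_cases h : ∃ z, S z = s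
    · obtain ⟨z, hz⟩ := h
      obtain ⟨w, hw, rfl⟩ := I.exists_map z
      exact ⟨w, hw, fun _ => hz⟩
    -- A state that no word attains gets the empty word as a default representative.
    · exact ⟨[], by simp [Valid], fun h' => absurd h' h⟩
  choose rep hval hrep using hrep
  refine ⟨[] :: (Finset.univ.image rep).toList, by simp, fun w hw => ?_⟩
  have hwv : Valid d w := by
    rcases List.mem_cons.mp hw with rfl | hw
    · simp [Valid]
    · obtain ⟨s, _, rfl⟩ := Finset.mem_image.mp (Finset.mem_toList.mp hw)
      exact hval s
  refine ⟨hwv, fun x hx => ?_⟩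
  have hx' : Valid d [x] := by simpa [Valid] using hx
  refine ⟨rep (S ((w ++ [x]).map lX)), List.mem_cons_of_mem _ (Finset.mem_toList.mpr
    (Finset.mem_image_of_mem _ (Finset.mem_univ _))), ?_⟩
  rw [I.same_iff hg (hwv.append hx') (hval _)]
  exact hS _ _ (hrep _ ⟨_, rfl⟩).symm

theorem exists_base (I : Interp t d lX ev) (hcon : IsContracting G X) : ∃ b, Base t d b := by
  obtain ⟨m, hm⟩ := I.exists_contr hcon
  obtain ⟨k, hk⟩ := I.exists_good (m + 1)
  obtain ⟨n, hn⟩ := hm k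
  obtain ⟨l, hl⟩ := I.exists_closed hk
  exact ⟨((k, m, n), l), hk, hn, hl⟩

theorem exists_sameState (I : Interp t d lX ev)
    {k m : ℕ} (hg : Good t d k (m + 1)) {l : List (List ℕ)}
    (hl : Closed t d k m l) (w : List X) :
    ∃ w' ∈ l, SameState (fam t ev m) w (w'.map lX) := by
  obtain ⟨w, hw, rfl⟩ := I.exists_map w
  induction w using List.reverseRecOn with
  | nil => exact ⟨[], hl.1, fun _ => rfl, fun _ _ => Iff.rfl⟩
  | append_singleton w x ih =>
    have hw1 : Valid d w := fun y hy => hw y (by simp [hy])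
    have hx : x < d := hw x (by simp)
    obtain ⟨w1, hw1l, h1⟩ := ih hw1
    obtain ⟨hv1, h2⟩ := hl.2 w1 hw1l
    obtain ⟨w2, hw2l, h3⟩ := h2 x (List.mem_range.mpr hx)
    rw [I.same_iff hg (hv1.append (by simpa [Valid] using hx)) (hl.2 w2 hw2l).1] at h3
    refine ⟨w2, hw2l, ?_⟩
    rw [List.map_append] at h3 ⊢
    have h4 := h1.append (List.map lX [x])
    exact ⟨fun i => (h4.1 i).trans (h3.1 i), fun i j => (h4.2 i j).trans (h3.2 i j)⟩

end Interp

end Decide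

/-! ### Soundness and completeness of certificates -/

/-- The formal sum of the elements of a list. -/
noncomputable def comb {ι : Type*} (R : Type*) [CommRing R] (L : List ι) : ι →₀ R :=
  (L.map fun i => Finsupp.single i 1).sum

open scoped Classical in
theorem mapDomain_comb_apply {ι β R : Type*} [CommRing R] (h : ι → β) (L : List ι) (b : β) :
    (comb R L).mapDomain h b = ((L.filter fun i => decide (h i = b)).length : R) := by
  induction L with
  | nil => simp [comb]
  | cons i L ih =>
    have e : comb R (i :: L) = Finsupp.single i 1 + comb R L := by simp [comb]
    rw [e, Finsupp.mapDomain_add, Finsupp.mapDomain_single, Finsupp.add_apply, ih,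
      Finsupp.single_apply, List.filter_cons]
    by_cases hi : h i = b
    · simp [hi, add_comm]
    · simp [hi]

/-- Integer coefficients become multiplicities in two lists, the form in which certificates record
combinations. -/
theorem exists_list_sub_of_mem_closure {A : Type*} [AddCommGroup A] {S : Set A} {y : A}
    (hy : y ∈ AddSubgroup.closure S) :
    ∃ L L' : List A, (∀ a ∈ L ++ L', a ∈ S) ∧ y = L.sum - L'.sum := by
  induction hy using AddSubgroup.closure_induction with
  | mem x hx => exact ⟨[x], [], by simpa using hx, by simp⟩
  | zero => exact ⟨[], [], by simp, by simp⟩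
  | add x y _ _ hx hy =>
    obtain ⟨L, L', h, rfl⟩ := hx
    obtain ⟨N, N', h', rfl⟩ := hy
    refine ⟨L ++ N, L' ++ N', fun a ha => ?_, by simp; abel⟩
    simp only [List.mem_append] at ha h h'
    rcases ha with (ha | ha) | (ha | ha)
    exacts [h a (Or.inl ha), h' a (Or.inl ha), h a (Or.inr ha), h' a (Or.inr ha)]
  | neg x _ hx =>
    obtain ⟨L, L', h, rfl⟩ := hx
    exact ⟨L', L, fun a ha => h a (by simpa [or_comm] using ha), by simp⟩

theorem exists_list_map_eq {α β : Type*} {f : α → β} {P : α → Prop} (L : List β)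
    (h : ∀ b ∈ L, ∃ a, P a ∧ f a = b) : ∃ L' : List α, (∀ a ∈ L', P a) ∧ L'.map f = L := by
  induction L with
  | nil => exact ⟨[], by simp, rfl⟩
  | cons b L ih =>
    obtain ⟨a, ha, rfl⟩ := h b (by simp)
    obtain ⟨L', hL', rfl⟩ := ih fun b hb => h b (by simp [hb])
    exact ⟨a :: L', by simpa using ⟨ha, hL'⟩, rfl⟩

theorem exists_eq_comb_sub {ι : Type*} (p : ℕ) (f : ι →₀ ZMod p) :
    ∃ L L' : List ι, f = comb (ZMod p) L - comb (ZMod p) L' := by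
  have hf : f ∈ AddSubgroup.closure (Set.range fun i : ι => Finsupp.single i (1 : ZMod p)) := by
    induction f using Finsupp.induction_linear with
    | zero => exact zero_mem _
    | add f g hf hg => exact add_mem hf hg
    | single i c =>
      obtain ⟨n, rfl⟩ := ZMod.intCast_surjective c
      have : Finsupp.single i (n : ZMod p) = n • Finsupp.single i (1 : ZMod p) := by simp
      rw [this]
      exact AddSubgroup.zsmul_mem _ (AddSubgroup.subset_closure (Set.mem_range_self i)) n
  obtain ⟨L, L', h, rfl⟩ := exists_list_sub_of_mem_closure hf
  have h1 : ∀ N : List (ι →₀ ZMod p), (∀ a ∈ N, a ∈ Set.range fun i : ι =>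
      Finsupp.single i (1 : ZMod p)) → ∃ M : List ι, comb (ZMod p) M = N.sum := by
    intro N hN
    obtain ⟨M, _, rfl⟩ := exists_list_map_eq (P := fun _ : ι => True)
      (f := fun i => Finsupp.single i (1 : ZMod p)) N fun b hb =>
        (hN b hb).imp fun _ ha => And.intro trivial ha
    exact ⟨M, rfl⟩
  obtain ⟨M, hM⟩ := h1 L fun a ha => h a (by simp [ha])
  obtain ⟨M', hM'⟩ := h1 L' fun a ha => h a (by simp [ha])
  exact ⟨M, M', by rw [hM, hM']⟩

theorem exists_list_forall_exists {α β : Type*} (l : List α) {P : α → β → Prop}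
    (h : ∀ a ∈ l, ∃ b, P a b) : ∃ L : List β, ∀ a ∈ l, ∃ b ∈ L, P a b := by
  induction l with
  | nil => exact ⟨[], by simp⟩
  | cons a l ih =>
    obtain ⟨b, hb⟩ := h a (by simp)
    obtain ⟨L, hL⟩ := ih fun a ha => h a (by simp [ha])
    refine ⟨b :: L, fun c hc => ?_⟩
    rcases List.mem_cons.mp hc with rfl | hc
    · exact ⟨b, by simp, hb⟩
    · obtain ⟨b', hb', h'⟩ := hL c hc
      exact ⟨b', by simp [hb'], h'⟩

namespace Decide

variable {G X : Type*} [Group G] [MulAction G (List X)] [SelfSimilarGroup G X]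
  {t : Tbl} {d : ℕ} {lX : ℕ → X} {ev : ℕ → G}

namespace Interp

theorem equ_iff (I : Interp t d lX ev)
    {k m : ℕ} (hg : Good t d k (m + 1)) {w : List ℕ} (hw : Valid d w)
    {i j : List ℕ} (hi : i ∈ cw t m) (hj : j ∈ cw t m) :
    Equ t d k w i j ↔ pt (val ev i) (w.map lX) = pt (val ev j) (w.map lX) := by
  rw [Equ, I.img_eq_iff (mem_cw.mp hi).2 (mem_cw.mp hj).2 hw,
    I.agree_iff_of_good hg (I.sect_mem_cw hi hw) (I.sect_mem_cw hj hw),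
    (I.run_spec (mem_cw.mp hi).2 hw).2.2, (I.run_spec (mem_cw.mp hj).2 hw).2.2, pt, pt,
    Prod.mk.injEq]

theorem cnt_cast (I : Interp t d lX ev)
    {k m : ℕ} (hg : Good t d k (m + 1)) {w : List ℕ} (hw : Valid d w)
    (R : Type*) [CommRing R] (L : List {u // u ∈ cw t m}) {i : List ℕ} (hi : i ∈ cw t m) :
    (cnt t d k (L.map Subtype.val) w i : R) =
      (emb (fam t ev m) (comb R L)).mapDomain (rt (w.map lX)) (pt (val ev i) (w.map lX)) := by
  classical
  rw [mapDomain_rt_emb, mapDomain_comb_apply, cnt, List.filter_map, List.length_map]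
  congr 2
  refine List.filter_congr fun j _ => ?_
  simp only [Function.comp_apply, decide_eq_decide]
  exact I.equ_iff hg hw j.2 hi

theorem van_iff (I : Interp t d lX ev)
    {k m : ℕ} (hg : Good t d k (m + 1)) {w : List ℕ} (hw : Valid d w) (p : ℕ)
    (L L' : List {u // u ∈ cw t m}) :
    Van t d k m p (L.map Subtype.val) (L'.map Subtype.val) w ↔
      (emb (fam t ev m) (comb (ZMod p) L - comb (ZMod p) L')).mapDomain (rt (w.map lX)) = 0 := by
  have hsub : (emb (fam t ev m) (comb (ZMod p) L - comb (ZMod p) L')).mapDomain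
      (rt (w.map lX)) = (emb (fam t ev m) (comb (ZMod p) L)).mapDomain (rt (w.map lX)) -
        (emb (fam t ev m) (comb (ZMod p) L')).mapDomain (rt (w.map lX)) := by
    simp only [mapDomain_rt_emb]
    exact (Finsupp.lmapDomain (ZMod p) (ZMod p) _).map_sub _ _
  have key : ∀ i ∈ cw t m, (cnt t d k (L.map Subtype.val) w i % p =
      cnt t d k (L'.map Subtype.val) w i % p ↔
      (emb (fam t ev m) (comb (ZMod p) L - comb (ZMod p) L')).mapDomain (rt (w.map lX))
        (pt (val ev i) (w.map lX)) = 0) := by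
    intro i hi
    rw [hsub, Finsupp.sub_apply, ← I.cnt_cast hg hw _ L hi, ← I.cnt_cast hg hw _ L' hi, sub_eq_zero,
      ZMod.natCast_eq_natCast_iff']
  constructor
  · intro h
    have := Fintype.ofFinite {u // u ∈ cw t m}
    exact mapDomain_emb_eq_zero _ fun i => (key i.1 i.2).mp (h i.1 i.2)
  · intro h i hi
    rw [key i hi, h, Finsupp.zero_apply]

/-- Certificates of existence are sound. -/
theorem not_noSing_of_nonCert (I : Interp t d lX ev)
    {b : BCert} (hb : Base t d b) {p : ℕ} {c : NCert}
    (hc : NonCert t d b.1.1 b.1.2.1 b.2 p c) : ¬ NoSing G X (ZMod p) := by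
  obtain ⟨hg, -, hl⟩ := hb
  obtain ⟨h1, h2, ⟨w0, hw0, -⟩, h4⟩ := hc
  obtain ⟨⟨l, l'⟩, V, U⟩ := c
  generalize b.1.1 = k, b.1.2.1 = m, b.2 = W at *
  obtain ⟨L, hL⟩ : ∃ L : List {u // u ∈ cw t m}, L.map Subtype.val = l := by
    obtain ⟨L, -, hL⟩ := exists_list_map_eq (P := fun _ : {u // u ∈ cw t m} => True)
      (f := Subtype.val) l fun u hu => ⟨⟨u, h1 u (by simp [hu])⟩, trivial, rfl⟩
    exact ⟨L, hL⟩
  obtain ⟨L', hL'⟩ : ∃ L : List {u // u ∈ cw t m}, L.map Subtype.val = l' := by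
    obtain ⟨L, -, hL⟩ := exists_list_map_eq (P := fun _ : {u // u ∈ cw t m} => True)
      (f := Subtype.val) l' fun u hu => ⟨⟨u, h1 u (by simp [hu])⟩, trivial, rfl⟩
    exact ⟨L, hL⟩
  subst hL hL'
  intro hns
  -- The combination is singular: the annihilating extension of the representative of v also works
  -- for v.
  obtain ⟨n, hn⟩ := hns (emb (fam t ev m) (comb (ZMod p) L - comb (ZMod p) L')) fun v => by
    obtain ⟨v', hv', hs⟩ := I.exists_sameState hg hl v
    obtain ⟨w, -, hw, hvan⟩ := h2 v' hv'
    rw [I.van_iff hg ((hl.2 v' hv').1.append hw), List.map_append] at hvan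
    exact ⟨w.map lX, (hs.symm.append _).mapDomain hvan⟩
  -- Following the recorded letters from representative to representative produces non-annihilating
  -- extensions of every length, so the combination is not eventually zero.
  have h5 : ∀ n : ℕ, ∀ w ∈ U, ∃ z : List X, z.length = n ∧
      (emb (fam t ev m) (comb (ZMod p) L - comb (ZMod p) L')).mapDomain
        (rt (w.map lX ++ z)) ≠ 0 := by
    intro n
    induction n with
    | zero =>
      intro w hw
      obtain ⟨hv, hvan, -⟩ := h4 w hw
      rw [I.van_iff hg hv] at hvan
      exact ⟨[], rfl, by simpa using hvan⟩
    | succ n ih =>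
      intro w hw
      obtain ⟨hv, -, x, hx, w', hw', hs⟩ := h4 w hw
      have hx' : Valid d [x] := by simpa [Valid] using hx
      rw [I.same_iff hg (hv.append hx') (h4 w' hw').1] at hs
      obtain ⟨z, hz, hne⟩ := ih w' hw'
      refine ⟨lX x :: z, by simp [hz], fun h0 => hne ?_⟩
      refine (hs.append z).mapDomain ?_
      simpa using h0
  obtain ⟨z, hz, hne⟩ := h5 n w0 hw0
  exact hne (mapDomain_rt_eq_zero_of_le hn _ (by simp [hz]))

/-- Certificates of existence are complete. -/
theorem exists_nonCert (I : Interp t d lX ev) {b : BCert} (hb : Base t d b) {p : ℕ}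
    (h : ¬ NoSing G X (ZMod p)) : ∃ c, NonCert t d b.1.1 b.1.2.1 b.2 p c := by
  classical
  obtain ⟨hg, hc, hl⟩ := hb
  generalize b.1.1 = k, b.1.2.1 = m, b.2 = W at *
  have hX : Finite X := by
    refine Finite.of_surjective (fun y : Fin d => lX y) fun x => ?_
    obtain ⟨y, hy, rfl⟩ := I.surj x
    exact ⟨⟨y, hy⟩, rfl⟩
  have := Fintype.ofFinite X
  obtain ⟨f, hf, hz⟩ : ∃ f : {u // u ∈ cw t m} →₀ ZMod p,
      Sing (X := X) (emb (fam t ev m) f) ∧ ¬ EvZero (X := X) (emb (fam t ev m) f) := by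
    by_contra hcon
    push Not at hcon
    exact h (noSing_of_family _ (I.contractsTo_fam hg hc) hcon)
  obtain ⟨L, L', rfl⟩ := exists_eq_comb_sub p f
  set f := comb (ZMod p) L - comb (ZMod p) L' with hfdef
  obtain ⟨V, hV⟩ := exists_list_forall_exists W
    (P := fun v w => Valid d w ∧ Van t d k m p (L.map Subtype.val) (L'.map Subtype.val) (v ++ w))
    fun v hv => by
      obtain ⟨w, hw⟩ := hf (v.map lX)
      obtain ⟨w, hwv, rfl⟩ := I.exists_map w
      refine ⟨w, hwv, ?_⟩
      rw [I.van_iff hg ((hl.2 v hv).1.append hwv), List.map_append]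
      exact hw
  -- A word is bad if it has non-annihilating extensions by every length. By finiteness of the
  -- alphabet some letter always keeps it bad, and badness depends only on the state, so the bad
  -- representatives form the persistent set.
  let bad : List X → Prop := fun w =>
    ∀ n, ∃ z : List X, z.length = n ∧ (emb (fam t ev m) f).mapDomain (rt (w ++ z)) ≠ 0
  have hbad : ∀ w, bad w → ∃ x, bad (w ++ [x]) := by
    intro w hw
    by_contra hcon
    simp only [bad] at hcon
    push Not at hcon
    choose N hN using hcon
    obtain ⟨z, hz, hne⟩ := hw (Finset.univ.sup N + 1)
    cases z with
    | nil => simp at hz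
    | cons x z =>
      apply hne
      have h1 := mapDomain_rt_eq_zero_of_le (φ := (emb (fam t ev m) f).mapDomain (rt (w ++ [x])))
        (n := N x) (fun z hz => by rw [← mapDomain_rt_append]; exact hN x z hz) z (by
          have := Finset.le_sup (f := N) (Finset.mem_univ x)
          simp at hz; omega)
      rw [← mapDomain_rt_append] at h1
      simpa using h1
  have hsame : ∀ w w', SameState (fam t ev m) w w' → bad w → bad w' := by
    intro w w' hs hw n
    obtain ⟨z, hz, hne⟩ := hw n
    exact ⟨z, hz, fun h0 => hne ((hs.symm.append z).mapDomain h0)⟩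
  refine ⟨((L.map Subtype.val, L'.map Subtype.val), (V, W.filter fun w => bad (w.map lX))),
    ?_, hV, ⟨[], ?_, rfl⟩, ?_⟩
  · intro u hu
    simp only [List.mem_append, List.mem_map] at hu
    rcases hu with ⟨a, _, rfl⟩ | ⟨a, _, rfl⟩ <;> exact a.2
  · refine List.mem_filter.mpr ⟨hl.1, decide_eq_true ?_⟩
    intro n
    by_contra hcon
    push Not at hcon
    exact hz ⟨n, fun w hw => by simpa using hcon w hw⟩
  · intro w hw
    obtain ⟨hwW, hwb⟩ := List.mem_filter.mp hw
    have hwb := of_decide_eq_true hwb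
    obtain ⟨hv, hcl⟩ := hl.2 w hwW
    refine ⟨hv, ?_, ?_⟩
    · rw [I.van_iff hg hv]
      obtain ⟨z, hz, hne⟩ := hwb 0
      rw [List.length_eq_zero_iff] at hz
      subst hz
      simpa using hne
    · obtain ⟨x, hx⟩ := hbad _ hwb
      obtain ⟨x, hxd, rfl⟩ := I.surj x
      obtain ⟨w', hw', hs⟩ := hcl x (List.mem_range.mpr hxd)
      refine ⟨x, List.mem_range.mpr hxd, w', List.mem_filter.mpr ⟨hw', decide_eq_true ?_⟩, hs⟩
      rw [I.same_iff hg (hv.append (by simpa [Valid] using hxd)) (hl.2 w' hw').1] at hs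
      refine hsame _ _ hs ?_
      simpa using hx

theorem resolves_iff (I : Interp t d lX ev)
    {k m : ℕ} (hg : Good t d k (m + 1)) {v : List ℕ} (hv : Valid d v) :
    Resolves t d k m v ↔ Resolving (fam t ev m) (v.map lX) := by
  have h : ∀ i ∈ cw t m, ∀ j ∈ cw t m,
      ((run t i v).1 = (run t j v).1 → Agree t d k (run t i v).2 (run t j v).2) ↔
      (val ev i • v.map lX = val ev j • v.map lX →
        pt (val ev i) (v.map lX) = pt (val ev j) (v.map lX)) := by
    intro i hi j hj
    rw [← I.equ_iff hg hv hi hj, ← I.img_eq_iff (mem_cw.mp hi).2 (mem_cw.mp hj).2 hv, Equ]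
    exact ⟨fun h h' => ⟨h', h h'⟩, fun h h' => (h h').2⟩
  exact ⟨fun H i j => (h i.1 i.2 j.1 j.2).mp (H i.1 i.2 j.1 j.2),
    fun H i hi j hj => (h i hi j hj).mpr (H ⟨i, hi⟩ ⟨j, hj⟩)⟩

theorem cntC_eq (I : Interp t d lX ev)
    {k m : ℕ} (hg : Good t d k (m + 1)) (L : List (List ℕ × {u // u ∈ cw t m}))
    (hL : ∀ q ∈ L, Valid d q.1) (j : {u // u ∈ cw t m}) :
    (cntC t d k (L.map fun q => (q.1, q.2.1)) j.1 : ℤ) =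
      (L.map fun q => row (fam t ev m) (q.1.map lX) q.2).sum j := by
  classical
  induction L with
  | nil => simp [cntC]
  | cons q L ih =>
    have ih := ih fun q hq => hL q (by simp [hq])
    have h1 : Equ t d k q.1 j.1 q.2.1 ↔ pt (fam t ev m j) (q.1.map lX) =
        pt (fam t ev m q.2) (q.1.map lX) := I.equ_iff hg (hL q (by simp)) j.2 q.2.2
    rw [List.map_cons, List.map_cons, List.sum_cons, Pi.add_apply, ← ih, cntC, List.filter_cons, row]
    by_cases h : pt (fam t ev m j) (q.1.map lX) = pt (fam t ev m q.2) (q.1.map lX)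
    · rw [if_pos (decide_eq_true (h1.mpr h)), if_pos h, List.length_cons, cntC]
      push_cast
      ring
    · rw [if_neg (by simpa using mt h1.mp h), if_neg h, cntC, zero_add]

theorem row_eq (I : Interp t d lX ev)
    {k m : ℕ} (hg : Good t d k (m + 1)) {w : List ℕ} (hw : Valid d w) (D : ℕ)
    (i j : {u // u ∈ cw t m}) [Decidable (Equ t d k w j.1 i.1)] :
    ((if Equ t d k w j.1 i.1 then D else 0 : ℕ) : ℤ) =
      D * row (fam t ev m) (w.map lX) i j := by
  classical
  have h1 : Equ t d k w j.1 i.1 ↔ pt (fam t ev m j) (w.map lX) = pt (fam t ev m i) (w.map lX) :=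
    I.equ_iff hg hw j.2 i.2
  rw [row]
  by_cases h : pt (fam t ev m j) (w.map lX) = pt (fam t ev m i) (w.map lX)
  · rw [if_pos (h1.mpr h), if_pos h, mul_one]
  · rw [if_neg (mt h1.mp h), if_neg h, mul_zero, Nat.cast_zero]

/-- Certificates of vanishing are sound. -/
theorem noSing_of_simpCert (I : Interp t d lX ev)
    {b : BCert} (hb : Base t d b) {p q : ℕ} (hq : q.Prime ∨ q = 0)
    (hqp : q ∣ p) {s : SCert} (hs : SimpCert t d b.1.1 b.1.2.1 p s) (hD : ¬ q ∣ s.1) :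
    NoSing G X (ZMod q) := by
  classical
  obtain ⟨hg, hc, -⟩ := hb
  generalize b.1.1 = k, b.1.2.1 = m at *
  have hX : Finite X := by
    refine Finite.of_surjective (fun y : Fin d => lX y) fun x => ?_
    obtain ⟨y, hy, rfl⟩ := I.surj x
    exact ⟨⟨y, hy⟩, rfl⟩
  have := Fintype.ofFinite {u // u ∈ cw t m}
  refine noSing_of_forall_row_mem (fam t ev m) (I.contractsTo_fam hg hc) hq (n := s.2.1) ?_
  intro w hw i
  obtain ⟨w, hwv, rfl⟩ := I.exists_map w
  obtain ⟨c, -, h1, h2⟩ := hs.2 w (mem_words.mpr ⟨by simpa using hw, hwv⟩) i.1 i.2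
  have hlist : ∀ l : List (List ℕ × List ℕ), (∀ q ∈ l, q ∈ c.1 ++ c.2) →
      ∃ L : List (List ℕ × {u // u ∈ cw t m}), (∀ q ∈ L, Valid d q.1) ∧
        L.map (fun q => (q.1, q.2.1)) = l ∧
        (L.map fun q => row (fam t ev m) (q.1.map lX) q.2).sum ∈
          AddSubgroup.closure (resRows X (fam t ev m)) := by
    intro l hl
    obtain ⟨L, hL, rfl⟩ := exists_list_map_eq
      (P := fun q : List ℕ × {u // u ∈ cw t m} => Valid d q.1 ∧ Resolves t d k m q.1)
      (f := fun q => (q.1, q.2.1)) l fun q hq => by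
        obtain ⟨h3, h4, h5⟩ := h1 q (hl q hq)
        exact ⟨(q.1, ⟨q.2, h3⟩), ⟨h4, h5⟩, rfl⟩
    refine ⟨L, fun q hq => (hL q hq).1, rfl, AddSubgroup.list_sum_mem _ fun x hx => ?_⟩
    obtain ⟨q, hq, rfl⟩ := List.mem_map.mp hx
    exact AddSubgroup.subset_closure ⟨_, _, (I.resolves_iff hg (hL q hq).1).mp (hL q hq).2, rfl⟩
  obtain ⟨L, hLv, hL, hLm⟩ := hlist c.1 fun q hq => by simp [hq]
  obtain ⟨L', hLv', hL', hLm'⟩ := hlist c.2 fun q hq => by simp [hq]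
  refine ⟨s.1, hD, _, sub_mem hLm hLm', fun j => ?_⟩
  have h3 : ((if Equ t d k w j.1 i.1 then s.1 else 0) + cntC t d k c.2 j.1) ≡
      cntC t d k c.1 j.1 [MOD p] := h2 j.1 j.2
  -- Relations modulo p descend to every divisor q. With p = 0 a single integral certificate thus
  -- serves all primes that do not divide its denominator.
  have h4 := (Nat.modEq_iff_dvd.mp (h3.of_dvd hqp).symm)
  rw [Nat.cast_add, I.row_eq hg hwv, ← hL, ← hL', I.cntC_eq hg L hLv, I.cntC_eq hg L' hLv'] at h4
  rw [Pi.sub_apply]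
  convert h4 using 1
  ring

/-- Certificates of vanishing are complete. -/
theorem exists_simpCert (I : Interp t d lX ev) [Nontrivial X] {b : BCert} (hb : Base t d b) {p : ℕ}
    (hp : p.Prime ∨ p = 0) (h : NoSing G X (ZMod p)) :
    ∃ s, SimpCert t d b.1.1 b.1.2.1 p s := by
  classical
  obtain ⟨hg, hc, -⟩ := hb
  generalize b.1.1 = k, b.1.2.1 = m at *
  have := Fintype.ofFinite {u // u ∈ cw t m}
  obtain ⟨n, hn⟩ := exists_forall_row_mem (fam t ev m) hp h
  -- One denominator is taken for all words of length n and all members of the family, as the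
  -- certificate has room for only one.
  obtain ⟨D, hD, hDy⟩ := exists_uniform_satSpan hp
    (((words d n).toFinset ×ˢ Finset.univ).image
      fun q : List ℕ × {u // u ∈ cw t m} => row (fam t ev m) (q.1.map lX) q.2) fun x hx => by
      obtain ⟨⟨w, i⟩, hq, rfl⟩ := Finset.mem_image.mp hx
      have hw := (mem_words.mp (List.mem_toFinset.mp (Finset.mem_product.mp hq).1)).1
      exact hn _ (by simpa using hw) i
  have main : ∀ w ∈ words d n, ∀ i ∈ cw t m, ∃ c : Comb,
      (∀ q ∈ c.1 ++ c.2, q.2 ∈ cw t m ∧ Valid d q.1 ∧ Resolves t d k m q.1) ∧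
      ∀ j ∈ cw t m, ((if Equ t d k w j i then D else 0) + cntC t d k c.2 j) % p =
        cntC t d k c.1 j % p := by
    intro w hw i hi
    obtain ⟨hl, hwv⟩ := mem_words.mp hw
    obtain ⟨y, hy, hk⟩ := hDy (row (fam t ev m) (w.map lX) ⟨i, hi⟩) (Finset.mem_image.mpr
      ⟨(w, ⟨i, hi⟩), Finset.mk_mem_product (List.mem_toFinset.mpr hw) (Finset.mem_univ _), rfl⟩)
    obtain ⟨L, L', hLL, rfl⟩ := exists_list_sub_of_mem_closure hy
    have hlist : ∀ l : List ({u // u ∈ cw t m} → ℤ), (∀ a ∈ l, a ∈ resRows X (fam t ev m)) →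
        ∃ N : List (List ℕ × {u // u ∈ cw t m}),
          (∀ q ∈ N, Valid d q.1 ∧ Resolves t d k m q.1) ∧
          (N.map fun q => row (fam t ev m) (q.1.map lX) q.2) = l := by
      intro l hl
      refine exists_list_map_eq l fun r hr => ?_
      obtain ⟨v, i, hv, rfl⟩ := hl r hr
      obtain ⟨v, hvv, rfl⟩ := I.exists_map v
      exact ⟨(v, i), ⟨hvv, (I.resolves_iff hg hvv).mpr hv⟩, rfl⟩
    obtain ⟨N, hN, rfl⟩ := hlist L fun a ha => hLL a (by simp [ha])
    obtain ⟨N', hN', rfl⟩ := hlist L' fun a ha => hLL a (by simp [ha])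
    refine ⟨(N.map fun q => (q.1, q.2.1), N'.map fun q => (q.1, q.2.1)), ?_, ?_⟩
    · intro q hq
      simp only [List.mem_append, List.mem_map] at hq
      rcases hq with ⟨a, ha, rfl⟩ | ⟨a, ha, rfl⟩
      · exact ⟨a.2.2, hN a ha⟩
      · exact ⟨a.2.2, hN' a ha⟩
    · intro j hj
      have h4 := hk ⟨j, hj⟩
      refine Nat.ModEq.symm (Nat.modEq_iff_dvd.mpr ?_)
      rw [Nat.cast_add, I.row_eq hg hwv D ⟨i, hi⟩ ⟨j, hj⟩,
        I.cntC_eq hg N (fun q hq => (hN q hq).1) ⟨j, hj⟩,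
        I.cntC_eq hg N' (fun q hq => (hN' q hq).1) ⟨j, hj⟩]
      rw [Pi.sub_apply] at h4
      convert h4 using 1
      ring
  obtain ⟨C, hC⟩ := exists_list_forall_exists (words d n ×ˢ cw t m)
    (P := fun (q : List ℕ × List ℕ) (c : Comb) =>
      (∀ q ∈ c.1 ++ c.2, q.2 ∈ cw t m ∧ Valid d q.1 ∧ Resolves t d k m q.1) ∧
      ∀ j ∈ cw t m, ((if Equ t d k q.1 j q.2 then D else 0) + cntC t d k c.2 j) % p =
        cntC t d k c.1 j % p) fun q hq => by
      obtain ⟨h1, h2⟩ := List.pair_mem_product.mp (show (q.1, q.2) ∈ _ from hq)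
      exact main q.1 h1 q.2 h2
  refine ⟨(D, n, C), fun h0 => hD (Nat.dvd_of_mod_eq_zero h0), fun w hw i hi => ?_⟩
  obtain ⟨c, hc, h1, h2⟩ := hC (w, i) (List.pair_mem_product.mpr ⟨hw, hi⟩)
  refine ⟨c, hc, h1, fun j hj => ?_⟩
  convert h2 j hj

end Interp

end Decide

/-! ### Reading the state diagram, and correctness of the search -/

namespace Decide

section Diagram

variable {G X : Type*} [Group G] [MulAction G (List X)] [SelfSimilarGroup G X]

/-- The letter with a given number. -/
def letterOf {d : ℕ} (hd : 0 < d) (eX : Fin d ≃ X) (x : ℕ) : X :=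
  if h : x < d then eX ⟨x, h⟩ else eX ⟨0, hd⟩

/-- The group element with a given code. -/
def stateOf (A : Automaton G X) {n : ℕ} (eA : Fin n ≃ A.states) (c : ℕ) : G :=
  if h : c / 2 < n then if c % 2 = 0 then (eA ⟨c / 2, h⟩ : G) else (eA ⟨c / 2, h⟩ : G)⁻¹ else 1

theorem interp_stateDiagram (A : Automaton G X) (hA : A.Generates) {d n : ℕ} (hd : 0 < d)
    (eX : Fin d ≃ X) (eA : Fin n ≃ A.states) :
    Interp (A.stateDiagram eX eA).2 d (letterOf hd eX) (stateOf A eA) := by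
  have hlen : (A.stateDiagram eX eA).2.length = n := by simp [Automaton.stateDiagram]
  have hrow : ∀ (i : Fin n) (x : Fin d),
      (((A.stateDiagram eX eA).2.getD i []).getD x (0, 0)) =
        (((eX.symm (letter (eA i : G) (eX x)) : Fin d) : ℕ),
        ((eA.symm ⟨sect (eA i : G) (eX x), A.sect_mem _ (eA i).2 _⟩ : Fin n) : ℕ)) := by
    intro i x
    simp [Automaton.stateDiagram, List.getD_eq_getElem?_getD]
  have hlX : ∀ x : Fin d, letterOf hd eX x = eX x := fun x => by simp [letterOf]
  have hev0 : ∀ i : Fin n, stateOf A eA (2 * i) = eA i := fun i => by simp [stateOf]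
  have hev1 : ∀ i : Fin n, stateOf A eA (2 * i + 1) = (eA i : G)⁻¹ := fun i => by
    have h1 : (2 * (i : ℕ) + 1) / 2 = i := by omega
    have h2 : (2 * (i : ℕ) + 1) % 2 = 1 := by omega
    simp [stateOf, h1, h2]
  refine ⟨?_, ?_, ?_, ?_, ?_⟩
  · intro x hx y hy h
    have := eX.injective ((hlX ⟨x, hx⟩).symm.trans (h.trans (hlX ⟨y, hy⟩)))
    simpa using this
  · intro x
    exact ⟨eX.symm x, (eX.symm x).2, by rw [hlX, Equiv.apply_symm_apply]⟩
  · intro c hc x hx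
    rw [hlen] at hc ⊢
    unfold stepL
    rw [hlen]
    split_ifs with h1 h2
    · obtain ⟨i, rfl⟩ : ∃ i : Fin n, c = 2 * i := ⟨⟨c / 2, by omega⟩, by simp; omega⟩
      have h3 : (2 * (i : ℕ)) / 2 = i := by omega
      rw [h3, hrow i ⟨x, hx⟩, hev0, show letterOf hd eX x = eX ⟨x, hx⟩ from hlX ⟨x, hx⟩, hlX, hev0]
      refine ⟨⟨Fin.is_lt _, ?_⟩, by simp, by simp⟩
      have := (eA.symm ⟨sect (eA i : G) (eX ⟨x, hx⟩), A.sect_mem _ (eA i).2 _⟩).is_lt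
      dsimp only
      omega
    · obtain ⟨i, rfl⟩ : ∃ i : Fin n, c = 2 * i + 1 := ⟨⟨c / 2, by omega⟩, by simp; omega⟩
      have h3 : (2 * (i : ℕ) + 1) / 2 = i := by omega
      -- The preimage of x under the state. It is the only position in the row with output x, since
      -- the state permutes the letters, so the search in `stepL` returns it.
      let y : Fin d := eX.symm (letter (eA i : G)⁻¹ (eX ⟨x, hx⟩))
      have hy : eX y = letter (eA i : G)⁻¹ (eX ⟨x, hx⟩) := by simp [y]
      have hy' : letter (eA i : G) (eX y) = eX ⟨x, hx⟩ := by
        have := letter_inv (eA i : G)⁻¹ (eX ⟨x, hx⟩)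
        rwa [inv_inv, ← hy] at this
      have hl : ((A.stateDiagram eX eA).2.getD i []).length = d := by
        simp [Automaton.stateDiagram, List.getD_eq_getElem?_getD]
      have hidx : ((A.stateDiagram eX eA).2.getD i []).findIdx (fun e => decide (e.1 = x)) = y := by
        have hget : ∀ z : Fin d, ((A.stateDiagram eX eA).2.getD i [])[(z : ℕ)]'(by
            rw [hl]; exact z.2) = ((A.stateDiagram eX eA).2.getD i []).getD z (0, 0) := by
          intro z
          exact (List.getD_eq_getElem _ _ (by rw [hl]; exact z.2)).symm
        rw [List.findIdx_eq (by rw [hl]; exact y.2)]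
        constructor
        · rw [hget, hrow, hy']
          simp
        · intro j hj
          have hjd : j < d := hj.trans y.2
          have h4 := hget ⟨j, hjd⟩
          dsimp only at h4
          rw [h4, hrow i ⟨j, hjd⟩]
          refine decide_eq_false fun h5 => ?_
          have h6 : letter (eA i : G) (eX ⟨j, hjd⟩) = letter (eA i : G) (eX y) := by
            rw [hy', ← Equiv.symm_apply_eq]
            exact Fin.ext h5
          have h7 := congrArg (letter (eA i : G)⁻¹) h6
          rw [letter_inv, letter_inv] at h7
          have := congrArg Fin.val (eX.injective h7)
          dsimp only at this
          omega
      rw [h3, hidx, hrow, hev1, show letterOf hd eX x = eX ⟨x, hx⟩ from hlX ⟨x, hx⟩, hlX, hev1]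
      refine ⟨⟨Fin.is_lt _, ?_⟩, hy, ?_⟩
      · have := (eA.symm ⟨sect (eA i : G) (eX y), A.sect_mem _ (eA i).2 _⟩).is_lt
        dsimp only
        omega
      · rw [← hy', sect_inv]
        simp
    · have h3 : c = 2 * n := by omega
      subst h3
      have h4 : stateOf A eA (2 * n) = 1 := by simp [stateOf]
      refine ⟨⟨hx, hc⟩, ?_, ?_⟩
      · rw [h4]
        have := smul_singleton (1 : G) (letterOf hd eX x)
        rw [one_smul] at this
        simpa using this
      · rw [h4]
        exact (sectWord_one (G := G) [letterOf hd eX x]).symm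
  · rw [hlen]; simp [stateOf]
  · intro g
    rw [hlen]
    have hg : g ∈ (Subgroup.closure (A.states : Set G)).toSubmonoid := by
      rw [show Subgroup.closure (A.states : Set G) = ⊤ from hA]
      trivial
    rw [Subgroup.closure_toSubmonoid] at hg
    obtain ⟨l, hl, rfl⟩ := Submonoid.exists_list_of_mem_closure hg
    obtain ⟨u, hu, rfl⟩ := exists_list_map_eq (P := fun c => c < 2 * n + 1)
      (f := stateOf A eA) l fun b hb => by
        rcases hl b hb with h | h
        · refine ⟨2 * (eA.symm ⟨b, h⟩ : Fin n), ?_, by rw [hev0]; simp⟩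
          have := (eA.symm ⟨b, h⟩).is_lt
          omega
        · refine ⟨2 * (eA.symm ⟨b⁻¹, h⟩ : Fin n) + 1, ?_, by rw [hev1]; simp⟩
          have := (eA.symm ⟨b⁻¹, h⟩).is_lt
          omega
    exact ⟨u, hu, rfl⟩

end Diagram

theorem isPrime_iff {p : ℕ} : IsPrime p ↔ p.Prime := by
  rw [Nat.prime_def_lt, IsPrime]
  simp only [List.mem_range, Nat.dvd_iff_mod_eq_zero]

/-- The given certificate only guarantees halting. The output may come from another one with smaller
code, so correctness has to rest on soundness of all certificates. -/
theorem exists_output {a : ℕ × Tbl} (h : ∃ c, CheckNone a c ∨ CheckSome a c) :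
    ∃ out ∈ decideSimple a, (out = none ∧ ∃ c, CheckNone a c) ∨
      ∃ c, CheckSome a c ∧ out = some c.2.2 := by
  classical
  have hdom : (decideSimple a).Dom := by
    obtain ⟨c, hc⟩ := h
    refine Nat.rfindOpt_dom.mpr ⟨Encodable.encode c, ?_⟩
    rw [attempt, Encodable.encodek, Option.bind_some]
    by_cases h1 : CheckNone a c
    · exact ⟨none, by rw [if_pos h1]; rfl⟩
    · exact ⟨some c.2.2, by rw [if_neg h1, if_pos (hc.resolve_left h1)]; rfl⟩
  refine ⟨_, Part.get_mem hdom, ?_⟩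
  obtain ⟨n, hn⟩ := Nat.rfindOpt_spec (Part.get_mem hdom)
  generalize (decideSimple a).get hdom = out at hn
  rw [attempt, Option.mem_def, Option.bind_eq_some_iff] at hn
  obtain ⟨c, -, hn⟩ := hn
  split_ifs at hn with h1 h2
  · exact Or.inl ⟨(Option.some.inj hn).symm, c, h1⟩
  · exact Or.inr ⟨c, h2, (Option.some.inj hn).symm⟩

namespace Interp

variable {G X : Type*} [Group G] [MulAction G (List X)] [SelfSimilarGroup G X]
  {t : Tbl} {d : ℕ} {lX : ℕ → X} {ev : ℕ → G}

theorem exists_check (I : Interp t d lX ev) [Nontrivial X] (hcon : IsContracting G X) :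
    ∃ c, CheckNone (d, t) c ∨ CheckSome (d, t) c := by
  classical
  obtain ⟨b, hb⟩ := I.exists_base hcon
  by_cases h0 : NoSing G X (ZMod 0)
  · obtain ⟨s, hs⟩ := I.exists_simpCert hb (Or.inr rfl) h0
    obtain ⟨E, hE⟩ := exists_list_forall_exists
      ((List.range (s.1 + 1)).filter fun p => p.Prime ∧ ¬ NoSing G X (ZMod p))
      (P := fun p e => NonCert t d b.1.1 b.1.2.1 b.2 p e) fun p hp =>
        I.exists_nonCert hb (of_decide_eq_true (List.mem_filter.mp hp).2).2
    obtain ⟨S, hS⟩ := exists_list_forall_exists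
      ((List.range (s.1 + 1)).filter fun p => p.Prime ∧ NoSing G X (ZMod p))
      (P := fun p e => SimpCert t d b.1.1 b.1.2.1 p e) fun p hp =>
        I.exists_simpCert hb (Or.inl (of_decide_eq_true (List.mem_filter.mp hp).2).1)
          (of_decide_eq_true (List.mem_filter.mp hp).2).2
    -- The exceptional primes are at most the denominator `s.1`; each prime up to this bound gets a
    -- certificate of one of the two kinds.
    refine ⟨(b, (E, (s, S)), (List.range (s.1 + 1)).filter fun p => p.Prime ∧ ¬ NoSing G X (ZMod p)),
      Or.inr ⟨hb, fun p hp => ⟨?_, hE p hp⟩, hs, fun p hp hpp => ?_⟩⟩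
    · exact isPrime_iff.mpr (of_decide_eq_true (List.mem_filter.mp hp).2).1
    · rw [isPrime_iff] at hpp
      by_cases hn : NoSing G X (ZMod p)
      · exact Or.inr (hS p (List.mem_filter.mpr ⟨hp, decide_eq_true ⟨hpp, hn⟩⟩))
      · exact Or.inl ⟨p, List.mem_filter.mpr ⟨hp, decide_eq_true ⟨hpp, hn⟩⟩, rfl⟩
  · obtain ⟨e, he⟩ := I.exists_nonCert hb h0
    exact ⟨(b, ([e], (default, [])), []), Or.inl ⟨hb, e, by simp, he⟩⟩

/-- The certificate concerns p = 0 only; failure modulo a prime follows because vanishing modulo a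
prime would imply vanishing over the integers. -/
theorem not_noSing_of_checkNone (I : Interp t d lX ev)
    [Finite X] {c : Cert} (hc : CheckNone (d, t) c) {p : ℕ}
    (hp : p.Prime ∨ p = 0) : ¬ NoSing G X (ZMod p) := by
  obtain ⟨hb, e, -, he⟩ := hc
  have h0 := I.not_noSing_of_nonCert hb he
  rcases hp with hp | rfl
  · exact fun h => h0 (noSing_int_of_zmod hp h)
  · exact h0

/-- A prime dividing the denominator is at most the denominator and was tested individually. In
every other characteristic, zero included, the characteristic zero certificate applies. -/
theorem noSing_iff_of_checkSome (I : Interp t d lX ev) {c : Cert} (hc : CheckSome (d, t) c) {p : ℕ}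
    (hp : p.Prime ∨ p = 0) : NoSing G X (ZMod p) ↔ p ∉ c.2.2 := by
  obtain ⟨hb, h1, h2, h3⟩ := hc
  constructor
  · intro h hpc
    obtain ⟨-, e, -, he⟩ := h1 p hpc
    exact I.not_noSing_of_nonCert hb he h
  · intro hpc
    by_cases hD : p ∣ c.2.1.2.1.1
    · have hD0 : c.2.1.2.1.1 ≠ 0 := by simpa using h2.1
      have hp0 : p.Prime := hp.resolve_right fun h => hD0 (by rw [h] at hD; exact zero_dvd_iff.mp hD)
      rcases h3 p (List.mem_range.mpr (Nat.lt_succ_of_le (Nat.le_of_dvd (by omega) hD)))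
        (isPrime_iff.mpr hp0) with ⟨q, hq, rfl⟩ | ⟨s, -, hs⟩
      · exact absurd hq hpc
      · exact I.noSing_of_simpCert hb hp dvd_rfl hs fun h => hs.1 (Nat.mod_eq_zero_of_dvd h)
    · exact I.noSing_of_simpCert hb hp (dvd_zero p) h2 hD

end Interp

end Decide

theorem isSimpleRing_iff_zmod (K : Type*) [Field K] {G X : Type*} [Fintype X] [Nontrivial X]
    [Group G] [MulAction G (List X)] [SelfSimilarGroup G X] :
    IsSimpleRing (NekrashevychAlgebra K G X) ↔ NoSing G X (ZMod (ringChar K)) := by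
  rw [isSimpleRing_iff_noSing, noSing_iff_zmod K (ringChar K)]

end SelfSimilarGroup

/-- First conjunct: for a contracting self-similar group generated by a finite automaton,
simplicity of the Nekrashevych algebra depends only on the characteristic of the field, and either
the algebra is non-simple over all fields, or there is a finite set of primes such that it is simple
exactly over the fields whose characteristic is not in that set. Second conjunct: a single algorithm
halts on the state diagram of every such automaton, decides which case holds, and in the second
case outputs that set of primes. It outputs `none` in the first case, and the list of the
exceptional primes in the second one. -/
theorem theoremt :
    (∀ (X : Type u) [Fintype X] (G : Type v) [Group G] [MulAction G (List X)]
        [SelfSimilarGroup G X], 2 ≤ Fintype.card X →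
        ∀ A : SelfSimilarGroup.Automaton G X, A.Generates →
        SelfSimilarGroup.IsContracting G X →
      (∀ (K : Type w) [Field K] (L : Type w') [Field L], ringChar K = ringChar L →
        (IsSimpleRing (SelfSimilarGroup.NekrashevychAlgebra K G X) ↔
          IsSimpleRing (SelfSimilarGroup.NekrashevychAlgebra L G X))) ∧
      ((∀ (K : Type w) [Field K],
          ¬ IsSimpleRing (SelfSimilarGroup.NekrashevychAlgebra K G X)) ∨
        ∃ P : Finset ℕ, (∀ p ∈ P, p.Prime) ∧ ∀ (K : Type w) [Field K],
          (IsSimpleRing (SelfSimilarGroup.NekrashevychAlgebra K G X) ↔ ringChar K ∉ P))) ∧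
    ∃ f : ℕ × List (List (ℕ × ℕ)) →. Option (List ℕ), Partrec f ∧
      ∀ (X : Type u) [Fintype X] (G : Type v) [Group G] [MulAction G (List X)]
        [SelfSimilarGroup G X], 2 ≤ Fintype.card X →
        ∀ A : SelfSimilarGroup.Automaton G X, A.Generates →
        SelfSimilarGroup.IsContracting G X →
        ∀ (d n : ℕ) (eX : Fin d ≃ X) (eA : Fin n ≃ A.states),
      ∃ out ∈ f (A.stateDiagram eX eA),
        (out = none ∧ ∀ (K : Type w) [Field K],
          ¬ IsSimpleRing (SelfSimilarGroup.NekrashevychAlgebra K G X)) ∨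
        ∃ P : List ℕ, out = some P ∧ (∀ p ∈ P, p.Prime) ∧ ∀ (K : Type w) [Field K],
          (IsSimpleRing (SelfSimilarGroup.NekrashevychAlgebra K G X) ↔ ringChar K ∉ P) := by
  have main : ∀ (X : Type u) [Fintype X] (G : Type v) [Group G] [MulAction G (List X)]
      [SelfSimilarGroup G X], 2 ≤ Fintype.card X →
      ∀ A : SelfSimilarGroup.Automaton G X, A.Generates →
      SelfSimilarGroup.IsContracting G X →
      ∀ (d n : ℕ) (eX : Fin d ≃ X) (eA : Fin n ≃ A.states),
      ∃ out ∈ SelfSimilarGroup.Decide.decideSimple (A.stateDiagram eX eA),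
        (out = none ∧ ∀ (K : Type w) [Field K],
          ¬ IsSimpleRing (SelfSimilarGroup.NekrashevychAlgebra K G X)) ∨
        ∃ P : List ℕ, out = some P ∧ (∀ p ∈ P, p.Prime) ∧ ∀ (K : Type w) [Field K],
          (IsSimpleRing (SelfSimilarGroup.NekrashevychAlgebra K G X) ↔ ringChar K ∉ P) := by
    intro X _ G _ _ _ hX A hA hcon d n eX eA
    have hnt : Nontrivial X := Fintype.one_lt_card_iff_nontrivial.mp (by omega)
    have hd : 0 < d := by
      have := Fintype.card_congr eX
      rw [Fintype.card_fin] at this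
      omega
    have I := SelfSimilarGroup.Decide.interp_stateDiagram A hA hd eX eA
    obtain ⟨out, hout, h⟩ := SelfSimilarGroup.Decide.exists_output
      (a := A.stateDiagram eX eA) (I.exists_check hcon)
    refine ⟨out, hout, ?_⟩
    rcases h with ⟨rfl, c, hc⟩ | ⟨c, hc, rfl⟩
    · refine Or.inl ⟨rfl, fun K _ => ?_⟩
      rw [SelfSimilarGroup.isSimpleRing_iff_zmod]
      exact I.not_noSing_of_checkNone hc (CharP.char_is_prime_or_zero K _)
    · refine Or.inr ⟨c.2.2, rfl, fun p hp =>
        SelfSimilarGroup.Decide.isPrime_iff.mp (hc.2.1 p hp).1, fun K _ => ?_⟩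
      rw [SelfSimilarGroup.isSimpleRing_iff_zmod]
      exact I.noSing_iff_of_checkSome hc (CharP.char_is_prime_or_zero K _)
  refine ⟨fun X _ G _ _ _ hX A hA hcon => ⟨fun K _ L _ hKL => ?_, ?_⟩,
    SelfSimilarGroup.Decide.decideSimple, SelfSimilarGroup.Decide.partrec_decideSimple, main⟩
  · have hnt : Nontrivial X := Fintype.one_lt_card_iff_nontrivial.mp (by omega)
    rw [SelfSimilarGroup.isSimpleRing_iff_zmod, SelfSimilarGroup.isSimpleRing_iff_zmod, hKL]
  -- The dichotomy is read off from the output of the algorithm for an arbitrary enumeration of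
  -- letters and states.
  · obtain ⟨out, -, ⟨-, h⟩ | ⟨P, -, hP, h⟩⟩ := main X G hX A hA hcon _ _ (Fintype.equivFin X).symm
      A.states.equivFin.symm
    · exact Or.inl h
    · exact Or.inr ⟨P.toFinset, fun p hp => hP p (List.mem_toFinset.mp hp), fun K _ => by
        rw [h K, List.mem_toFinset]⟩
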